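/- **Setting.** Let $\Lambda=3H^2>0$ ($H>0$), $\kappa>0$ and $1<b<2$. For $\mathbf p\in\mathbb R^3$ write $p=|\mathbf p|$. For $\mathbf p,\mathbf q\in\mathbb R^3$ and $\omega\in\mathbb S^2$ put $\varrho=\sqrt{2(pq-\mathbf p\cdot\mathbf q)}$, $$\mathbf p'=\tfrac12(\mathbf p+\mathbf q)+\tfrac12\varrho\,\omega+\tfrac12\frac{(\mathbf p+\mathbf q)\cdot\omega}{p+q+\varrho}(\mathbf p+\mathbf q),$$ and let $\mathbf q'$ be the same expression with $\omega$ replaced by $-\omega$. With the scattering cross-section $\sigma(h)=\kappa h^{-b}$, the massless Boltzmann equation in a spatially flat FLRW universe with scale factor $R(t)$ is, in proper time $t$, $$\partial_t F=R^{-1}\int_{\mathbb R^3}\int_{\mathbb S^2}\frac{h^2\sigma(h)}{pq}\big(F(\mathbf p')F(\mathbf q')-F(\mathbf p)F(\mathbf q)\big)\,d\omega\,d^3q,\qquad h=\varrho/R,\tag{1}$$ and, in the time $s$ with $ds=R^{b-3}dt$ and $s=0$ at $t=0$, $$\partial_s f=\kappa\int_{\mathbb R^3}\int_{\mathbb S^2}\frac{\varrho^{2-b}}{pq}\big(f(\mathbf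 p')f(\mathbf q')-f(\mathbf p)f(\mathbf q)\big)\,d\omega\,d^3q.\tag{2}$$ *Data* are isotropic, non-negative, not identically zero functions $f_0\in L^1(\mathbb R^3)$ with $\int f_0\,p^m\,d^3p<\infty$ for $-2\le m\le 2$. A *solution on $[0,T]$* with data $f_0$ is a non-negative isotropic $f\in C^1([0,T];L^1(\mathbb R^3))$ with $f(0)=f_0$ which satisfies (2), the collision integral converging absolutely for almost every $\mathbf p$, and for which there is a constant $C$ with $\int f(s,\mathbf p)p^m\,d^3p\le C$ for all $s\in[0,T]$ and $-1\le m\le 2$. The existence time $T(f_0)\in[0,\infty]$ is the supremum of all $T>0$ for which there is a solution on $[0,T]$ with data $f_0$. The scale factor belonging to $f_0$ is $R(t)=C_2\sqrt{\sinh(2Ht)}$, where $C_2>0$ is determined by $\int p f_0\,d^3p=\frac{3H^2}{8\pi}C_2^4$, and $$s(t)=\int_0^t R(t')^{b-3}\,dt',\qquad s_\infty(f_0)=\int_0^\infty R(t)^{b-3}\,dt .$$ **Statement.** Let $f_0$ be data. 1. The integral $s_\infty(f_0)$ converges and is positive, $s(0)=0$, and $t\mapsto s(t)$ is continuous and strictly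 increasing on $[0,\infty)$, with $ds/dt=R^{b-3}$ for $t>0$, and maps $[0,\infty)$ onto $[0,s_\infty(f_0))$. Thus the whole infinite range of proper time corresponds to a finite $s$-interval. 2. $T(f_0)>0$, and for every $\lambda>0$: for each $T>0$, a solution with data $f_0$ exists on $[0,T]$ if and only if a solution with data $\lambda f_0$ exists on $[0,\lambda^{-1}T]$. Moreover $$T(\lambda f_0)=\lambda^{-1}T(f_0),\qquad s_\infty(\lambda f_0)=\lambda^{(b-3)/4}s_\infty(f_0),\qquad \frac{T(\lambda f_0)}{s_\infty(\lambda f_0)}=\lambda^{-(1+b)/4}\,\frac{T(f_0)}{s_\infty(f_0)} .$$ 3. There is $\lambda_0>0$ such that for every $0<\lambda\le\lambda_0$ there are $T>s_\infty(\lambda f_0)$ and a solution $f$ on $[0,T]$ with data $\lambda f_0$, which is the only solution on $[0,T]$ with these data. Hence it exists for all proper time: with $R$ and $s(t)$ the scale factor and time belonging to $\lambda f_0$, the function $F(t)=f(s(t))$, $0\le t<\infty$, is non-negative and isotropic, is continuous into $L^1(\mathbb R^3)$ for $t\ge0$ and $C^1$ for $t>0$, has $F(0)=\lambda f_0$, satisfies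 (1) for all $t>0$ (the collision integral converging absolutely for almost every $\mathbf p$), and has its moments $\int F(t,\mathbf p)p^m\,d^3p$, $-1\le m\le2$, bounded uniformly in $t\ge0$ and $m$. Furthermore, $R$ is positive and $C^2$ for $t>0$, tends to $0$ as $t\to0^+$, and solves the Einstein equations $\dot R^2/R^2=\frac{8\pi}{3}\rho+\frac{\Lambda}{3}$ and $\ddot R/R=-\frac{8\pi}{3}\rho+\frac{\Lambda}{3}$ for $t>0$ with the energy density $\rho(t)=R(t)^{-4}\int p\,F(t,\mathbf p)\,d^3p$. -/

import Mathlib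

open MeasureTheory Set Filter Topology
open scoped ENNReal

noncomputable section

namespace FLRWBoltzmann

/-- Spatial momenta `𝐩 = (p₁, p₂, p₃)`, with Euclidean norm `p = |𝐩|`. -/
abbrev Mom : Type := EuclideanSpace ℝ (Fin 3)

/-- The unit sphere of scattering parameters `ω`. -/
abbrev Sph : Type := Metric.sphere (0 : Mom) 1

/-- The space `L¹(ℝ³)` of momentum distributions. -/
abbrev L1 : Type := Lp ℝ 1 (volume : Measure Mom)

/-- The measure `d³q dω`, with `dω` the standard surface measure of the sphere. -/
def collMeasure : Measure (Mom × Sph) :=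
  (volume : Measure Mom).prod (volume : Measure Mom).toSphere

/-- The rescaled relative momentum `ϱ = √(2 (p q - 𝐩 · 𝐪))`. -/
def relMom (p q : Mom) : ℝ :=
  Real.sqrt (2 * (‖p‖ * ‖q‖ - inner ℝ p q))

/-- The spatial momentum produced by a collision of massless particles with momenta `𝐩, 𝐪`:
`𝐩' = (𝐩+𝐪)/2 + ϱ ω / 2 + ((𝐩+𝐪)·ω) (𝐩+𝐪) / (2 (p + q + ϱ))`. -/
def postMom (p q w : Mom) : Mom :=
  (1 / 2 : ℝ) • (p + q) + (relMom p q / 2) • w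
    + (inner ℝ (p + q) w / (2 * (‖p‖ + ‖q‖ + relMom p q))) • (p + q)

/-- `f(p') f(q') - f(p) f(q)`, where `𝐪'` is obtained from `𝐩'` by changing the sign of `ω`. -/
def gainLoss (f : Mom → ℝ) (p q w : Mom) : ℝ :=
  f (postMom p q w) * f (postMom p q (-w)) - f p * f q

/-- The scattering cross-section `σ(h, Θ) = κ h ^ (-b)`. -/
def crossSection (κ b h : ℝ) : ℝ := κ * h ^ (-b)

/-! ### The Boltzmann equation in the regularised time `s` -/

/-- The integrand `κ ϱ^(2-b) / (p q) (f(p') f(q') - f(p) f(q))`. -/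
def collIntegrand (κ b : ℝ) (f : Mom → ℝ) (p : Mom) (z : Mom × Sph) : ℝ :=
  κ * (relMom p z.1 ^ (2 - b) / (‖p‖ * ‖z.1‖)) * gainLoss f p z.1 (z.2 : Mom)

/-- The collision operator of the Boltzmann equation in the time `s`. -/
def collision (κ b : ℝ) (f : Mom → ℝ) (p : Mom) : ℝ :=
  ∫ z, collIntegrand κ b f p z ∂collMeasure

/-- `f` depends on `𝐩` through `p = |𝐩|` only. -/
def IsIsotropic (f : L1) : Prop :=
  ∃ φ : ℝ → ℝ, Measurable φ ∧ ∀ᵐ p : Mom, f p = φ ‖p‖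

/-- Initial data: isotropic, non-negative, not identically zero, in `L¹(ℝ³)`, with finite moments
of all orders between `-2` and `2`. -/
structure IsData (f₀ : L1) : Prop where
  nonneg : 0 ≤ f₀
  ne_zero : f₀ ≠ 0
  isotropic : IsIsotropic f₀
  moments : ∀ m : ℝ, -2 ≤ m → m ≤ 2 → Integrable (fun p : Mom => f₀ p * ‖p‖ ^ m)

/-- `f` is a non-negative isotropic solution in `C¹([0,T]; L¹(ℝ³))`, with data `f₀` at `s = 0` and
with uniformly bounded moments of orders between `-1` and `2`, of the Boltzmann equation
`∂ₛ f = κ ∫∫ ϱ^(2-b) / (p q) (f(p') f(q') - f(p) f(q)) dω d³q`.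
Only the values of `f` on `[0,T]` matter. -/
structure IsSolution (κ b T : ℝ) (f₀ : L1) (f : ℝ → L1) : Prop where
  init : f 0 = f₀
  nonneg : ∀ s ∈ Icc 0 T, 0 ≤ f s
  isotropic : ∀ s ∈ Icc 0 T, IsIsotropic (f s)
  moments : ∃ C : ℝ, ∀ s ∈ Icc 0 T, ∀ m : ℝ, -1 ≤ m → m ≤ 2 →
    Integrable (fun p : Mom => f s p * ‖p‖ ^ m) ∧ ∫ p : Mom, f s p * ‖p‖ ^ m ≤ C
  converges : ∀ s ∈ Icc 0 T, ∀ᵐ p : Mom, Integrable (collIntegrand κ b (f s) p) collMeasure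
  equation : ∃ g : ℝ → L1, ContinuousOn g (Icc 0 T) ∧
    ∀ s ∈ Icc 0 T, HasDerivWithinAt f (g s) (Icc 0 T) s ∧
      ∀ᵐ p : Mom, g s p = collision κ b (f s) p

/-- There is a solution on `[0,T]` with data `f₀`. -/
def ExistsUpTo (κ b : ℝ) (f₀ : L1) (T : ℝ) : Prop :=
  ∃ f : ℝ → L1, IsSolution κ b T f₀ f

/-- The (maximal) existence time in `s`, possibly infinite: the supremum of all `T > 0` such that
there is a solution on `[0,T]`. -/
def existenceTime (κ b : ℝ) (f₀ : L1) : ℝ≥0∞ :=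
  ⨆ (T : ℝ) (_ : 0 < T ∧ ExistsUpTo κ b f₀ T), ENNReal.ofReal T

/-! ### The scale factor and the time `s` -/

/-- The constant `∫ p f d³p`, which equals `R⁴ρ`. -/
def energy (f : L1) : ℝ := ∫ p : Mom, ‖p‖ * f p

/-- The limiting Hubble parameter `H`, where `Λ = 3 H²`. -/
def hubble (Λ : ℝ) : ℝ := Real.sqrt (Λ / 3)

/-- The constant `C₂ > 0` with `∫ p f₀ d³p = 3 H² / (8 π) C₂⁴`. -/
def scaleConst (Λ : ℝ) (f₀ : L1) : ℝ :=
  (8 * Real.pi / (3 * hubble Λ ^ 2) * energy f₀) ^ (1 / 4 : ℝ)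

/-- The scale factor `R(t) = C₂ √(sinh (2 H t))`, `t ≥ 0`, of the universe with cosmological
constant `Λ > 0` and data `f₀` at the initial singularity `t = 0`. -/
def scaleFactor (Λ : ℝ) (f₀ : L1) (t : ℝ) : ℝ :=
  scaleConst Λ f₀ * Real.sqrt (Real.sinh (2 * hubble Λ * t))

/-- The regularised time `s` as a function of proper time: `ds = R^(b-3) dt`, with `s = 0` at
`t = 0`. -/
def sTime (Λ b : ℝ) (f₀ : L1) (t : ℝ) : ℝ :=
  ∫ t' in (0 : ℝ)..t, scaleFactor Λ f₀ t' ^ (b - 3)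

/-- The total lifetime `s_∞ = ∫₀^∞ R^(b-3) dt` in the time `s`. -/
def sInfinity (Λ b : ℝ) (f₀ : L1) : ℝ :=
  ∫ t in Ioi (0 : ℝ), scaleFactor Λ f₀ t ^ (b - 3)

/-! ### The Einstein-Boltzmann system in proper time `t` -/

/-- The Einstein equations on `t > 0` for the scale factor `R` of a spatially flat universe with
cosmological constant `Λ` and radiation of energy density `ρ`, with the initial singularity at
`t = 0`. -/
structure SolvesEinstein (Λ : ℝ) (R ρ : ℝ → ℝ) : Prop where
  pos : ∀ t, 0 < t → 0 < R t
  singular : Tendsto R (𝓝[>] 0) (𝓝 0)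
  smooth : ContDiffOn ℝ 2 R (Ioi 0)
  first : ∀ t, 0 < t → (deriv R t / R t) ^ 2 = 8 * Real.pi / 3 * ρ t + Λ / 3
  second : ∀ t, 0 < t → deriv (deriv R) t / R t = -(8 * Real.pi / 3) * ρ t + Λ / 3

/-- The energy density `ρ = R⁻⁴ ∫ p f d³p`. -/
def energyDensity (R : ℝ → ℝ) (F : ℝ → L1) (t : ℝ) : ℝ := (R t ^ 4)⁻¹ * energy (F t)

/-- The integrand `h² σ(h) / (p q) (f(p') f(q') - f(p) f(q))`, with `h = ϱ / R` the relative
momentum in the physical metric (`h²` is the squared total energy). -/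
def physIntegrand (κ b R : ℝ) (f : Mom → ℝ) (p : Mom) (z : Mom × Sph) : ℝ :=
  (relMom p z.1 / R) ^ 2 * crossSection κ b (relMom p z.1 / R) / (‖p‖ * ‖z.1‖)
    * gainLoss f p z.1 (z.2 : Mom)

/-- `F` is, for all proper times `0 ≤ t < ∞`, a non-negative isotropic solution, continuous into
`L¹(ℝ³)` for `t ≥ 0` and continuously differentiable for `t > 0`, with data `f₀` at the initial
singularity `t = 0` and with bounded moments of orders between `-1` and `2`, of
`∂ₜ F = R⁻¹ ∫∫ h² σ(h) / (p q) (F(p') F(q') - F(p) F(q)) dω d³q`. -/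
structure IsProperTimeSolution (κ b : ℝ) (R : ℝ → ℝ) (f₀ : L1) (F : ℝ → L1) : Prop where
  init : F 0 = f₀
  continuousOn : ContinuousOn F (Ici 0)
  nonneg : ∀ t, 0 ≤ t → 0 ≤ F t
  isotropic : ∀ t, 0 ≤ t → IsIsotropic (F t)
  moments : ∃ C : ℝ, ∀ t, 0 ≤ t → ∀ m : ℝ, -1 ≤ m → m ≤ 2 →
    Integrable (fun p : Mom => F t p * ‖p‖ ^ m) ∧ ∫ p : Mom, F t p * ‖p‖ ^ m ≤ C
  converges : ∀ t, 0 < t →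
    ∀ᵐ p : Mom, Integrable (physIntegrand κ b (R t) (F t) p) collMeasure
  equation : ∃ G : ℝ → L1, ContinuousOn G (Ioi 0) ∧
    ∀ t, 0 < t → HasDerivAt F (G t) t ∧
      ∀ᵐ p : Mom, G t p = (R t)⁻¹ * ∫ z, physIntegrand κ b (R t) (F t) p z ∂collMeasure

end FLRWBoltzmann

end

open FLRWBoltzmann

open scoped NNReal

noncomputable section

namespace FLRWBoltzmann

/-! The argument is radial. Writing an isotropic `f` as `n(|𝐩|)/|𝐩|²`, the energy `|𝐩'|` after a
collision is uniformly distributed in `ω`, and in the variable `u = ϱ²` the collision integral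
collapses to a kernel `kerE b p q x` on energies (`lintegral_collMeasure`). Three facts about this
kernel carry everything. Its total mass in `x` is `c (pq)^(2-b/2)`, so the loss term is a constant
times the scalar `mom (-(b/2)) n` times `r^(-b/2) n`. It is invariant under exchange of the states
before and after the collision (`measurePreserving_collSwap`), which yields the weak form of the
gain term and the conservation of number and energy. And its integrals against `x²`, `x^(-b/2)` and
`(x+ε)⁻²` are bounded by products of functions of `p` and `q`.

Local existence (`exists_isRadSolution`): with the weight `r⁻² + r²` the gain term is a bounded
quadratic map of an `L¹` space. The loss term is unbounded, but it is a scalar functional times a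
fixed multiplication operator; taking the integrated loss rate as new time turns it into a linear
contraction semigroup. Duhamel's formula, the contraction principle and the inverse change of time
then give a solution.

Uniqueness (`IsRadSolution.eqOn`): the difference of two solutions is measured with the weight
`r^(-b/2)`, and the stability estimate needs a moment of order `-b`, which lies below the order `-1`
granted by the definition of a solution. The missing bound comes from the data:
`IsRadSolution.exists_mom_neg_two_le` propagates the moment of order `-2`. There the gain is
absorbed by the loss, whose rate stays away from zero because number and energy are conserved.

Global existence in proper time needs no existence for all `s`. The integral `s_∞` is finite because
`R` behaves like `t^(1/2)` at the singularity, where `b > 1` is used, and grows at least linearly,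
where `b < 2` is used. The collision term is quadratic, so the existence time scales like `λ⁻¹`
(`existenceTime_smul`), whereas `R` scales like `λ^(1/4)` and `s_∞` like `λ^((b-3)/4)`
(`sInfinity_smul`). The quotient behaves like `λ^(-(1+b)/4)` and exceeds `1` for small `λ`
(`exists_smallness`). The Einstein equations hold because energy is conserved, so that `ρ` is a
constant times `R⁻⁴` and the explicit `R` can be inserted. -/

/-- The surface measure `dω` of the unit sphere. -/
abbrev sphMeasure : Measure Sph := (volume : Measure Mom).toSphere

/-! ### Kinematics of a massless collision -/

lemma norm_sph (w : Sph) : ‖(w : Mom)‖ = 1 := by simp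

lemma relMom_nonneg (p q : Mom) : 0 ≤ relMom p q := Real.sqrt_nonneg _

lemma relMom_sq (p q : Mom) : relMom p q ^ 2 = 2 * (‖p‖ * ‖q‖ - inner ℝ p q) :=
  Real.sq_sqrt (by linarith [real_inner_le_norm p q])

lemma norm_add_sq_relMom (p q : Mom) : ‖p + q‖ ^ 2 = (‖p‖ + ‖q‖) ^ 2 - relMom p q ^ 2 := by
  rw [relMom_sq, norm_add_sq_real]; ring

/-- Squaring the formula for `𝐩'` and using `|𝐩+𝐪|² = (p+q)² - ϱ²` produces a perfect square, so the
outgoing energy is affine in the component of `ω` along `𝐩+𝐪`. Reversing `ω` then gives energy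
conservation. -/
lemma norm_postMom (p q : Mom) (w : Sph) :
    ‖postMom p q w‖ = (‖p‖ + ‖q‖ + inner ℝ (p + q) (w : Mom)) / 2 := by
  have hw := norm_sph w
  set E := ‖p‖ + ‖q‖ with hE
  set t := inner ℝ (p + q) (w : Mom) with ht
  set r := relMom p q with hr
  have hr0 : 0 ≤ r := relMom_nonneg p q
  have hE0 : 0 ≤ E := by positivity
  have hP := norm_add_sq_relMom p q
  have hbd : |t| ≤ E := by
    calc |t| ≤ ‖p + q‖ * ‖(w : Mom)‖ := abs_real_inner_le_norm _ _
      _ ≤ E := by rw [hw, mul_one]; exact norm_add_le _ _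
  have hnn : 0 ≤ (E + t) / 2 := by linarith [neg_abs_le t]
  rcases hE0.eq_or_lt with h0 | hEpos
  -- The quotient in the definition of `postMom` is `0/0` only when both momenta vanish.
  · have hp : p = 0 := by
      have : ‖p‖ = 0 := by linarith [norm_nonneg p, norm_nonneg q]
      simpa using this
    have hq : q = 0 := by
      have : ‖q‖ = 0 := by linarith [norm_nonneg p, norm_nonneg q]
      simpa using this
    have ht0 : t = 0 := by rw [ht, hp, hq]; simp
    have hr0 : r = 0 := by rw [hr, hp, hq]; simp [relMom]
    rw [ht0, ← h0]
    unfold postMom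
    rw [← hr, hr0, hp, hq]; simp
  · have key : postMom p q w = ((E + r + t) / (2 * (E + r))) • (p + q) + (r / 2) • (w : Mom) := by
      have : (E + r + t) / (2 * (E + r)) = 1 / 2 + t / (2 * (E + r)) := by
        field_simp
      rw [this, add_smul]; unfold postMom; rw [← hr, ← ht, ← hE]; abel
    have : ‖postMom p q w‖ ^ 2 = ((E + t) / 2) ^ 2 := by
      rw [key, norm_add_sq_real, norm_smul, norm_smul, inner_smul_left, inner_smul_right, hw,
        mul_pow, hP, ← ht]
      simp only [Real.norm_eq_abs, sq_abs, RCLike.conj_to_real, mul_pow, one_pow]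
      have : E + r ≠ 0 := by positivity
      field_simp
      ring
    exact (sq_eq_sq₀ (norm_nonneg _) hnn).1 this

lemma inner_neg_sph (P : Mom) (w : Sph) : inner ℝ P ((-w : Sph) : Mom) = -inner ℝ P (w : Mom) := by
  simp

lemma norm_postMom_neg (p q : Mom) (w : Sph) :
    ‖postMom p q (-(w : Mom))‖ = ‖p‖ + ‖q‖ - ‖postMom p q w‖ := by
  have h := norm_postMom p q (-w)
  rw [inner_neg_sph] at h
  have h' : postMom p q (-(w : Mom)) = postMom p q ((-w : Sph) : Mom) := by simp
  rw [h', h, norm_postMom]; ring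

/-! ### Polar coordinates and Archimedes' theorem -/

lemma lintegral_polar {f : Mom → ℝ≥0∞} (hf : Measurable f) :
    ∫⁻ x, f x = ∫⁻ r in Ioi (0 : ℝ), ENNReal.ofReal (r ^ 2) * ∫⁻ w : Sph, f (r • (w : Mom)) ∂sphMeasure := by
  have hmp := (volume : Measure Mom).measurePreserving_homeomorphUnitSphereProd
  have h1 : ∫⁻ x, f x = ∫⁻ x : ({(0 : Mom)}ᶜ : Set Mom), f x.1 ∂((volume : Measure Mom).comap (↑)) := by
    rw [lintegral_subtype_comap (measurableSet_singleton (0 : Mom)).compl f, restrict_compl_singleton]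
  have h2 : ∫⁻ x : ({(0 : Mom)}ᶜ : Set Mom), f x.1 ∂((volume : Measure Mom).comap (↑)) =
      ∫⁻ y : Sph × Ioi (0 : ℝ), f (y.2.1 • (y.1 : Mom)) ∂(sphMeasure.prod (Measure.volumeIoiPow 2)) := by
    have h3 : Module.finrank ℝ Mom - 1 = 2 := by simp
    rw [h3] at hmp
    have := hmp.lintegral_comp (f := fun y : Sph × Ioi (0 : ℝ) => f (y.2.1 • (y.1 : Mom))) (by fun_prop)
    rw [← this]
    refine lintegral_congr fun x => ?_
    congr 1
    have hx : (x : Mom) ≠ 0 := x.2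
    simp [smul_smul, hx]
  rw [h1, h2, lintegral_prod_symm' _ (by fun_prop), Measure.volumeIoiPow]
  rw [lintegral_withDensity_eq_lintegral_mul _ (by fun_prop)]
  · exact lintegral_subtype_comap measurableSet_Ioi
      (fun r : ℝ => ENNReal.ofReal (r ^ 2) * ∫⁻ w : Sph, f (r • (w : Mom)) ∂sphMeasure)
  · exact Measurable.lintegral_prod_left' (f := fun y : Sph × Ioi (0 : ℝ) => f (y.2.1 • (y.1 : Mom))) (by fun_prop)


lemma lintegral_sq_add_sq {g : ℝ → ℝ≥0∞} (hg : Measurable g) :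
    ∫⁻ y : ℝ × ℝ, g (y.1 ^ 2 + y.2 ^ 2) = ENNReal.ofReal Real.pi * ∫⁻ v in Ioi (0 : ℝ), g v := by
  rw [← lintegral_comp_polarCoord_symm]
  have h1 : ∀ p : ℝ × ℝ, (polarCoord.symm p).1 ^ 2 + (polarCoord.symm p).2 ^ 2 = p.1 ^ 2 := by
    intro p; simp only [polarCoord_symm_apply]
    have := Real.sin_sq_add_cos_sq p.2
    linear_combination p.1 ^ 2 * this
  simp only [h1, polarCoord_target]
  rw [Measure.volume_eq_prod, ← Measure.prod_restrict, lintegral_prod _ (by fun_prop)]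
  simp only [lintegral_const, smul_eq_mul, Measure.restrict_apply MeasurableSet.univ, univ_inter, Real.volume_Ioo]
  have h2 : ∫⁻ v in Ioi (0 : ℝ), g v = ∫⁻ r in Ioi (0 : ℝ), ENNReal.ofReal (2 * r) * g (r ^ 2) := by
    have him : (fun r : ℝ => r ^ 2) '' Ioi 0 = Ioi 0 := by
      ext v; constructor
      · rintro ⟨r, hr, rfl⟩; exact pow_pos (mem_Ioi.1 hr) 2
      · intro hv; exact ⟨√v, Real.sqrt_pos.2 hv, Real.sq_sqrt (le_of_lt hv)⟩
    have := lintegral_image_eq_lintegral_abs_deriv_mul (f := fun r : ℝ => r ^ 2) (f' := fun r => 2 * r)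
      measurableSet_Ioi (fun x _ => by simpa using (hasDerivAt_pow 2 x).hasDerivWithinAt)
      (fun x hx y hy h => (sq_eq_sq₀ (le_of_lt hx) (le_of_lt hy)).1 h) g
    rw [him] at this
    rw [this]
    refine setLIntegral_congr_fun measurableSet_Ioi fun r hr => ?_
    rw [abs_of_pos (by linarith [mem_Ioi.1 hr])]
  rw [h2, ← lintegral_const_mul _ (by fun_prop)]
  refine setLIntegral_congr_fun measurableSet_Ioi fun r hr => ?_
  have hr' : (0 : ℝ) < r := hr
  rw [mul_right_comm, ← mul_assoc, ← ENNReal.ofReal_mul hr'.le, ← ENNReal.ofReal_mul Real.pi_pos.le]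
  congr 2
  ring

/-- The pair `(x₀, |x|²)` has the constant density `π` on `{w > z²}`: for fixed `x₀` the other two
coordinates contribute the area element of a disc, which is `π` times the differential of the
squared radius. This is Archimedes' theorem in volume form. -/
lemma lintegral_coord_norm_sq {f : ℝ → ℝ → ℝ≥0∞} (hf : Measurable (Function.uncurry f)) :
    ∫⁻ x : Mom, f (x 0) (‖x‖ ^ 2) =
      ENNReal.ofReal Real.pi * ∫⁻ z : ℝ, ∫⁻ w in Ioi (z ^ 2), f z w := by
  have hf' : Measurable (fun y : ℝ × ℝ => f y.1 y.2) := hf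
  have e1 := (PiLp.volume_preserving_toLp (Fin 3)).lintegral_comp
    (f := fun x : Mom => f (x 0) (‖x‖ ^ 2)) (hf.comp (by fun_prop : Measurable fun x : Mom => (x 0, ‖x‖ ^ 2)))
  rw [← e1]
  have e2 := (volume_preserving_piFinSuccAbove (fun _ : Fin 3 => ℝ) 0).symm.lintegral_comp
    (f := fun x : Fin 3 → ℝ => f (x 0) (x 0 ^ 2 + (x 1 ^ 2 + x 2 ^ 2)))
    (hf.comp (by fun_prop : Measurable fun x : Fin 3 → ℝ => (x 0, x 0 ^ 2 + (x 1 ^ 2 + x 2 ^ 2))))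
  have e3 : ∀ x : Fin 3 → ℝ, f ((WithLp.toLp 2 x : Mom) 0) (‖(WithLp.toLp 2 x : Mom)‖ ^ 2) =
      f (x 0) (x 0 ^ 2 + (x 1 ^ 2 + x 2 ^ 2)) := by
    intro x
    rw [EuclideanSpace.norm_sq_eq, Fin.sum_univ_three]
    simp [add_assoc]
  simp only [e3]
  rw [← e2]
  rw [Measure.volume_eq_prod]
  have hm1 : Measurable (fun a : ℝ × (Fin 2 → ℝ) => f a.1 (a.1 ^ 2 + (a.2 0 ^ 2 + a.2 1 ^ 2))) :=
    hf.comp (by fun_prop : Measurable fun a : ℝ × (Fin 2 → ℝ) => (a.1, a.1 ^ 2 + (a.2 0 ^ 2 + a.2 1 ^ 2)))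
  have e4 : ∀ a : ℝ × (Fin 2 → ℝ), f (((MeasurableEquiv.piFinSuccAbove (fun _ : Fin 3 => ℝ) 0).symm a) 0)
      (((MeasurableEquiv.piFinSuccAbove (fun _ : Fin 3 => ℝ) 0).symm a) 0 ^ 2 + 
      (((MeasurableEquiv.piFinSuccAbove (fun _ : Fin 3 => ℝ) 0).symm a) 1 ^ 2 + 
      ((MeasurableEquiv.piFinSuccAbove (fun _ : Fin 3 => ℝ) 0).symm a) 2 ^ 2)) = 
      f a.1 (a.1 ^ 2 + (a.2 0 ^ 2 + a.2 1 ^ 2)) := by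
    intro a; rfl
  refine (lintegral_congr e4).trans ?_
  rw [lintegral_prod _ hm1.aemeasurable]
  rw [← lintegral_const_mul _ (by
    have : ∀ z : ℝ, ∫⁻ w in Ioi (z ^ 2), f z w = ∫⁻ w, (if z ^ 2 < w then f z w else 0) := by
      intro z; rw [← lintegral_indicator measurableSet_Ioi]; rfl
    simp only [this]
    refine Measurable.lintegral_prod_right' (f := fun y : ℝ × ℝ => if y.1 ^ 2 < y.2 then f y.1 y.2 else 0) ?_
    exact Measurable.ite (measurableSet_lt (by fun_prop) (by fun_prop)) hf' measurable_const)]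
  refine lintegral_congr fun z => ?_
  have hz : Measurable (fun v => f z (z ^ 2 + v)) := hf.comp (by fun_prop : Measurable fun v : ℝ => (z, z ^ 2 + v))
  have e5 := (volume_preserving_finTwoArrow ℝ).lintegral_comp
    (f := fun y : ℝ × ℝ => f z (z ^ 2 + (y.1 ^ 2 + y.2 ^ 2))) (hz.comp (by fun_prop : Measurable fun y : ℝ × ℝ => y.1 ^ 2 + y.2 ^ 2))
  have e6 : ∫⁻ y : Fin 2 → ℝ, f z (z ^ 2 + (y 0 ^ 2 + y 1 ^ 2)) = 
     ∫⁻ y : ℝ × ℝ, f z (z ^ 2 + (y.1 ^ 2 + y.2 ^ 2)) := e5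
  rw [e6, lintegral_sq_add_sq hz]
  congr 1
  have := (measurePreserving_add_left (volume : Measure ℝ) (z ^ 2)).setLIntegral_comp_preimage (s := Ioi (z ^ 2)) measurableSet_Ioi
     (f := f z) (hf.comp (by fun_prop : Measurable fun v : ℝ => (z, v)))
  rw [← this]
  simp

lemma lintegral_Ioo_affine {a c : ℝ} (ha : 0 < a) (l u : ℝ) (g : ℝ → ℝ≥0∞) :
    ∫⁻ x in Ioo (a * l + c) (a * u + c), g x =
      ENNReal.ofReal a * ∫⁻ t in Ioo l u, g (a * t + c) := by
  have him : (fun t : ℝ => a * t + c) '' Ioo l u = Ioo (a * l + c) (a * u + c) := by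
    ext x; constructor
    · rintro ⟨t, ht, rfl⟩
      exact ⟨by have := mul_lt_mul_of_pos_left ht.1 ha; linarith,
        by have := mul_lt_mul_of_pos_left ht.2 ha; linarith⟩
    · intro hx
      refine ⟨(x - c) / a, ⟨?_, ?_⟩, ?_⟩
      · rw [lt_div_iff₀ ha]; linarith [hx.1]
      · rw [div_lt_iff₀ ha]; linarith [hx.2]
      · simp only []; field_simp; ring
  have := lintegral_image_eq_lintegral_abs_deriv_mul (f := fun t : ℝ => a * t + c) (f' := fun _ => a)
    measurableSet_Ioo (fun x _ => by simpa using (((hasDerivAt_id x).const_mul a).add_const c).hasDerivWithinAt)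
    (fun x _ y _ h => mul_left_cancel₀ ha.ne' (add_right_cancel h)) g (s := Ioo l u)
  rw [him] at this
  rw [this, abs_of_pos ha, lintegral_const_mul' _ _ ENNReal.ofReal_ne_top]

lemma exists_orthonormalBasis_zero {e : Mom} (he : ‖e‖ = 1) :
    ∃ b : OrthonormalBasis (Fin 3) ℝ Mom, b 0 = e := by
  obtain ⟨b, hb⟩ := Orthonormal.exists_orthonormalBasis_extension_of_card_eq (𝕜 := ℝ) (E := Mom)
    (ι := Fin 3) (by simp) (v := fun _ => e) (s := {0}) (by
      constructor
      · intro i; simpa using he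
      · intro i j hij; exact absurd (Subsingleton.elim i j) hij)
  exact ⟨b, hb 0 rfl⟩

lemma lintegral_inner_norm_sq {e : Mom} (he : ‖e‖ = 1) {f : ℝ → ℝ → ℝ≥0∞}
    (hf : Measurable (Function.uncurry f)) :
    ∫⁻ x : Mom, f (inner ℝ e x) (‖x‖ ^ 2) =
      ENNReal.ofReal Real.pi * ∫⁻ z : ℝ, ∫⁻ w in Ioi (z ^ 2), f z w := by
  obtain ⟨b, rfl⟩ := exists_orthonormalBasis_zero he
  have h := b.measurePreserving_repr.lintegral_comp (f := fun x : Mom => f (x 0) (‖x‖ ^ 2))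
    (hf.comp (by fun_prop : Measurable fun x : Mom => (x 0, ‖x‖ ^ 2)))
  rw [← lintegral_coord_norm_sq hf, ← h]
  simp [b.repr_apply_apply]

/-- The homogeneous function `H(e·x/|x|)` on the unit ball is integrated twice: in polar
coordinates, giving the factor `∫ r² = 1/3`, and in the variables `(e·x, |x|²)`, giving `π ∫ √w =
2π/3`. Comparing the two results yields the claim. -/
lemma lintegral_inner_sphere_unit {e : Mom} (he : ‖e‖ = 1) {H : ℝ → ℝ≥0∞} (hH : Measurable H) :
    ∫⁻ w : Sph, H (inner ℝ e (w : Mom)) ∂sphMeasure =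
      ENNReal.ofReal (2 * Real.pi) * ∫⁻ c in Ioo (-1 : ℝ) 1, H c := by
  set f : ℝ → ℝ → ℝ≥0∞ := fun z w => (Iio (1 : ℝ)).indicator (fun _ => H (z / √w)) w with hfdef
  have hf : Measurable (Function.uncurry f) := by
    have : Function.uncurry f = (Prod.snd ⁻¹' Iio (1 : ℝ)).indicator
        (fun y : ℝ × ℝ => H (y.1 / √y.2)) := by
      ext y; rfl
    rw [this]
    exact (hH.comp (by fun_prop)).indicator (measurable_snd measurableSet_Iio)
  have hA := lintegral_inner_norm_sq he hf
  have hfm : Measurable fun x : Mom => f (inner ℝ e x) (‖x‖ ^ 2) :=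
    hf.comp (by fun_prop : Measurable fun x : Mom => (inner ℝ e x, ‖x‖ ^ 2))
  rw [lintegral_polar hfm] at hA
  have h1 : ∫⁻ r in Ioi (0 : ℝ), ENNReal.ofReal (r ^ 2) *
      ∫⁻ w : Sph, f (inner ℝ e (r • (w : Mom))) (‖r • (w : Mom)‖ ^ 2) ∂sphMeasure =
      (∫⁻ r in Ioo (0 : ℝ) 1, ENNReal.ofReal (r ^ 2)) * ∫⁻ w : Sph, H (inner ℝ e (w : Mom)) ∂sphMeasure := by
    rw [← lintegral_mul_const _ (by fun_prop), ← lintegral_indicator measurableSet_Ioi,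
      ← lintegral_indicator measurableSet_Ioo]
    refine lintegral_congr fun r => ?_
    by_cases hr : 0 < r
    · have hn : ∀ w : Sph, ‖r • (w : Mom)‖ ^ 2 = r ^ 2 := by
        intro w; rw [norm_smul, norm_sph, mul_one]; simp
      have hval : ∀ w : Sph, f (inner ℝ e (r • (w : Mom))) (‖r • (w : Mom)‖ ^ 2) =
          (Iio (1 : ℝ)).indicator (fun _ => H (inner ℝ e (w : Mom))) (r ^ 2) := by
        intro w
        rw [hn, inner_smul_right]
        simp only [hfdef, Real.sqrt_sq hr.le, mul_div_cancel_left₀ _ hr.ne']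
      by_cases hr1 : r < 1
      · have : r ^ 2 < 1 := by nlinarith
        simp only [indicator, mem_Ioi, mem_Iio, mem_Ioo, hr, hval, hr1, this, if_true, and_self]
      · have : ¬ r ^ 2 < 1 := by nlinarith
        simp only [indicator, mem_Ioi, mem_Iio, mem_Ioo, hr, hval, hr1, this, if_true, if_false,
          and_false, lintegral_zero, mul_zero]
    · simp [indicator, hr]
  have h2 : ∫⁻ z : ℝ, ∫⁻ w in Ioi (z ^ 2), f z w =
      (∫⁻ w in Ioo (0 : ℝ) 1, ENNReal.ofReal √w) * ∫⁻ c in Ioo (-1 : ℝ) 1, H c := by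
    have e1 : ∀ z : ℝ, ∫⁻ w in Ioi (z ^ 2), f z w = ∫⁻ w, (if z ^ 2 < w then f z w else 0) := by
      intro z; rw [← lintegral_indicator measurableSet_Ioi]; rfl
    simp only [e1]
    rw [lintegral_lintegral_swap]
    · rw [← lintegral_mul_const _ (by fun_prop), ← lintegral_indicator measurableSet_Ioo]
      refine lintegral_congr fun w => ?_
      by_cases hw : 0 < w ∧ w < 1
      · have hs : 0 < √w := Real.sqrt_pos.2 hw.1
        have := lintegral_Ioo_affine (c := 0) hs (-1) 1 (fun z => H (z / √w))
        simp only [add_zero, mul_div_cancel_left₀ _ hs.ne'] at this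
        rw [indicator_of_mem (show w ∈ Ioo 0 1 from hw), ← this,
          ← lintegral_indicator measurableSet_Ioo]
        refine lintegral_congr fun z => ?_
        have hz : z ^ 2 < w ↔ z ∈ Ioo (√w * -1) (√w * 1) := by
          rw [mul_neg, mul_one, mem_Ioo, ← abs_lt, ← Real.sqrt_lt_sqrt_iff (sq_nonneg z), Real.sqrt_sq_eq_abs]
        by_cases h : z ^ 2 < w
        · rw [if_pos h, indicator_of_mem (hz.1 h)]; simp [hfdef, hw.2]
        · rw [if_neg h, indicator_of_notMem (fun h' => h (hz.2 h'))]
      · rw [indicator_of_notMem (show w ∉ Ioo 0 1 from hw)]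
        refine (lintegral_congr fun z => ?_).trans lintegral_zero
        split_ifs with h
        · have : ¬ w < 1 := fun h' => hw ⟨lt_of_le_of_lt (sq_nonneg z) h, h'⟩
          simp [hfdef, this]
        · rfl
    · exact (Measurable.ite (measurableSet_lt (by fun_prop) (by fun_prop)) hf measurable_const).aemeasurable
  rw [h1, h2] at hA
  have i1 : ∫⁻ r in Ioo (0 : ℝ) 1, ENNReal.ofReal (r ^ 2) = ENNReal.ofReal (1 / 3) := by
    rw [← ofReal_integral_eq_lintegral_ofReal, ← integral_Ioc_eq_integral_Ioo,
      ← intervalIntegral.integral_of_le zero_le_one, integral_pow]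
    · norm_num
    · exact (intervalIntegral.intervalIntegrable_pow 2).1.mono_set Ioo_subset_Ioc_self
    · exact .of_forall fun x => sq_nonneg x
  have i2 : ∫⁻ w in Ioo (0 : ℝ) 1, ENNReal.ofReal √w = ENNReal.ofReal (2 / 3) := by
    have : ∀ w : ℝ, √w = w ^ (1 / 2 : ℝ) := Real.sqrt_eq_rpow
    simp only [this]
    rw [← ofReal_integral_eq_lintegral_ofReal, ← integral_Ioc_eq_integral_Ioo,
      ← intervalIntegral.integral_of_le zero_le_one, integral_rpow (by norm_num)]
    · norm_num
    · exact (intervalIntegral.intervalIntegrable_rpow' (by norm_num)).1.mono_set Ioo_subset_Ioc_self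
    · filter_upwards [ae_restrict_mem measurableSet_Ioo] with x hx
      exact Real.rpow_nonneg hx.1.le _
  rw [i1, i2] at hA
  have h3 : ∀ a : ℝ≥0∞, ENNReal.ofReal 3 * (ENNReal.ofReal (1 / 3) * a) = a := by
    intro a; rw [← mul_assoc, ← ENNReal.ofReal_mul (by norm_num)]; norm_num
  have := congrArg (fun a => ENNReal.ofReal 3 * a) hA
  simp only [h3] at this
  rw [this, ← mul_assoc, ← mul_assoc, ← ENNReal.ofReal_mul (by norm_num),
    ← ENNReal.ofReal_mul (by positivity)]
  congr 2; ring

/-- Archimedes' hat-box theorem. -/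
lemma lintegral_inner_sphere {P : Mom} (hP : P ≠ 0) {H : ℝ → ℝ≥0∞} (hH : Measurable H) :
    ∫⁻ w : Sph, H (inner ℝ P (w : Mom)) ∂sphMeasure =
      ENNReal.ofReal (2 * Real.pi) * ∫⁻ c in Ioo (-1 : ℝ) 1, H (‖P‖ * c) := by
  have hn : ‖P‖ ≠ 0 := norm_ne_zero_iff.2 hP
  rw [← lintegral_inner_sphere_unit (e := ‖P‖⁻¹ • P) (by simp [norm_smul, hn])
    (H := fun c => H (‖P‖ * c)) (by fun_prop)]
  refine lintegral_congr fun w => ?_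
  rw [inner_smul_left]
  simp [hn]

/-! ### The energy kernel and the radial reduction -/

/-- The kernel of the radially reduced collision operator, with values in `[0, ∞]`: the rate at which
particles of energies `p, q` produce particles of energies `x, p + q - x`. -/
def kerE (b p q x : ℝ) : ℝ≥0∞ :=
  ∫⁻ u in Ioo 0 (4 * min (p * q) (x * (p + q - x))), ENNReal.ofReal (u ^ (1 - b / 2) / √((p + q) ^ 2 - u))

/-- By `norm_postMom` and Archimedes' theorem the outgoing energy is uniform on an interval of
length `|𝐩+𝐪|` centred at half the total energy. -/
lemma lintegral_postMom {p q : Mom} (hP : p + q ≠ 0) {g : ℝ → ℝ≥0∞} (hg : Measurable g) :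
    ∫⁻ w : Sph, g ‖postMom p q w‖ ∂sphMeasure = ENNReal.ofReal (4 * Real.pi / ‖p + q‖) *
      ∫⁻ x in Ioo ((‖p‖ + ‖q‖ - ‖p + q‖) / 2) ((‖p‖ + ‖q‖ + ‖p + q‖) / 2), g x := by
  have hn : 0 < ‖p + q‖ := norm_pos_iff.2 hP
  simp only [norm_postMom]
  rw [lintegral_inner_sphere hP (H := fun t => g ((‖p‖ + ‖q‖ + t) / 2)) (by fun_prop)]
  have h := lintegral_Ioo_affine (a := ‖p + q‖ / 2) (c := (‖p‖ + ‖q‖) / 2) (by positivity) (-1) 1 g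
  have e1 : ‖p + q‖ / 2 * -1 + (‖p‖ + ‖q‖) / 2 = (‖p‖ + ‖q‖ - ‖p + q‖) / 2 := by ring
  have e2 : ‖p + q‖ / 2 * 1 + (‖p‖ + ‖q‖) / 2 = (‖p‖ + ‖q‖ + ‖p + q‖) / 2 := by ring
  rw [e1, e2] at h
  rw [h, ← mul_assoc, ← ENNReal.ofReal_mul (by positivity)]
  congr 2
  · field_simp; ring
  · ext c; congr 1; ring

/-- On a sphere of radius `r` the quantity `u = ϱ²` is affine in `𝐩·ω`, hence uniform on `(0, 4pr)`.
Thus `(|𝐪|, ϱ²)` can serve as coordinates for the collision partner. -/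
lemma lintegral_norm_inner {p : Mom} (hp : p ≠ 0) {G : ℝ → ℝ → ℝ≥0∞}
    (hG : Measurable (Function.uncurry G)) :
    ∫⁻ q : Mom, G ‖q‖ (2 * (‖p‖ * ‖q‖ - inner ℝ p q)) =
      ∫⁻ r in Ioi (0 : ℝ), ENNReal.ofReal (Real.pi * r / ‖p‖) * ∫⁻ u in Ioo 0 (4 * (‖p‖ * r)), G r u := by
  have hn : 0 < ‖p‖ := norm_pos_iff.2 hp
  have hm : Measurable fun q : Mom => G ‖q‖ (2 * (‖p‖ * ‖q‖ - inner ℝ p q)) :=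
    hG.comp (by fun_prop : Measurable fun q : Mom => (‖q‖, 2 * (‖p‖ * ‖q‖ - inner ℝ p q)))
  rw [lintegral_polar hm]
  refine setLIntegral_congr_fun measurableSet_Ioi fun r hr => ?_
  have hr : 0 < r := hr
  have h1 : ∀ w : Sph, G ‖r • (w : Mom)‖ (2 * (‖p‖ * ‖r • (w : Mom)‖ - inner ℝ p (r • (w : Mom)))) =
      G r (2 * (‖p‖ * r - r * inner ℝ p (w : Mom))) := by
    intro w; rw [norm_smul, norm_sph, mul_one, Real.norm_of_nonneg hr.le, inner_smul_right]
  simp only [h1]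
  have hGr : Measurable (G r) := hG.comp (by fun_prop : Measurable fun u : ℝ => (r, u))
  rw [lintegral_inner_sphere hp (H := fun t => G r (2 * (‖p‖ * r - r * t))) (by fun_prop)]
  have h := lintegral_Ioo_affine (a := 2 * (‖p‖ * r)) (c := 2 * (‖p‖ * r)) (by positivity) (-1) 1 (G r)
  have e1 : 2 * (‖p‖ * r) * -1 + 2 * (‖p‖ * r) = 0 := by ring
  have e2 : 2 * (‖p‖ * r) * 1 + 2 * (‖p‖ * r) = 4 * (‖p‖ * r) := by ring
  rw [e1, e2] at h
  rw [h]
  -- `u` decreases in `c`; the reflection `c ↦ -c` makes it increasing, as `lintegral_Ioo_affine`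
  -- requires.
  have h2 : ∫⁻ c in Ioo (-1 : ℝ) 1, G r (2 * (‖p‖ * r - r * (‖p‖ * c))) =
      ∫⁻ c in Ioo (-1 : ℝ) 1, G r (2 * (‖p‖ * r) * c + 2 * (‖p‖ * r)) := by
    have := (Measure.measurePreserving_neg (volume : Measure ℝ)).setLIntegral_comp_preimage
      (s := Ioo (-1) 1) measurableSet_Ioo
      (f := fun c => G r (2 * (‖p‖ * r) * c + 2 * (‖p‖ * r))) (by fun_prop)
    rw [← this]
    have hs : Neg.neg ⁻¹' Ioo (-1 : ℝ) 1 = Ioo (-1) 1 := by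
      ext c; simp only [mem_preimage, mem_Ioo]; constructor <;> rintro ⟨h1, h2⟩ <;> constructor <;> linarith
    rw [hs]
    refine lintegral_congr fun c => ?_
    congr 1; ring
  rw [h2]
  generalize ∫⁻ c in Ioo (-1 : ℝ) 1, G r (2 * (‖p‖ * r) * c + 2 * (‖p‖ * r)) = I
  rw [← mul_assoc, ← mul_assoc, ← ENNReal.ofReal_mul (by positivity), ← ENNReal.ofReal_mul (by positivity)]
  congr 2
  field_simp

lemma measurable_setLIntegral_Ioo {α : Type*} [MeasurableSpace α] {l u : α → ℝ} (hl : Measurable l)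
    (hu : Measurable u) {g : α → ℝ → ℝ≥0∞} (hg : Measurable (Function.uncurry g)) :
    Measurable fun a => ∫⁻ x in Ioo (l a) (u a), g a x := by
  have : ∀ a, ∫⁻ x in Ioo (l a) (u a), g a x = ∫⁻ x, (if l a < x ∧ x < u a then g a x else 0) := by
    intro a; rw [← lintegral_indicator measurableSet_Ioo]; simp only [indicator, mem_Ioo]
  simp only [this]
  refine Measurable.lintegral_prod_right' (f := fun y : α × ℝ => if l y.1 < y.2 ∧ y.2 < u y.1 then g y.1 y.2 else 0) ?_
  have h : MeasurableSet ({y : α × ℝ | l y.1 < y.2} ∩ {y : α × ℝ | y.2 < u y.1}) :=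
    (measurableSet_lt (by fun_prop) (by fun_prop)).inter (measurableSet_lt (by fun_prop) (by fun_prop))
  exact Measurable.ite h hg measurable_const

lemma measurable_kerE {α : Type*} [MeasurableSpace α] {p q x : α → ℝ} (hp : Measurable p)
    (hq : Measurable q) (hx : Measurable x) (b : ℝ) : Measurable fun a => kerE b (p a) (q a) (x a) := by
  refine measurable_setLIntegral_Ioo measurable_const (by fun_prop)
    (g := fun a u => ENNReal.ofReal (u ^ (1 - b / 2) / √((p a + q a) ^ 2 - u))) ?_
  unfold Function.uncurry
  fun_prop

lemma ae_add_ne_zero (p : Mom) : ∀ᵐ q : Mom, p + q ≠ 0 := by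
  have : ∀ᵐ q : Mom, q ≠ -p := by simp [ae_iff]
  filter_upwards [this] with q hq h
  exact hq (eq_neg_of_add_eq_zero_right h)

lemma measurable_postMom : Measurable fun y : Mom × Mom × Sph => postMom y.1 y.2.1 y.2.2 := by
  unfold postMom relMom; fun_prop

/-- Given `ϱ² = u`, the outgoing energy `x` is attainable exactly when `u < 4x(E-x)`. This has the
same form as the constraint `u < 4pq` on the incoming pair, which is why the minimum of the two
products appears in `kerE`. -/
lemma mem_Ioo_iff_lt_kernel {E u x : ℝ} :
    x ∈ Ioo ((E - √(E ^ 2 - u)) / 2) ((E + √(E ^ 2 - u)) / 2) ↔ u < 4 * (x * (E - x)) := by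
  have h : x ∈ Ioo ((E - √(E ^ 2 - u)) / 2) ((E + √(E ^ 2 - u)) / 2) ↔ |2 * x - E| < √(E ^ 2 - u) := by
    rw [abs_lt, mem_Ioo]; constructor <;> rintro ⟨h1, h2⟩ <;> constructor <;> linarith
  rw [h, ← Real.sqrt_sq_eq_abs, Real.sqrt_lt_sqrt_iff (sq_nonneg _)]
  constructor <;> intro h <;> nlinarith

lemma lintegral_kerE {b p q : ℝ} {g : ℝ → ℝ≥0∞} (hg : Measurable g) :
    ∫⁻ x, kerE b p q x * g x = ∫⁻ u in Ioo 0 (4 * (p * q)),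
      ENNReal.ofReal (u ^ (1 - b / 2) / √((p + q) ^ 2 - u)) *
        ∫⁻ x in Ioo ((p + q - √((p + q) ^ 2 - u)) / 2) ((p + q + √((p + q) ^ 2 - u)) / 2), g x := by
  have h1 : ∀ u, ENNReal.ofReal (u ^ (1 - b / 2) / √((p + q) ^ 2 - u)) *
        ∫⁻ x in Ioo ((p + q - √((p + q) ^ 2 - u)) / 2) ((p + q + √((p + q) ^ 2 - u)) / 2), g x =
      ∫⁻ x, ENNReal.ofReal (u ^ (1 - b / 2) / √((p + q) ^ 2 - u)) *
        (if u < 4 * (x * (p + q - x)) then g x else 0) := by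
    intro u
    rw [lintegral_const_mul' _ _ ENNReal.ofReal_ne_top, ← lintegral_indicator measurableSet_Ioo]
    simp only [indicator, mem_Ioo_iff_lt_kernel]
  simp only [h1]
  rw [lintegral_lintegral_swap]
  · refine lintegral_congr fun x => ?_
    rw [kerE, ← lintegral_mul_const _ (by fun_prop), ← lintegral_indicator measurableSet_Ioo,
      ← lintegral_indicator measurableSet_Ioo]
    refine lintegral_congr fun u => ?_
    have hmem : u ∈ Ioo 0 (4 * min (p * q) (x * (p + q - x))) ↔
        u ∈ Ioo 0 (4 * (p * q)) ∧ u < 4 * (x * (p + q - x)) := by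
      simp only [mem_Ioo, mul_min_of_nonneg _ _ (zero_le_four (α := ℝ)), lt_min_iff]; tauto
    by_cases h : u ∈ Ioo 0 (4 * (p * q)) <;> by_cases h' : u < 4 * (x * (p + q - x)) <;>
      simp only [indicator, hmem, h, h', and_true, and_false, if_true, if_false, mul_zero]
  · refine AEMeasurable.mul (by fun_prop) (Measurable.aemeasurable ?_)
    exact Measurable.ite (measurableSet_lt (by fun_prop) (by fun_prop)) (hg.comp measurable_snd) measurable_const

/-- Radial reduction of the collision integral. -/
lemma lintegral_collMeasure {b : ℝ} {p : Mom} (hp : p ≠ 0) {F : ℝ → ℝ → ℝ≥0∞}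
    (hF : Measurable (Function.uncurry F)) :
    ∫⁻ z, ENNReal.ofReal (relMom p z.1 ^ (2 - b) / (‖p‖ * ‖z.1‖)) *
        F ‖z.1‖ ‖postMom p z.1 (z.2 : Mom)‖ ∂collMeasure =
      ENNReal.ofReal (4 * Real.pi ^ 2 / ‖p‖ ^ 2) *
        ∫⁻ q in Ioi (0 : ℝ), ∫⁻ x, kerE b ‖p‖ q x * F q x := by
  have hn : 0 < ‖p‖ := norm_pos_iff.2 hp
  have hF1 : ∀ r, Measurable (F r) := fun r => hF.comp (by fun_prop : Measurable fun u : ℝ => (r, u))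
  have hmp := measurable_postMom.comp (by fun_prop : Measurable fun z : Mom × Sph => (p, z))
  have hmr : Measurable fun q : Mom => relMom p q := by unfold relMom; fun_prop
  have hmF : Measurable fun z : Mom × Sph => F ‖z.1‖ ‖postMom p z.1 (z.2 : Mom)‖ :=
    hF.comp (Measurable.prodMk (by fun_prop) hmp.norm)
  rw [collMeasure, lintegral_prod _ (by fun_prop)]
  -- The result of the `ω`-integration, written through `|𝐪|` and `u = ϱ²` alone, with `|𝐩+𝐪| =
  -- √((p+q)² - u)`.
  set G : ℝ → ℝ → ℝ≥0∞ := fun r u => ENNReal.ofReal (√u ^ (2 - b) / (‖p‖ * r)) *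
    (ENNReal.ofReal (4 * Real.pi / √((‖p‖ + r) ^ 2 - u)) *
      ∫⁻ x in Ioo ((‖p‖ + r - √((‖p‖ + r) ^ 2 - u)) / 2) ((‖p‖ + r + √((‖p‖ + r) ^ 2 - u)) / 2), F r x)
    with hG
  have hGm : Measurable (Function.uncurry G) := by
    have : Measurable fun y : ℝ × ℝ => 
      ∫⁻ x in Ioo ((‖p‖ + y.1 - √((‖p‖ + y.1) ^ 2 - y.2)) / 2) ((‖p‖ + y.1 + √((‖p‖ + y.1) ^ 2 - y.2)) / 2),
        F y.1 x :=
      measurable_setLIntegral_Ioo (by fun_prop) (by fun_prop) (g := fun y : ℝ × ℝ => F y.1)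
        (hF.comp (by fun_prop : Measurable fun y : (ℝ × ℝ) × ℝ => (y.1.1, y.2)))
    exact (by fun_prop : Measurable fun y : ℝ × ℝ => ENNReal.ofReal (√y.2 ^ (2 - b) / (‖p‖ * y.1))).mul
      ((by fun_prop : Measurable fun y : ℝ × ℝ => ENNReal.ofReal (4 * Real.pi / √((‖p‖ + y.1) ^ 2 - y.2))).mul this)
  have h1 : ∫⁻ q : Mom, ∫⁻ w : Sph, ENNReal.ofReal (relMom p q ^ (2 - b) / (‖p‖ * ‖q‖)) *
      F ‖q‖ ‖postMom p q (w : Mom)‖ ∂sphMeasure = ∫⁻ q : Mom, G ‖q‖ (2 * (‖p‖ * ‖q‖ - inner ℝ p q)) := by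
    refine lintegral_congr_ae ?_
    filter_upwards [ae_add_ne_zero p] with q hq
    rw [lintegral_const_mul' _ _ ENNReal.ofReal_ne_top, lintegral_postMom hq (hF1 _), ← relMom_sq]
    simp only [hG, Real.sqrt_sq (relMom_nonneg p q), ← norm_add_sq_relMom, Real.sqrt_sq (norm_nonneg _)]
  rw [h1, lintegral_norm_inner hp hGm]
  have hmk : Measurable fun y : ℝ × ℝ => kerE b ‖p‖ y.1 y.2 * F y.1 y.2 :=
    (measurable_kerE measurable_const measurable_fst measurable_snd b).mul hF
  rw [← lintegral_const_mul _ (hmk.lintegral_prod_right')]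
  refine setLIntegral_congr_fun measurableSet_Ioi fun r hr => ?_
  have hr : 0 < r := hr
  simp only [hG]
  have h2 : ∀ u ∈ Ioo 0 (4 * (‖p‖ * r)), ENNReal.ofReal (√u ^ (2 - b) / (‖p‖ * r)) *
      (ENNReal.ofReal (4 * Real.pi / √((‖p‖ + r) ^ 2 - u)) *
      ∫⁻ x in Ioo ((‖p‖ + r - √((‖p‖ + r) ^ 2 - u)) / 2) ((‖p‖ + r + √((‖p‖ + r) ^ 2 - u)) / 2), F r x) =
      ENNReal.ofReal (4 * Real.pi / (‖p‖ * r)) * (ENNReal.ofReal (u ^ (1 - b / 2) / √((‖p‖ + r) ^ 2 - u)) *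
      ∫⁻ x in Ioo ((‖p‖ + r - √((‖p‖ + r) ^ 2 - u)) / 2) ((‖p‖ + r + √((‖p‖ + r) ^ 2 - u)) / 2), F r x) := by
    intro u hu
    rw [← mul_assoc, ← mul_assoc,
      ← ENNReal.ofReal_mul (div_nonneg (Real.rpow_nonneg (Real.sqrt_nonneg _) _) (by positivity)),
      ← ENNReal.ofReal_mul (by positivity)]
    congr 2
    rw [Real.sqrt_eq_rpow, ← Real.rpow_mul hu.1.le, show (1 / 2 : ℝ) * (2 - b) = 1 - b / 2 by ring]
    field_simp
  rw [setLIntegral_congr_fun measurableSet_Ioo h2, lintegral_const_mul' _ _ ENNReal.ofReal_ne_top,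
    ← mul_assoc, ← ENNReal.ofReal_mul (by positivity), lintegral_kerE (hF1 r)]
  congr 2
  field_simp

/-! ### Collisions do not concentrate on null sets -/

/-- The orthogonal group of momentum space. -/
abbrev Rot : Type := unitary (Mom →L[ℝ] Mom)

instance : ContinuousStar (Mom →L[ℝ] Mom) :=
  ⟨(ContinuousLinearMap.adjoint (𝕜 := ℝ) (E := Mom) (F := Mom)).continuous⟩

instance : IsTopologicalGroup Rot := inferInstance

instance : MeasurableSpace Rot := borel _

instance : BorelSpace Rot := ⟨rfl⟩

instance : LocallyCompactSpace Rot :=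
  (isClosed_unitary (R := Mom →L[ℝ] Mom)).isClosedEmbedding_subtypeVal.locallyCompactSpace

/-- The action of a rotation. -/
abbrev Rot.isom (u : Rot) : Mom ≃ₗᵢ[ℝ] Mom := Unitary.linearIsometryEquiv u

/-- The full orthogonal group is used, so the reflection exchanging two vectors of equal length is
available. -/
lemma exists_rot {x y : Mom} (h : ‖x‖ = ‖y‖) : ∃ u : Rot, u.isom x = y :=
  ⟨Unitary.linearIsometryEquiv.symm ((Submodule.span ℝ {x - y})ᗮ.reflection), by
    rw [Rot.isom, MulEquiv.apply_symm_apply]; exact Submodule.reflection_sub h⟩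

lemma measurable_rot_inv : Measurable fun y : Rot × Mom => (y.1⁻¹).isom y.2 := by
  have : Continuous fun y : Rot × Mom => ((y.1⁻¹ : Rot) : Mom →L[ℝ] Mom) y.2 :=
    (continuous_subtype_val.comp (continuous_inv.comp continuous_fst)).clm_apply continuous_snd
  exact this.measurable

/-- A rotation invariant measure whose radial projection is absolutely continuous is absolutely
continuous. -/
lemma absolutelyContinuous_of_rotation_invariant {ν : Measure Mom} [SFinite ν]
    (hinv : ∀ U : Mom ≃ₗᵢ[ℝ] Mom, ν.map U = ν)
    (hrad : ∀ B : Set ℝ, MeasurableSet B → volume B = 0 → ν {x | ‖x‖ ∈ B} = 0) :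
    ν ≪ volume := by
  refine Measure.AbsolutelyContinuous.mk fun N hN hN0 => ?_
  set μ : Measure Rot := Measure.haar
  set H : Mom → ℝ≥0∞ := fun x => μ {u : Rot | (u⁻¹).isom x ∈ N} with hH
  have hS : MeasurableSet {y : Rot × Mom | (y.1⁻¹).isom y.2 ∈ N} := measurable_rot_inv hN
  have hHm : Measurable H := measurable_measure_prodMk_right hS
  -- Averaging over the group: Tonelli on `Rot × Mom` and invariance of `m` give `∫ H dm = μ(univ)
  -- m(N)`. For Lebesgue measure this says `H = 0` a.e.; since `H` is radial, it vanishes except at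
  -- a null set of radii, so also `ν`-a.e., and the same identity for `ν` forces `ν(N) = 0`.
  have swap : ∀ (m : Measure Mom) [SFinite m], (∀ U : Mom ≃ₗᵢ[ℝ] Mom, m.map U = m) →
      ∫⁻ x, H x ∂m = μ univ * m N := by
    intro m _ hm
    have h1 : ∫⁻ x, H x ∂m = (μ.prod m) {y : Rot × Mom | (y.1⁻¹).isom y.2 ∈ N} := by
      rw [Measure.prod_apply_symm hS]; rfl
    rw [h1, Measure.prod_apply hS]
    have h2 : ∀ u : Rot, m (Prod.mk u ⁻¹' {y : Rot × Mom | (y.1⁻¹).isom y.2 ∈ N}) = m N := by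
      intro u
      conv_rhs => rw [← hm (u⁻¹).isom, Measure.map_apply (u⁻¹).isom.continuous.measurable hN]
      rfl
    simp only [h2, lintegral_const, mul_comm]
  have hrad' : ∀ x y : Mom, ‖x‖ = ‖y‖ → H x = H y := by
    intro x y hxy
    obtain ⟨v, rfl⟩ := exists_rot hxy
    have : {u : Rot | (u⁻¹).isom x ∈ N} = (fun u => v * u) ⁻¹' {u : Rot | (u⁻¹).isom (v.isom x) ∈ N} := by
      ext u
      simp only [mem_preimage, Set.mem_ofPred_eq]
      have : (((v * u)⁻¹ : Rot)).isom (v.isom x) = (u⁻¹).isom x := by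
        have h3 : ((v * u)⁻¹ : Rot) * v = u⁻¹ := by group
        rw [← h3]; rfl
      rw [this]
    simp only [hH]
    rw [this, measure_preimage_mul]
  have hvol : ∫⁻ x, H x = 0 := by
    rw [swap volume (fun U => U.measurePreserving.map_eq), hN0, mul_zero]
  set e : Mom := EuclideanSpace.single 0 1
  have he : ‖e‖ = 1 := by simp [e]
  set B : Set ℝ := {r | 0 < r ∧ H (r • e) ≠ 0}
  have hm1 : Measurable fun r : ℝ => H (r • e) := hHm.comp (by fun_prop)
  have hBm : MeasurableSet B := measurableSet_Ioi.inter (hm1 (measurableSet_singleton 0).compl)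
  have hB : volume B = 0 := by
    rw [lintegral_polar hHm, lintegral_eq_zero_iff (by
      refine Measurable.mul (by fun_prop) ?_
      exact Measurable.lintegral_prod_right' (f := fun y : ℝ × Sph => H (y.1 • (y.2 : Mom))) (by fun_prop))] at hvol
    have hvol' := (ae_restrict_iff' measurableSet_Ioi).1 hvol
    refine measure_mono_null (fun r hr => ?_) hvol'
    intro hc
    have hc := hc hr.1
    have hr0 : 0 < r := hr.1
    have h3 : ∀ w : Sph, H (r • (w : Mom)) = H (r • e) := by
      intro w; apply hrad'; rw [norm_smul, norm_smul, norm_sph, he]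
    simp only [h3, lintegral_const, Pi.zero_apply, mul_eq_zero] at hc
    rcases hc with hc | hc | hc
    · rw [ENNReal.ofReal_eq_zero] at hc; nlinarith
    · exact hr.2 hc
    · rw [Measure.measure_univ_eq_zero] at hc; exact Measure.toSphere_ne_zero _ hc
  -- The set `B` of exceptional radii contains positive numbers only, so the origin is treated
  -- separately.
  have h0 : ν {x | ‖x‖ ∈ ({0} : Set ℝ)} = 0 := hrad _ (measurableSet_singleton _) (by simp)
  have hH0 : ∀ᵐ x ∂ν, H x = 0 := by
    have h1 := hrad B hBm hB
    refine measure_mono_null (fun x hx => ?_) (measure_union_null h0 h1)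
    rcases (norm_nonneg x).eq_or_lt with hx0 | hx0
    · exact Or.inl hx0.symm
    · refine Or.inr ⟨hx0, ?_⟩
      rw [hrad' (‖x‖ • e) x (by rw [norm_smul, he]; simp)]
      exact hx
  have h4 := swap ν hinv
  rw [lintegral_congr_ae hH0, lintegral_zero, eq_comm, mul_eq_zero] at h4
  rcases h4 with h4 | h4
  · exact absurd (Measure.measure_univ_eq_zero.1 h4) (NeZero.ne μ)
  · exact h4

/-- The action of an isometry on the unit sphere. -/
def sphMap (U : Mom ≃ₗᵢ[ℝ] Mom) (w : Sph) : Sph := ⟨U w, by simp⟩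

open scoped Pointwise in
lemma measurePreserving_sphMap (U : Mom ≃ₗᵢ[ℝ] Mom) : MeasurePreserving (sphMap U) sphMeasure sphMeasure := by
  have hm : Measurable (sphMap U) := (U.continuous.comp continuous_subtype_val).measurable.subtype_mk
  refine ⟨hm, Measure.ext fun s hs => ?_⟩
  rw [Measure.map_apply hm hs, Measure.toSphere_apply' _ hs, Measure.toSphere_apply' _ (hm hs)]
  congr 1
  have : Ioo (0 : ℝ) 1 • ((↑) '' (sphMap U ⁻¹' s) : Set Mom) = U ⁻¹' (Ioo (0 : ℝ) 1 • ((↑) '' s)) := by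
    ext x
    simp only [Set.mem_smul, mem_image, mem_preimage]
    constructor
    · rintro ⟨r, hr, _, ⟨w, hw, rfl⟩, rfl⟩
      exact ⟨r, hr, _, ⟨_, hw, rfl⟩, by simp [sphMap]⟩
    · rintro ⟨r, hr, _, ⟨w, hw, rfl⟩, h⟩
      refine ⟨r, hr, _, ⟨sphMap U.symm w, ?_, rfl⟩, ?_⟩
      · have : sphMap U (sphMap U.symm w) = w := by ext1; simp [sphMap]
        rwa [this]
      · apply U.injective; rw [← h]; simp [sphMap]
  rw [this]
  exact U.measurePreserving.measure_preimage_equiv (f := U.toHomeomorph.toMeasurableEquiv) _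



instance : SFinite collMeasure := Measure.prod.instSFinite

lemma postMom_isometry (U : Mom ≃ₗᵢ[ℝ] Mom) (p q w : Mom) :
    postMom (U p) (U q) (U w) = U (postMom p q w) := by
  have h1 : relMom (U p) (U q) = relMom p q := by unfold relMom; simp [U.inner_map_map]
  unfold postMom
  simp only [map_add, map_smul, h1, U.norm_map]
  rw [← U.map_add, U.inner_map_map]

/-- Elements of `L¹` are defined only almost everywhere, whereas the collision integral evaluates
them at `𝐩'`. The image of the measure under `(𝐩,𝐪,ω) ↦ 𝐩'` is rotation invariant because `postMom`
is equivariant, and its radial projection is absolutely continuous because the outgoing energy is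
uniform on an interval for almost every `𝐪`. -/
lemma ae_notMem_of_norm {N : Set Mom} (hN : volume N = 0) :
    ∀ᵐ p : Mom, ∀ᵐ z ∂collMeasure, postMom p z.1 (z.2 : Mom) ∉ N := by
  set T : Mom × Mom × Sph → Mom := fun y => postMom y.1 y.2.1 y.2.2
  have hT : Measurable T := measurable_postMom
  have hac : ((volume : Measure Mom).prod collMeasure).map T ≪ volume := by
    refine absolutelyContinuous_of_rotation_invariant (fun U => ?_) (fun B hB hB0 => ?_)
    · have hU : MeasurePreserving (Prod.map U (Prod.map U (sphMap U)))
          ((volume : Measure Mom).prod collMeasure) ((volume : Measure Mom).prod collMeasure) :=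
        U.measurePreserving.prod (U.measurePreserving.prod (measurePreserving_sphMap U))
      conv_rhs => rw [← hU.map_eq]
      rw [Measure.map_map U.continuous.measurable hT, Measure.map_map hT hU.measurable]
      congr 1
      ext1 y
      exact (postMom_isometry U _ _ _).symm
    · have hBm : MeasurableSet {x : Mom | ‖x‖ ∈ B} := measurable_norm hB
      rw [Measure.map_apply hT hBm]
      have hm2 : MeasurableSet (T ⁻¹' {x : Mom | ‖x‖ ∈ B}) := hT hBm
      rw [Measure.measure_prod_null hm2]
      refine .of_forall fun p => ?_
      have hm3 := measurable_prodMk_left (x := p) hm2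
      simp only [Pi.zero_apply]
      rw [collMeasure, Measure.measure_prod_null hm3]
      filter_upwards [ae_add_ne_zero p] with q hq
      have hm4 := measurable_prodMk_left (x := q) hm3
      have := lintegral_postMom hq (g := B.indicator 1) (measurable_one.indicator hB)
      rw [Pi.zero_apply, ← lintegral_indicator_one hm4]
      refine Eq.trans (lintegral_congr fun w => ?_) (this.trans ?_)
      · rfl
      · rw [lintegral_indicator_one hB, Measure.restrict_apply hB,
          measure_mono_null inter_subset_left hB0, mul_zero]
  have h : ∀ᵐ y ∂((volume : Measure Mom).prod collMeasure), T y ∉ N := by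
    have h1 : ∀ᵐ x ∂((volume : Measure Mom).prod collMeasure).map T, x ∉ N :=
      hac.ae_le (measure_eq_zero_iff_ae_notMem.1 hN)
    exact ae_of_ae_map hT.aemeasurable h1
  exact Measure.ae_ae_of_ae_prod h

/-- The partner momentum `𝐪'` is covered because `ω ↦ -ω` preserves the surface measure. -/
lemma ae_postMom {P : Mom → Prop} (hP : ∀ᵐ x : Mom, P x) :
    ∀ᵐ p : Mom, ∀ᵐ z ∂collMeasure, P (postMom p z.1 (z.2 : Mom)) ∧ P (postMom p z.1 (-(z.2 : Mom))) := by
  have hneg : MeasurePreserving (Prod.map id (sphMap (LinearIsometryEquiv.neg ℝ))) collMeasure collMeasure :=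
    (MeasurePreserving.id _).prod (measurePreserving_sphMap _)
  filter_upwards [ae_notMem_of_norm (N := {x | ¬ P x}) hP] with p hp
  filter_upwards [hp, hneg.quasiMeasurePreserving.ae hp] with z h1 h2
  exact ⟨not_not.1 h1, not_not.1 h2⟩

/-! ### Integrals of powers against the kernel -/

lemma setLIntegral_Ioo_ofReal_sub {f F : ℝ → ℝ} {l u : ℝ} (hlu : l ≤ u)
    (hd : ∀ x ∈ Icc l u, HasDerivAt F (f x) x) (hc : ContinuousOn f (Icc l u)) (h0 : ∀ x ∈ Icc l u, 0 ≤ f x) :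
    ∫⁻ x in Ioo l u, ENNReal.ofReal (f x) = ENNReal.ofReal (F u - F l) := by
  have hi : IntervalIntegrable f volume l u := (by rwa [uIcc_of_le hlu] : ContinuousOn f (uIcc l u)).intervalIntegrable
  rw [← intervalIntegral.integral_eq_sub_of_hasDerivAt (by rwa [uIcc_of_le hlu]) hi,
    intervalIntegral.integral_of_le hlu, integral_Ioc_eq_integral_Ioo, ofReal_integral_eq_lintegral_ofReal]
  · exact hi.1.mono_set Ioo_subset_Ioc_self
  · filter_upwards [ae_restrict_mem measurableSet_Ioo] with x hx
    exact h0 x (Ioo_subset_Icc_self hx)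

lemma setLIntegral_rpow {s a : ℝ} (hs : -1 < s) (ha : 0 ≤ a) :
    ∫⁻ u in Ioo 0 a, ENNReal.ofReal (u ^ s) = ENNReal.ofReal (a ^ (s + 1) / (s + 1)) := by
  have hi := intervalIntegral.intervalIntegrable_rpow' (a := 0) (b := a) hs
  have h := integral_rpow (a := 0) (b := a) (r := s) (Or.inl hs)
  rw [Real.zero_rpow (by linarith), sub_zero] at h
  rw [← h, intervalIntegral.integral_of_le ha, integral_Ioc_eq_integral_Ioo, ofReal_integral_eq_lintegral_ofReal]
  · exact hi.1.mono_set Ioo_subset_Ioc_self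
  · filter_upwards [ae_restrict_mem measurableSet_Ioo] with x hx
    exact Real.rpow_nonneg hx.1.le _

lemma sqrt_disc_mem {p q u : ℝ} (hp : 0 < p) (hq : 0 < q) (hu : u ∈ Ioo 0 (4 * (p * q))) :
    √((p + q) ^ 2 - u) ∈ Ioo 0 (p + q) := by
  have h1 : 0 < (p + q) ^ 2 - u := by nlinarith [sq_nonneg (p - q), hu.2]
  refine ⟨Real.sqrt_pos.2 h1, ?_⟩
  rw [Real.sqrt_lt' (by positivity)]; linarith [hu.1]

/-- For fixed `u` the energy `x` ranges over an interval of length `D = √((p+q)² - u)`. If `c D`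
bounds the average of the weight over that interval, the factor `D` cancels the denominator in
`kerE`. -/
lemma lintegral_kerE_le {b p q : ℝ} (hp : 0 < p) (hq : 0 < q) {g c : ℝ → ℝ} (hg : Measurable g)
    (h : ∀ D ∈ Ioo 0 (p + q), ∫⁻ x in Ioo ((p + q - D) / 2) ((p + q + D) / 2), ENNReal.ofReal (g x) ≤
      ENNReal.ofReal (D * c D)) :
    ∫⁻ x, kerE b p q x * ENNReal.ofReal (g x) ≤
      ∫⁻ u in Ioo 0 (4 * (p * q)), ENNReal.ofReal (u ^ (1 - b / 2) * c √((p + q) ^ 2 - u)) := by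
  rw [lintegral_kerE (by fun_prop)]
  refine lintegral_mono_ae ?_
  filter_upwards [ae_restrict_mem measurableSet_Ioo] with u hu
  have hD := sqrt_disc_mem hp hq hu
  refine (mul_le_mul_right (h _ hD) _).trans_eq ?_
  rw [← ENNReal.ofReal_mul (div_nonneg (Real.rpow_nonneg hu.1.le _) hD.1.le)]
  congr 1
  have := hD.1.ne'
  field_simp

lemma lintegral_kerE_eq {b p q : ℝ} (hp : 0 < p) (hq : 0 < q) {g c : ℝ → ℝ} (hg : Measurable g)
    (h : ∀ D ∈ Ioo 0 (p + q), ∫⁻ x in Ioo ((p + q - D) / 2) ((p + q + D) / 2), ENNReal.ofReal (g x) =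
      ENNReal.ofReal (D * c D)) :
    ∫⁻ x, kerE b p q x * ENNReal.ofReal (g x) =
      ∫⁻ u in Ioo 0 (4 * (p * q)), ENNReal.ofReal (u ^ (1 - b / 2) * c √((p + q) ^ 2 - u)) := by
  rw [lintegral_kerE (by fun_prop)]
  refine setLIntegral_congr_fun measurableSet_Ioo fun u hu => ?_
  have hD := sqrt_disc_mem hp hq hu
  rw [h _ hD, ← ENNReal.ofReal_mul (div_nonneg (Real.rpow_nonneg hu.1.le _) hD.1.le)]
  congr 1
  have := hD.1.ne'
  field_simp

/-- With weight `1` the cancellation is exact and only `∫ u^(1-b/2) du` over `(0, 4pq)` remains. The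
total rate depends on the product `pq` alone, which makes the loss term factorise. -/
lemma lintegral_kerE_one {b p q : ℝ} (hb : b < 2) (hp : 0 < p) (hq : 0 < q) :
    ∫⁻ x, kerE b p q x = ENNReal.ofReal ((4 * (p * q)) ^ (2 - b / 2) / (2 - b / 2)) := by
  have := lintegral_kerE_eq (b := b) hp hq (g := fun _ => 1) (c := fun _ => 1) (by fun_prop) (by
    intro D hD
    rw [setLIntegral_Ioo_ofReal_sub (F := id) (by linarith [hD.1]) (fun x _ => hasDerivAt_id x)
      continuousOn_const (by intros; positivity)]
    congr 1; simp only [id]; ring)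
  simp only [ENNReal.ofReal_one, mul_one] at this
  rw [this, setLIntegral_rpow (by linarith) (by positivity), show 1 - b / 2 + 1 = 2 - b / 2 by ring]

/-- The interval of outgoing energies is centred at `(p+q)/2`, so this is the total rate times the
mean incoming energy. -/
lemma lintegral_kerE_id {b p q : ℝ} (hb : b < 2) (hp : 0 < p) (hq : 0 < q) :
    ∫⁻ x, kerE b p q x * ENNReal.ofReal x =
      ENNReal.ofReal ((4 * (p * q)) ^ (2 - b / 2) / (2 - b / 2) * ((p + q) / 2)) := by
  rw [lintegral_kerE_eq (b := b) hp hq (g := fun x => x) (c := fun _ => (p + q) / 2) (by fun_prop) (by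
    intro D hD
    rw [setLIntegral_Ioo_ofReal_sub (F := fun x => x ^ 2 / 2) (f := fun x => x) (by linarith [hD.1]) (fun x _ => by
        simpa using (hasDerivAt_pow 2 x).div_const 2)
      continuousOn_id (by intro x hx; linarith [hx.1, hD.2])]
    congr 1; ring)]
  have h1 : ∀ u ∈ Ioo 0 (4 * (p * q)), ENNReal.ofReal (u ^ (1 - b / 2) * ((p + q) / 2)) =
      ENNReal.ofReal (u ^ (1 - b / 2)) * ENNReal.ofReal ((p + q) / 2) := fun u _ =>
    ENNReal.ofReal_mul' (by positivity)
  rw [setLIntegral_congr_fun measurableSet_Ioo h1, lintegral_mul_const _ (by fun_prop), setLIntegral_rpow (by linarith) (by positivity), show 1 - b / 2 + 1 = 2 - b / 2 by ring,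
    ← ENNReal.ofReal_mul (div_nonneg (by positivity) (by linarith))]

lemma kerE_eq_zero {b p q x : ℝ} (hE : 0 ≤ p + q) (hx : ¬ (0 < x ∧ x < p + q)) : kerE b p q x = 0 := by
  rw [kerE, Ioo_eq_empty, Measure.restrict_empty, lintegral_zero_measure]
  simp only [not_lt]
  have : min (p * q) (x * (p + q - x)) ≤ 0 := by
    refine (min_le_right _ _).trans ?_
    by_contra hc
    push Not at hc
    rcases pos_and_pos_or_neg_and_neg_of_mul_pos hc with h | h
    · exact hx ⟨h.1, by linarith [h.2]⟩
    · linarith [h.1, h.2]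
  linarith

lemma lintegral_kerE_sq_le {b p q : ℝ} (hb : b < 2) (hp : 0 < p) (hq : 0 < q) :
    ∫⁻ x, kerE b p q x * ENNReal.ofReal (x ^ 2) ≤
      ENNReal.ofReal ((4 * (p * q)) ^ (2 - b / 2) / (2 - b / 2) * (p + q) ^ 2) := by
  rw [ENNReal.ofReal_mul (div_nonneg (by positivity) (by linarith)), ← lintegral_kerE_one hb hp hq,
    ← lintegral_mul_const _ (measurable_kerE (x := fun x : ℝ => x) measurable_const measurable_const measurable_id b)]
  refine lintegral_mono fun x => ?_
  by_cases hx : 0 < x ∧ x < p + q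
  · gcongr
    · exact hx.1.le
    · exact hx.2.le
  · simp [kerE_eq_zero (by positivity) hx]

/-- The average of `x^(-b/2)` over the interval is at most a constant times `(p+q)^(-b/2)`. A short
interval, `D ≤ (p+q)/2`, stays above `(p+q)/4`; a long one is compared with all of `(0, p+q)`, where
the power is integrable because `b < 2`. -/
lemma lintegral_kerE_rpow_le {b p q : ℝ} (hb₁ : 1 < b) (hb : b < 2) (hp : 0 < p) (hq : 0 < q) :
    ∫⁻ x, kerE b p q x * ENNReal.ofReal (x ^ (-(b / 2))) ≤
      ENNReal.ofReal ((4 + 2 / (1 - b / 2)) * (4 ^ (2 - b / 2) / (2 - b / 2)) *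
        ((p * q) ^ (2 - b / 2) * (p + q) ^ (-(b / 2)))) := by
  have hE : 0 < p + q := by positivity
  have hb' : 0 < 1 - b / 2 := by linarith
  set c := (4 + 2 / (1 - b / 2)) * (p + q) ^ (-(b / 2)) with hc
  have hc0 : 0 ≤ c := by positivity
  refine (lintegral_kerE_le hp hq (c := fun _ => c) (by fun_prop) ?_).trans ?_
  · intro D hD
    rcases le_total D ((p + q) / 2) with h | h
    · calc ∫⁻ x in Ioo ((p + q - D) / 2) ((p + q + D) / 2), ENNReal.ofReal (x ^ (-(b / 2)))
          ≤ ∫⁻ x in Ioo ((p + q - D) / 2) ((p + q + D) / 2), ENNReal.ofReal (4 * (p + q) ^ (-(b / 2))) := by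
            refine setLIntegral_mono measurable_const fun x hx => ENNReal.ofReal_le_ofReal ?_
            have h1 : (p + q) / 4 ≤ x := by linarith [hx.1]
            calc x ^ (-(b / 2)) ≤ ((p + q) / 4) ^ (-(b / 2)) :=
                  Real.rpow_le_rpow_of_nonpos (by positivity) h1 (by linarith)
              _ = (p + q) ^ (-(b / 2)) * 4 ^ (b / 2) := by
                  rw [Real.div_rpow hE.le (by norm_num), Real.rpow_neg (by norm_num : (0:ℝ) ≤ 4), div_inv_eq_mul]
              _ ≤ (p + q) ^ (-(b / 2)) * 4 ^ (1 : ℝ) := by gcongr <;> linarith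
              _ = _ := by rw [Real.rpow_one]; ring
        _ = ENNReal.ofReal (D * (4 * (p + q) ^ (-(b / 2)))) := by
            rw [lintegral_const, Measure.restrict_apply MeasurableSet.univ, univ_inter, Real.volume_Ioo,
              ← ENNReal.ofReal_mul (by positivity)]
            congr 1; ring
        _ ≤ _ := by
            refine ENNReal.ofReal_le_ofReal ?_
            rw [hc]
            have : 0 ≤ 2 / (1 - b / 2) := by positivity
            gcongr
            · exact hD.1.le
            · linarith
    · calc ∫⁻ x in Ioo ((p + q - D) / 2) ((p + q + D) / 2), ENNReal.ofReal (x ^ (-(b / 2)))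
          ≤ ∫⁻ x in Ioo 0 (p + q), ENNReal.ofReal (x ^ (-(b / 2))) :=
            lintegral_mono_set (Ioo_subset_Ioo (by linarith [hD.2]) (by linarith [hD.2]))
        _ = ENNReal.ofReal ((p + q) * ((p + q) ^ (-(b / 2)) / (1 - b / 2))) := by
            rw [setLIntegral_rpow (by linarith) hE.le, Real.rpow_add hE, Real.rpow_one,
              show -(b / 2) + 1 = 1 - b / 2 by ring]
            congr 1; ring
        _ ≤ _ := by
            refine ENNReal.ofReal_le_ofReal ?_
            have h1 : (p + q) ≤ 2 * D := by linarith
            calc (p + q) * ((p + q) ^ (-(b / 2)) / (1 - b / 2)) ≤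
                  (2 * D) * ((p + q) ^ (-(b / 2)) / (1 - b / 2)) := by gcongr
              _ = D * ((2 / (1 - b / 2)) * (p + q) ^ (-(b / 2))) := by ring
              _ ≤ _ := by rw [hc]; gcongr; exact hD.1.le; linarith
  · have h1 : ∀ u ∈ Ioo 0 (4 * (p * q)), ENNReal.ofReal (u ^ (1 - b / 2) * c) =
        ENNReal.ofReal (u ^ (1 - b / 2)) * ENNReal.ofReal c := fun u _ => ENNReal.ofReal_mul' hc0
    rw [setLIntegral_congr_fun measurableSet_Ioo h1, lintegral_mul_const _ (by fun_prop),
      setLIntegral_rpow (by linarith) (by positivity), show 1 - b / 2 + 1 = 2 - b / 2 by ring,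
      ← ENNReal.ofReal_mul (div_nonneg (by positivity) (by linarith)),
      Real.mul_rpow (by norm_num) (by positivity), hc]
    refine le_of_eq ?_
    congr 1; ring

/-- The constant in the estimate of the moments of order `-2`. -/
def negTwoConst (b : ℝ) : ℝ := 8 * 4 ^ (1 - b / 2) / (1 - b / 2) + 2 * 4 ^ (2 - b / 2) / (2 - b / 2)

lemma negTwoConst_pos {b : ℝ} (hb : b < 2) : 0 < negTwoConst b := by
  unfold negTwoConst
  have : 0 < 1 - b / 2 := by linarith
  have : 0 < 2 - b / 2 := by linarith
  positivity

/-- The primitive `-(x+ε)⁻¹` gives the exact average `(u/4 + ε(p+q) + ε²)⁻¹`. Since `(p+ε)(q+ε)` is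
the sum of `pq` and `ε(p+q) + ε²`, it is at most twice the larger of the two. If `pq` is larger, the
average is bounded by `4/u`; otherwise the term `u/4` is dropped. The estimate is uniform in `ε ≥
0`. -/
lemma lintegral_kerE_neg_two_le {b p q ε : ℝ} (hb : b < 2) (hp : 0 < p) (hq : 0 < q) (hε : 0 ≤ ε) :
    ∫⁻ x, kerE b p q x * ENNReal.ofReal (((x + ε) ^ 2)⁻¹) ≤
      ENNReal.ofReal (negTwoConst b * ((p * q) ^ (2 - b / 2) / ((p + ε) * (q + ε)))) := by
  have hE : 0 < p + q := by positivity
  have hb' : 0 < 1 - b / 2 := by linarith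
  have hb'' : 0 < 2 - b / 2 := by linarith
  refine (lintegral_kerE_le hp hq (c := fun D => (((p + q) ^ 2 - D ^ 2) / 4 + ε * (p + q) + ε ^ 2)⁻¹)
    (by fun_prop) ?_).trans ?_
  · intro D hD
    have hl : ∀ x ∈ Icc ((p + q - D) / 2) ((p + q + D) / 2), 0 < x + ε := by
      intro x hx; linarith [hx.1, hD.2]
    rw [setLIntegral_Ioo_ofReal_sub (F := fun x => -(x + ε)⁻¹) (by linarith [hD.1]) (fun x hx => by
      have := (((hasDerivAt_id x).add_const ε).inv (hl x hx).ne').neg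
      have e : -(-1 / (id x + ε) ^ 2) = ((x + ε) ^ 2)⁻¹ := by simp [neg_div]
      rw [e] at this
      exact this) (by
      refine ContinuousOn.inv₀ (by fun_prop) fun x hx => (pow_pos (hl x hx) 2).ne')
      (fun x _ => by positivity)]
    refine le_of_eq ?_
    congr 1
    have h1 : 0 < (p + q - D) / 2 + ε := by linarith [hD.2]
    have h2 : 0 < (p + q + D) / 2 + ε := by linarith [hD.2, hD.1]
    have h3 : ((p + q) ^ 2 - D ^ 2) / 4 + ε * (p + q) + ε ^ 2 =
      ((p + q - D) / 2 + ε) * ((p + q + D) / 2 + ε) := by ring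
    have h4 : (p + q - D) / 2 + ε ≠ 0 := h1.ne'
    have h5 : (p + q + D) / 2 + ε ≠ 0 := h2.ne'
    rw [h3, mul_inv, neg_sub_neg, inv_sub_inv h4 h5, div_eq_mul_inv, mul_inv]
    ring
  · have h0 : ∀ u ∈ Ioo 0 (4 * (p * q)), √((p + q) ^ 2 - u) ^ 2 = (p + q) ^ 2 - u := fun u hu =>
      Real.sq_sqrt (Real.sqrt_pos.1 (sqrt_disc_mem hp hq hu).1).le
    rcases le_total (ε * (p + q) + ε ^ 2) (p * q) with h | h
    · calc _ ≤ ∫⁻ u in Ioo 0 (4 * (p * q)), ENNReal.ofReal (u ^ (-(b / 2))) * ENNReal.ofReal 4 := by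
            refine setLIntegral_mono (by fun_prop) fun u hu => ?_
            have hu0 : 0 < u := hu.1
            rw [h0 u hu, ← ENNReal.ofReal_mul' (by norm_num)]
            refine ENNReal.ofReal_le_ofReal ?_
            rw [show 1 - b / 2 = -(b / 2) + 1 by ring, Real.rpow_add hu.1, Real.rpow_one, mul_assoc]
            gcongr
            rw [mul_inv_le_iff₀ (by
              have : 0 ≤ ε * (p + q) + ε ^ 2 := by positivity
              nlinarith)]
            have : 0 ≤ ε * (p + q) + ε ^ 2 := by positivity
            nlinarith
        _ = ENNReal.ofReal (4 * (4 * (p * q)) ^ (1 - b / 2) / (1 - b / 2)) := by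
            rw [lintegral_mul_const _ (by fun_prop), setLIntegral_rpow (by linarith) (by positivity),
              show -(b / 2) + 1 = 1 - b / 2 by ring, ← ENNReal.ofReal_mul (by positivity)]
            congr 1; ring
        _ ≤ _ := by
            refine ENNReal.ofReal_le_ofReal ?_
            have h2 : (p + ε) * (q + ε) ≤ 2 * (p * q) := by nlinarith
            have h3 : (p * q) ^ (1 - b / 2) / 2 ≤ (p * q) ^ (2 - b / 2) / ((p + ε) * (q + ε)) := by
              rw [show 2 - b / 2 = (1 - b / 2) + 1 by ring, Real.rpow_add (by positivity), Real.rpow_one,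
                div_le_div_iff₀ (by norm_num) (by positivity), mul_assoc]
              refine mul_le_mul_of_nonneg_left ?_ (by positivity)
              linarith
            rw [Real.mul_rpow (by norm_num) (by positivity)]
            calc 4 * (4 ^ (1 - b / 2) * (p * q) ^ (1 - b / 2)) / (1 - b / 2)
                = (8 * 4 ^ (1 - b / 2) / (1 - b / 2)) * ((p * q) ^ (1 - b / 2) / 2) := by ring
              _ ≤ negTwoConst b * ((p * q) ^ (2 - b / 2) / ((p + ε) * (q + ε))) := by
                  gcongr
                  · exact (negTwoConst_pos hb).le
                  · unfold negTwoConst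
                    linarith [show (0:ℝ) < 2 * 4 ^ (2 - b / 2) / (2 - b / 2) by positivity]
    · have hpos : 0 < ε * (p + q) + ε ^ 2 := lt_of_lt_of_le (by positivity) h
      calc _ ≤ ∫⁻ u in Ioo 0 (4 * (p * q)), ENNReal.ofReal (u ^ (1 - b / 2)) *
              ENNReal.ofReal (ε * (p + q) + ε ^ 2)⁻¹ := by
            refine setLIntegral_mono (by fun_prop) fun u hu => ?_
            have hu0 : 0 < u := hu.1
            rw [h0 u hu, ← ENNReal.ofReal_mul' (by positivity)]
            refine ENNReal.ofReal_le_ofReal ?_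
            gcongr
            linarith
        _ = ENNReal.ofReal ((4 * (p * q)) ^ (2 - b / 2) / (2 - b / 2) * (ε * (p + q) + ε ^ 2)⁻¹) := by
            rw [lintegral_mul_const _ (by fun_prop), setLIntegral_rpow (by linarith) (by positivity),
              show 1 - b / 2 + 1 = 2 - b / 2 by ring, ← ENNReal.ofReal_mul (by positivity)]
        _ ≤ _ := by
            refine ENNReal.ofReal_le_ofReal ?_
            have h2 : (p + ε) * (q + ε) ≤ 2 * (ε * (p + q) + ε ^ 2) := by nlinarith
            have h3 : (ε * (p + q) + ε ^ 2)⁻¹ ≤ 2 / ((p + ε) * (q + ε)) := by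
              rw [inv_eq_one_div, div_le_div_iff₀ hpos (by positivity)]; linarith
            rw [Real.mul_rpow (by norm_num) (by positivity)]
            calc 4 ^ (2 - b / 2) * (p * q) ^ (2 - b / 2) / (2 - b / 2) * (ε * (p + q) + ε ^ 2)⁻¹
                ≤ 4 ^ (2 - b / 2) * (p * q) ^ (2 - b / 2) / (2 - b / 2) * (2 / ((p + ε) * (q + ε))) := by gcongr
              _ = (2 * 4 ^ (2 - b / 2) / (2 - b / 2)) * ((p * q) ^ (2 - b / 2) / ((p + ε) * (q + ε))) := by ring
              _ ≤ negTwoConst b * ((p * q) ^ (2 - b / 2) / ((p + ε) * (q + ε))) := by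
                  gcongr
                  unfold negTwoConst
                  linarith [show (0:ℝ) < 8 * 4 ^ (1 - b / 2) / (1 - b / 2) by positivity]

/-! ### Microscopic reversibility -/

/-- Lebesgue measure on the half line of energies. -/
def radVol : Measure ℝ := volume.restrict (Ioi 0)

instance : SigmaFinite radVol := by unfold radVol; infer_instance

lemma ae_radVol_pos : ∀ᵐ r ∂radVol, 0 < r := ae_restrict_mem measurableSet_Ioi

/-- The kernel of the radially reduced collision operator. -/
def kerN (b p q x : ℝ) : ℝ≥0 := (kerE b p q x).toNNReal

/-- The measure on `(p, q, x)` given by the collision kernel. -/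
def radColl (b : ℝ) : Measure (ℝ × ℝ × ℝ) :=
  (radVol.prod (radVol.prod volume)).withDensity (fun y => kerN b y.1 y.2.1 y.2.2)

/-- The exchange of the states before and after a collision. -/
def collSwap (y : ℝ × ℝ × ℝ) : ℝ × ℝ × ℝ := (y.2.2, y.1 + y.2.1 - y.2.2, y.1)

lemma collSwap_involutive : Function.Involutive collSwap := by
  rintro ⟨p, q, x⟩; simp [collSwap]

lemma measurable_collSwap : Measurable collSwap := by unfold collSwap; fun_prop

lemma measurable_kerN (b : ℝ) : Measurable fun y : ℝ × ℝ × ℝ => kerN b y.1 y.2.1 y.2.2 :=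
  (measurable_kerE (by fun_prop) (by fun_prop) (by fun_prop) b).ennreal_toNNReal

/-- The kernel sees only the total energy and the minimum of the two products, and the exchange of
states preserves both. -/
lemma kerE_collSwap (b p q x : ℝ) : kerE b x (p + q - x) p = kerE b p q x := by
  unfold kerE
  have h1 : x + (p + q - x) = p + q := by ring
  have h2 : p + q - p = q := by ring
  rw [h1, h2, min_comm]

/-- By Tonelli, the exchange is a translation in one variable followed by a permutation of the
variables. -/
lemma measurePreserving_collSwap_volume : MeasurePreserving collSwap volume volume := by
  refine ⟨measurable_collSwap, Measure.ext fun s hs => ?_⟩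
  rw [Measure.map_apply measurable_collSwap hs]
  set f : ℝ × ℝ × ℝ → ℝ≥0∞ := s.indicator 1 with hf
  have hfm : Measurable f := measurable_one.indicator hs
  have h1 : ∀ t : Set (ℝ × ℝ × ℝ), MeasurableSet t → volume t = ∫⁻ p : ℝ, ∫⁻ q : ℝ, ∫⁻ x : ℝ, t.indicator 1 (p, q, x) := by
    intro t ht
    have hm : Measurable (t.indicator (1 : ℝ × ℝ × ℝ → ℝ≥0∞)) := measurable_one.indicator ht
    rw [← lintegral_indicator_one ht, Measure.volume_eq_prod, lintegral_prod _ hm.aemeasurable]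
    refine lintegral_congr fun p => ?_
    rw [Measure.volume_eq_prod, lintegral_prod _ (by fun_prop)]
  rw [h1 _ (measurable_collSwap hs), h1 _ hs]
  have h2 : ∀ p q x : ℝ, (collSwap ⁻¹' s).indicator (1 : ℝ × ℝ × ℝ → ℝ≥0∞) (p, q, x) = f (x, p + q - x, p) :=
    fun p q x => rfl
  simp only [h2, ← hf]
  calc ∫⁻ p : ℝ, ∫⁻ q : ℝ, ∫⁻ x : ℝ, f (x, p + q - x, p)
      = ∫⁻ p : ℝ, ∫⁻ x : ℝ, ∫⁻ q : ℝ, f (x, q, p) := by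
        refine lintegral_congr fun p => ?_
        rw [lintegral_lintegral_swap (by fun_prop)]
        refine lintegral_congr fun x => ?_
        have := lintegral_add_left_eq_self (μ := (volume : Measure ℝ)) (fun q => f (x, q, p)) (p - x)
        rw [← this]
        refine lintegral_congr fun q => ?_
        congr 3; ring
    _ = ∫⁻ x : ℝ, ∫⁻ p : ℝ, ∫⁻ q : ℝ, f (x, q, p) := by
        rw [lintegral_lintegral_swap]
        exact (Measurable.lintegral_prod_right' (f := fun y : (ℝ × ℝ) × ℝ => f (y.1.2, y.2, y.1.1)) (by fun_prop)).aemeasurable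
    _ = _ := by
        refine lintegral_congr fun x => ?_
        rw [lintegral_lintegral_swap (by fun_prop)]

lemma radColl_eq (b : ℝ) : radColl b = (volume : Measure (ℝ × ℝ × ℝ)).withDensity
    (({y : ℝ × ℝ × ℝ | 0 < y.1 ∧ 0 < y.2.1}).indicator fun y => (kerN b y.1 y.2.1 y.2.2 : ℝ≥0∞)) := by
  have hS : MeasurableSet {y : ℝ × ℝ × ℝ | 0 < y.1 ∧ 0 < y.2.1} := by
    have h : MeasurableSet ({y : ℝ × ℝ × ℝ | 0 < y.1} ∩ {y | 0 < y.2.1}) :=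
      (measurableSet_lt (by fun_prop) (by fun_prop)).inter (measurableSet_lt (by fun_prop) (by fun_prop))
    exact h
  rw [withDensity_indicator hS, radColl]
  congr 1
  have : {y : ℝ × ℝ × ℝ | 0 < y.1 ∧ 0 < y.2.1} = Ioi 0 ×ˢ (Ioi 0 ×ˢ univ) := by
    ext y; simp
  rw [this, Measure.volume_eq_prod, Measure.volume_eq_prod, ← Measure.prod_restrict, ← Measure.prod_restrict,
    Measure.restrict_univ]
  rfl

/-- Lebesgue measure and the kernel are both invariant. The restriction to `p, q > 0` does no harm:
if one of the two pairs of energies is not positive, the kernel vanishes there. -/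
lemma measurePreserving_collSwap (b : ℝ) : MeasurePreserving collSwap (radColl b) (radColl b) := by
  refine ⟨measurable_collSwap, Measure.ext fun s hs => ?_⟩
  rw [Measure.map_apply measurable_collSwap hs, radColl_eq, withDensity_apply _ hs,
    withDensity_apply _ (measurable_collSwap hs)]
  set J : ℝ × ℝ × ℝ → ℝ≥0∞ := ({y : ℝ × ℝ × ℝ | 0 < y.1 ∧ 0 < y.2.1}).indicator
    fun y => (kerN b y.1 y.2.1 y.2.2 : ℝ≥0∞) with hJ
  have hS : MeasurableSet {y : ℝ × ℝ × ℝ | 0 < y.1 ∧ 0 < y.2.1} := by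
    have h : MeasurableSet ({y : ℝ × ℝ × ℝ | 0 < y.1} ∩ {y | 0 < y.2.1}) :=
      (measurableSet_lt (by fun_prop) (by fun_prop)).inter (measurableSet_lt (by fun_prop) (by fun_prop))
    exact h
  have hJm : Measurable J := (measurable_kerN b).coe_nnreal_ennreal.indicator hS
  rw [← measurePreserving_collSwap_volume.setLIntegral_comp_preimage hs hJm]
  refine lintegral_congr fun y => ?_
  obtain ⟨p, q, x⟩ := y
  simp only [hJ, collSwap, indicator, kerN, kerE_collSwap, Set.mem_ofPred_eq]
  by_cases h1 : 0 < p ∧ 0 < q <;> by_cases h2 : 0 < x ∧ 0 < p + q - x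
  · simp [h1, h2]
  · rw [if_pos h1, if_neg h2, kerE_eq_zero (by linarith [h1.1, h1.2]) (fun h => h2 ⟨h.1, by linarith [h.2]⟩)]
    simp
  · rw [if_neg h1, if_pos h2, ← kerE_collSwap, kerE_eq_zero (by linarith [h2.1, h2.2])
      (fun h => h1 ⟨h.1, by linarith [h.2]⟩)]
    simp
  · rw [if_neg h1, if_neg h2]

/-- `collSwap` as a measurable equivalence. -/
def collSwapEquiv : (ℝ × ℝ × ℝ) ≃ᵐ (ℝ × ℝ × ℝ) where
  toEquiv := collSwap_involutive.toPerm
  measurable_toFun := measurable_collSwap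
  measurable_invFun := measurable_collSwap

lemma measurableEmbedding_collSwap : MeasurableEmbedding collSwap := collSwapEquiv.measurableEmbedding

lemma quasiMeasurePreserving_fst (b : ℝ) :
    Measure.QuasiMeasurePreserving (fun y : ℝ × ℝ × ℝ => y.1) (radColl b) radVol :=
  Measure.quasiMeasurePreserving_fst.mono_left (withDensity_absolutelyContinuous _ _)

lemma quasiMeasurePreserving_snd (b : ℝ) :
    Measure.QuasiMeasurePreserving (fun y : ℝ × ℝ × ℝ => y.2.1) (radColl b) radVol :=
  (Measure.quasiMeasurePreserving_fst.comp Measure.quasiMeasurePreserving_snd).mono_left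
    (withDensity_absolutelyContinuous _ _)

lemma quasiMeasurePreserving_out (b : ℝ) :
    Measure.QuasiMeasurePreserving (fun y : ℝ × ℝ × ℝ => y.2.2) (radColl b) radVol :=
  (quasiMeasurePreserving_fst b).comp (measurePreserving_collSwap b).quasiMeasurePreserving

lemma quasiMeasurePreserving_out' (b : ℝ) :
    Measure.QuasiMeasurePreserving (fun y : ℝ × ℝ × ℝ => y.1 + y.2.1 - y.2.2) (radColl b) radVol :=
  (quasiMeasurePreserving_snd b).comp (measurePreserving_collSwap b).quasiMeasurePreserving

lemma ae_kerE_ne_top {b p q : ℝ} (hb : b < 2) (hp : 0 < p) (hq : 0 < q) : ∀ᵐ x, kerE b p q x ≠ ∞ := by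
  have h := lintegral_kerE_one hb hp hq
  have := ae_lt_top (measurable_kerE (x := fun x : ℝ => x) measurable_const measurable_const measurable_id b)
    (by rw [h]; exact ENNReal.ofReal_ne_top : ∫⁻ x, kerE b p q x ≠ ∞)
  filter_upwards [this] with x hx using hx.ne

lemma lintegral_radColl {b : ℝ} (hb : b < 2) {F : ℝ × ℝ × ℝ → ℝ≥0∞} (hF : Measurable F) :
    ∫⁻ y, F y ∂radColl b = ∫⁻ p, ∫⁻ q, (∫⁻ x, kerE b p q x * F (p, q, x)) ∂radVol ∂radVol := by
  have hk := (measurable_kerN b).coe_nnreal_ennreal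
  rw [radColl, lintegral_withDensity_eq_lintegral_mul _ hk hF, lintegral_prod _ (hk.mul hF).aemeasurable]
  refine lintegral_congr_ae ?_
  filter_upwards [ae_radVol_pos] with p hp
  have hm : Measurable fun z : ℝ × ℝ => (kerN b p z.1 z.2 : ℝ≥0∞) * F (p, z) :=
    (hk.mul hF).comp measurable_prodMk_left
  simp only [Pi.mul_apply]
  rw [lintegral_prod _ hm.aemeasurable]
  refine lintegral_congr_ae ?_
  filter_upwards [ae_radVol_pos] with q hq
  refine lintegral_congr_ae ?_
  filter_upwards [ae_kerE_ne_top hb hp hq] with x hx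
  simp only [kerN, ENNReal.coe_toNNReal hx]

/-! ### The gain term and its weak form -/

section

lemma lintegral_radColl_mul {b : ℝ} (hb : b < 2) {W f g : ℝ → ℝ≥0∞} (hW : Measurable W)
    (hf : AEMeasurable f radVol) (hg : AEMeasurable g radVol) :
    ∫⁻ y, W y.2.2 * (f y.1 * g y.2.1) ∂radColl b =
      ∫⁻ p, ∫⁻ q, (∫⁻ x, kerE b p q x * W x) * (f p * g q) ∂radVol ∂radVol := by
  have h1 : ∫⁻ y, W y.2.2 * (f y.1 * g y.2.1) ∂radColl b =
      ∫⁻ y, W y.2.2 * (hf.mk f y.1 * hg.mk g y.2.1) ∂radColl b := by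
    refine lintegral_congr_ae ?_
    filter_upwards [(quasiMeasurePreserving_fst b).ae_eq_comp hf.ae_eq_mk,
      (quasiMeasurePreserving_snd b).ae_eq_comp hg.ae_eq_mk] with y h1 h2
    simp only [Function.comp] at h1 h2
    rw [h1, h2]
  have hfm := hf.measurable_mk
  have hgm := hg.measurable_mk
  rw [h1, lintegral_radColl hb (by fun_prop)]
  refine lintegral_congr_ae ?_
  filter_upwards [hf.ae_eq_mk] with p hp
  refine lintegral_congr_ae ?_
  filter_upwards [hg.ae_eq_mk] with q hq
  have hk : Measurable fun x => kerE b p q x * W x :=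
    (measurable_kerE measurable_const measurable_const measurable_id b).mul hW
  rw [hp, hq, ← lintegral_mul_const _ hk]
  simp only [mul_assoc]

/-- The integrand of the weak form of the gain term. -/
def weakGain (W n m : ℝ → ℝ) (y : ℝ × ℝ × ℝ) : ℝ := W y.2.2 * (n y.1 / y.1 ^ 2 * (m y.2.1 / y.2.1 ^ 2))

/-- The integrand of the gain term for radial densities `n, m`. -/
def gainKer (b : ℝ) (n m : ℝ → ℝ) (p : ℝ) (z : ℝ × ℝ) : ℝ :=
  kerN b p z.1 z.2 * (n z.2 / z.2 ^ 2 * (m (p + z.1 - z.2) / (p + z.1 - z.2) ^ 2))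

/-- The gain term for radial densities `n, m`. -/
def gain (κ b : ℝ) (n m : ℝ → ℝ) (p : ℝ) : ℝ :=
  4 * Real.pi ^ 2 * κ * ∫ z, gainKer b n m p z ∂(radVol.prod volume)

variable {κ b : ℝ} {n m W : ℝ → ℝ}

lemma aestronglyMeasurable_weakGain (hW : Measurable W) (hn : AEStronglyMeasurable n radVol)
    (hm : AEStronglyMeasurable m radVol) : AEStronglyMeasurable (weakGain W n m) (radColl b) := by
  have h1 := hn.comp_quasiMeasurePreserving (quasiMeasurePreserving_fst b)
  have h2 := hm.comp_quasiMeasurePreserving (quasiMeasurePreserving_snd b)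
  have h3 : AEStronglyMeasurable (fun y : ℝ × ℝ × ℝ => W y.2.2) (radColl b) :=
    (by fun_prop : Measurable fun y : ℝ × ℝ × ℝ => W y.2.2).aestronglyMeasurable
  have h4 : AEStronglyMeasurable (fun y : ℝ × ℝ × ℝ => (y.1 ^ 2)⁻¹) (radColl b) :=
    (by fun_prop : Measurable fun y : ℝ × ℝ × ℝ => (y.1 ^ 2)⁻¹).aestronglyMeasurable
  have h5 : AEStronglyMeasurable (fun y : ℝ × ℝ × ℝ => (y.2.1 ^ 2)⁻¹) (radColl b) :=
    (by fun_prop : Measurable fun y : ℝ × ℝ × ℝ => (y.2.1 ^ 2)⁻¹).aestronglyMeasurable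
  exact h3.mul ((h1.mul h4).mul (h2.mul h5))

/-- A kernel bound of product form becomes a bilinear bound on the gain term; the factors `p²` and
`q²` in the hypothesis match the denominators in `weakGain`. -/
lemma lintegral_weakGain_le {A B : ℝ → ℝ} {C : ℝ} (hb : b < 2) (hW : Measurable W) (hA : ∀ r, 0 < r → 0 ≤ A r)
    (hB : ∀ r, 0 < r → 0 ≤ B r) (hC : 0 ≤ C) (hn : AEStronglyMeasurable n radVol)
    (hm : AEStronglyMeasurable m radVol) (hnA : Integrable (fun r => A r * n r) radVol)
    (hmB : Integrable (fun r => B r * m r) radVol)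
    (hker : ∀ p q, 0 < p → 0 < q → ∫⁻ x, kerE b p q x * ENNReal.ofReal |W x| ≤
      ENNReal.ofReal (C * (p ^ 2 * A p) * (q ^ 2 * B q))) :
    ∫⁻ y, ‖weakGain W n m y‖ₑ ∂radColl b ≤
      ENNReal.ofReal (C * (∫ r, A r * |n r| ∂radVol) * ∫ r, B r * |m r| ∂radVol) := by
  have e1 : ∀ y : ℝ × ℝ × ℝ, ‖weakGain W n m y‖ₑ =
      ENNReal.ofReal |W y.2.2| * (ENNReal.ofReal |n y.1 / y.1 ^ 2| * ENNReal.ofReal |m y.2.1 / y.2.1 ^ 2|) := by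
    intro y
    rw [weakGain, ← ofReal_norm, Real.norm_eq_abs, abs_mul, abs_mul, ENNReal.ofReal_mul (abs_nonneg _),
      ENNReal.ofReal_mul (abs_nonneg _)]
  simp only [e1]
  have hn' : AEMeasurable (fun r => ENNReal.ofReal |n r / r ^ 2|) radVol := by
    have := hn.aemeasurable; fun_prop
  have hm' : AEMeasurable (fun r => ENNReal.ofReal |m r / r ^ 2|) radVol := by
    have := hm.aemeasurable; fun_prop
  rw [lintegral_radColl_mul hb (W := fun x => ENNReal.ofReal |W x|) (by fun_prop) hn' hm']
  have i1 : ∀ {D : ℝ → ℝ} {k : ℝ → ℝ}, (∀ r, 0 < r → 0 ≤ D r) → Integrable (fun r => D r * k r) radVol →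
      ∫⁻ r, ENNReal.ofReal (D r * |k r|) ∂radVol = ENNReal.ofReal (∫ r, D r * |k r| ∂radVol) := by
    intro D k hD hk
    rw [← ofReal_integral_eq_lintegral_ofReal]
    · refine hk.abs.congr ?_
      filter_upwards [ae_radVol_pos] with r hr
      rw [abs_mul, abs_of_nonneg (hD r hr)]
    · filter_upwards [ae_radVol_pos] with r hr
      exact mul_nonneg (hD r hr) (abs_nonneg _)
  calc ∫⁻ p, ∫⁻ q, (∫⁻ x, kerE b p q x * ENNReal.ofReal |W x|) *
        (ENNReal.ofReal |n p / p ^ 2| * ENNReal.ofReal |m q / q ^ 2|) ∂radVol ∂radVol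
      ≤ ∫⁻ p, ∫⁻ q, ENNReal.ofReal C * ENNReal.ofReal (A p * |n p|) * ENNReal.ofReal (B q * |m q|) ∂radVol ∂radVol := by
        refine lintegral_mono_ae ?_
        filter_upwards [ae_radVol_pos] with p hp
        refine lintegral_mono_ae ?_
        filter_upwards [ae_radVol_pos] with q hq
        refine (mul_le_mul_left (hker p q hp hq) _).trans_eq ?_
        have hAp := hA p hp
        have hBq := hB q hq
        rw [← ENNReal.ofReal_mul (by positivity), ← ENNReal.ofReal_mul (by positivity),
          ← ENNReal.ofReal_mul (by positivity), ← ENNReal.ofReal_mul (by positivity)]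
        congr 1
        rw [abs_div, abs_div, abs_of_pos (pow_pos hp 2), abs_of_pos (pow_pos hq 2)]
        field_simp
    _ = _ := by
        have hm2 : AEMeasurable (fun q => ENNReal.ofReal (B q * |m q|)) radVol := by
          have h := hmB.abs.aestronglyMeasurable.aemeasurable.ennreal_ofReal
          refine h.congr ?_
          filter_upwards [ae_radVol_pos] with r hr
          rw [abs_mul, abs_of_nonneg (hB r hr)]
        have hn2 : AEMeasurable (fun q => ENNReal.ofReal (A q * |n q|)) radVol := by
          have h := hnA.abs.aestronglyMeasurable.aemeasurable.ennreal_ofReal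
          refine h.congr ?_
          filter_upwards [ae_radVol_pos] with r hr
          rw [abs_mul, abs_of_nonneg (hA r hr)]
        simp only [lintegral_const_mul'' _ hm2]
        rw [lintegral_mul_const'' _ (hn2.const_mul _), lintegral_const_mul'' _ hn2, i1 hA hnA, i1 hB hmB,
          ENNReal.ofReal_mul (mul_nonneg hC (integral_nonneg_of_ae ?_)), ENNReal.ofReal_mul hC]
        filter_upwards [ae_radVol_pos] with r hr
        exact mul_nonneg (hA r hr) (abs_nonneg _)

lemma integrable_weakGain {A B : ℝ → ℝ} {C : ℝ} (hb : b < 2) (hW : Measurable W) (hA : ∀ r, 0 < r → 0 ≤ A r)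
    (hB : ∀ r, 0 < r → 0 ≤ B r) (hC : 0 ≤ C) (hn : AEStronglyMeasurable n radVol)
    (hm : AEStronglyMeasurable m radVol) (hnA : Integrable (fun r => A r * n r) radVol)
    (hmB : Integrable (fun r => B r * m r) radVol)
    (hker : ∀ p q, 0 < p → 0 < q → ∫⁻ x, kerE b p q x * ENNReal.ofReal |W x| ≤
      ENNReal.ofReal (C * (p ^ 2 * A p) * (q ^ 2 * B q))) :
    Integrable (weakGain W n m) (radColl b) ∧ ∫ y, |weakGain W n m y| ∂radColl b ≤
      C * (∫ r, A r * |n r| ∂radVol) * ∫ r, B r * |m r| ∂radVol := by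
  have h := lintegral_weakGain_le hb hW hA hB hC hn hm hnA hmB hker
  have hi : Integrable (weakGain W n m) (radColl b) :=
    ⟨aestronglyMeasurable_weakGain hW hn hm, lt_of_le_of_lt h ENNReal.ofReal_lt_top⟩
  refine ⟨hi, ?_⟩
  have h1 := integral_norm_eq_lintegral_enorm hi.aestronglyMeasurable
  simp only [Real.norm_eq_abs] at h1
  rw [h1]
  refine ENNReal.toReal_le_of_le_ofReal ?_ h
  refine mul_nonneg (mul_nonneg hC (integral_nonneg_of_ae ?_)) (integral_nonneg_of_ae ?_)
  · filter_upwards [ae_radVol_pos] with r hr using mul_nonneg (hA r hr) (abs_nonneg _)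
  · filter_upwards [ae_radVol_pos] with r hr using mul_nonneg (hB r hr) (abs_nonneg _)

/-- The exchange of states carries `W(x) n(p) m(q)` to `W(p) n(x) m(p+q-x)`, so the weight moves
from an outgoing to an incoming energy. All estimates of the gain term go through this identity. -/
lemma integrable_smul_gainKer (h : Integrable (weakGain W n m) (radColl b)) :
    Integrable (fun y : ℝ × ℝ × ℝ => W y.1 * gainKer b n m y.1 y.2) (radVol.prod (radVol.prod volume)) := by
  have h1 := ((measurePreserving_collSwap b).integrable_comp_emb measurableEmbedding_collSwap).2 h
  rw [radColl, integrable_withDensity_iff_integrable_smul (measurable_kerN b)] at h1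
  refine h1.congr (.of_forall fun y => ?_)
  simp only [weakGain, collSwap, gainKer, Function.comp, NNReal.smul_def, smul_eq_mul]
  ring

lemma gain_mul_eq (p : ℝ) : W p * gain κ b n m p =
    4 * Real.pi ^ 2 * κ * ∫ z, W p * gainKer b n m p z ∂(radVol.prod volume) := by
  rw [gain, integral_const_mul]; ring

lemma integrable_gain (h : Integrable (weakGain W n m) (radColl b)) :
    Integrable (fun p => W p * gain κ b n m p) radVol := by
  simp only [gain_mul_eq]
  exact (integrable_smul_gainKer h).integral_prod_left.const_mul _

lemma integral_gain (h : Integrable (weakGain W n m) (radColl b)) :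
    ∫ p, W p * gain κ b n m p ∂radVol = 4 * Real.pi ^ 2 * κ * ∫ y, weakGain W n m y ∂radColl b := by
  simp only [gain_mul_eq]
  rw [integral_const_mul, ← integral_prod _ (integrable_smul_gainKer h),
    ← (measurePreserving_collSwap b).integral_comp measurableEmbedding_collSwap, radColl,
    integral_withDensity_eq_integral_smul (measurable_kerN b)]
  congr 2
  ext y
  simp only [weakGain, collSwap, gainKer, NNReal.smul_def, smul_eq_mul]
  ring

lemma integral_abs_gain_le (h : Integrable (weakGain W n m) (radColl b)) (hκ : 0 ≤ κ) :
    ∫ p, |W p * gain κ b n m p| ∂radVol ≤ 4 * Real.pi ^ 2 * κ * ∫ y, |weakGain W n m y| ∂radColl b := by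
  have hc : 0 ≤ 4 * Real.pi ^ 2 * κ := by positivity
  have h2 := integrable_smul_gainKer h
  calc ∫ p, |W p * gain κ b n m p| ∂radVol
      ≤ ∫ p, 4 * Real.pi ^ 2 * κ * ∫ z, |W p * gainKer b n m p z| ∂(radVol.prod volume) ∂radVol := by
        refine integral_mono (integrable_gain h).abs (h2.abs.integral_prod_left.const_mul _) fun p => ?_
        simp only []
        rw [gain_mul_eq, abs_mul, abs_of_nonneg hc]
        gcongr
        exact abs_integral_le_integral_abs
    _ = _ := by
        rw [integral_const_mul, ← integral_prod _ h2.abs,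
          ← (measurePreserving_collSwap b).integral_comp measurableEmbedding_collSwap, radColl,
          integral_withDensity_eq_integral_smul (measurable_kerN b)]
        congr 2
        ext y
        simp only [weakGain, collSwap, gainKer, NNReal.smul_def, smul_eq_mul, abs_mul, NNReal.abs_eq]
        ring

lemma ae_integrable_gainKer (h : Integrable (weakGain (fun _ => 1) n m) (radColl b)) :
    ∀ᵐ p ∂radVol, Integrable (gainKer b n m p) (radVol.prod volume) := by
  filter_upwards [(integrable_smul_gainKer h).prod_right_ae] with p hp
  simpa using hp

/-- The outgoing energies are images of the incoming ones under a measure preserving map, hence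
avoid null sets for `radColl`. Where the kernel vanishes this says nothing, but there both
integrands are zero. -/
lemma gain_congr {n' m' : ℝ → ℝ} (hn : n =ᵐ[radVol] n') (hm : m =ᵐ[radVol] m') :
    ∀ᵐ p ∂radVol, gainKer b n m p =ᵐ[radVol.prod volume] gainKer b n' m' p := by
  have h1 : ∀ᵐ y ∂radColl b, n y.2.2 = n' y.2.2 ∧ m (y.1 + y.2.1 - y.2.2) = m' (y.1 + y.2.1 - y.2.2) := by
    filter_upwards [(quasiMeasurePreserving_out b).ae_eq_comp hn, (quasiMeasurePreserving_out' b).ae_eq_comp hm]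
      with y h1 h2 using ⟨h1, h2⟩
  rw [radColl, ae_withDensity_iff (measurable_kerN b).coe_nnreal_ennreal] at h1
  filter_upwards [Measure.ae_ae_of_ae_prod h1] with p hp
  filter_upwards [hp] with z hz
  by_cases h0 : kerN b p z.1 z.2 = 0
  · simp [gainKer, h0]
  · have := hz (by simpa using h0)
    simp only [gainKer, this.1, this.2]

end

/-! ### Bounds by product weights and conservation laws of the gain term -/

section

lemma rpow_le_rpow_add {r s s₁ s₂ : ℝ} (hr : 0 < r) (h₁ : s₁ ≤ s) (h₂ : s ≤ s₂) : r ^ s ≤ r ^ s₁ + r ^ s₂ := by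
  rcases le_total r 1 with h | h
  · have := Real.rpow_le_rpow_of_exponent_ge hr h h₁
    linarith [Real.rpow_nonneg hr.le s₂]
  · have := Real.rpow_le_rpow_of_exponent_le h h₂
    linarith [Real.rpow_nonneg hr.le s₁]

/-- The constant `c` in `∫ kerE b p q x dx = c (p q)^(2 - b / 2)`. -/
def kerConst (b : ℝ) : ℝ := 4 ^ (2 - b / 2) / (2 - b / 2)

lemma kerConst_pos {b : ℝ} (hb : b < 2) : 0 < kerConst b := by
  unfold kerConst
  have : 0 < 2 - b / 2 := by linarith
  positivity

lemma kerConst_mul {b p q : ℝ} (hp : 0 < p) (hq : 0 < q) : (4 * (p * q)) ^ (2 - b / 2) / (2 - b / 2) =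
    kerConst b * (p ^ 2 * p ^ (-(b / 2))) * (q ^ 2 * q ^ (-(b / 2))) := by
  have h : ∀ r : ℝ, 0 < r → r ^ (2 - b / 2) = r ^ 2 * r ^ (-(b / 2)) := by
    intro r hr; rw [← Real.rpow_natCast r 2, ← Real.rpow_add hr]; congr 1
  rw [Real.mul_rpow (by norm_num) (by positivity), Real.mul_rpow hp.le hq.le, h p hp, h q hq, kerConst]
  ring

section Kernel
variable {b p q : ℝ}

lemma kernel_one_le (hb : b < 2) (hp : 0 < p) (hq : 0 < q) :
    ∫⁻ x, kerE b p q x * ENNReal.ofReal |(1 : ℝ)| ≤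
      ENNReal.ofReal (kerConst b * (p ^ 2 * p ^ (-(b / 2))) * (q ^ 2 * q ^ (-(b / 2)))) := by
  rw [← kerConst_mul hp hq]
  simp [lintegral_kerE_one hb hp hq]

lemma kernel_abs_id_eq (hb : b < 2) (hp : 0 < p) (hq : 0 < q) :
    ∫⁻ x, kerE b p q x * ENNReal.ofReal |x| = ENNReal.ofReal
      (kerConst b * (p ^ 2 * p ^ (-(b / 2))) * (q ^ 2 * q ^ (-(b / 2))) * ((p + q) / 2)) := by
  rw [← kerConst_mul hp hq, ← lintegral_kerE_id hb hp hq]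
  refine lintegral_congr fun x => ?_
  by_cases hx : 0 < x ∧ x < p + q
  · rw [abs_of_pos hx.1]
  · simp [kerE_eq_zero (by positivity) hx]

/-- The weight `r⁻¹ + r²`, controlling all moments of a solution. -/
def solWeight (r : ℝ) : ℝ := r ^ (-1 : ℝ) + r ^ (2 : ℝ)

/-- The weight `r⁻² + r²`, controlling all moments of the data. -/
def dataWeight (r : ℝ) : ℝ := r ^ (-2 : ℝ) + r ^ (2 : ℝ)

lemma solWeight_nonneg (r : ℝ) (hr : 0 < r) : 0 ≤ solWeight r := by unfold solWeight; positivity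

lemma dataWeight_nonneg (r : ℝ) (hr : 0 < r) : 0 ≤ dataWeight r := by unfold dataWeight; positivity

lemma rpow_le_solWeight {r s : ℝ} (hr : 0 < r) (h₁ : -1 ≤ s) (h₂ : s ≤ 2) : r ^ s ≤ solWeight r :=
  rpow_le_rpow_add hr h₁ h₂

lemma rpow_le_dataWeight {r s : ℝ} (hr : 0 < r) (h₁ : -2 ≤ s) (h₂ : s ≤ 2) : r ^ s ≤ dataWeight r :=
  rpow_le_rpow_add hr h₁ h₂

/-- Outgoing energies are below `p+q` and `(p+q)² ≤ 2p² + 2q²`. The weight is left general because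
the bound is needed both for `solWeight` and for `dataWeight`. -/
lemma kernel_sq_le (hb₁ : 1 < b) (hb : b < 2) (hp : 0 < p) (hq : 0 < q) {w : ℝ → ℝ}
    (hw : ∀ s : ℝ, -1 ≤ s → s ≤ 2 → ∀ r, 0 < r → r ^ s ≤ w r) :
    ∫⁻ x, kerE b p q x * ENNReal.ofReal |x ^ 2| ≤ ENNReal.ofReal
      (4 * kerConst b * (p ^ 2 * w p) * (q ^ 2 * w q)) := by
  simp only [abs_pow, sq_abs]
  refine (lintegral_kerE_sq_le hb hp hq).trans (ENNReal.ofReal_le_ofReal ?_)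
  rw [kerConst_mul hp hq]
  have hc := (kerConst_pos hb).le
  have h : ∀ r : ℝ, 0 < r → r ^ (-(b / 2)) * r ^ 2 ≤ w r := by
    intro r hr; rw [← Real.rpow_natCast r 2, ← Real.rpow_add hr]
    exact hw _ (by push_cast; linarith) (by push_cast; linarith) r hr
  have hp1 := h p hp
  have hq1 := h q hq
  have hp2 := hw (-(b / 2)) (by linarith) (by linarith) p hp
  have hq2 := hw (-(b / 2)) (by linarith) (by linarith) q hq
  have hp0 := Real.rpow_nonneg hp.le (-(b / 2))
  have hq0 := Real.rpow_nonneg hq.le (-(b / 2))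
  have h1 : (p + q) ^ 2 ≤ 2 * p ^ 2 + 2 * q ^ 2 := by nlinarith [sq_nonneg (p - q)]
  have h2 : p ^ (-(b / 2)) * q ^ (-(b / 2)) * (p + q) ^ 2 ≤ 4 * (w p * w q) := by
    calc p ^ (-(b / 2)) * q ^ (-(b / 2)) * (p + q) ^ 2 ≤ p ^ (-(b / 2)) * q ^ (-(b / 2)) * (2 * p ^ 2 + 2 * q ^ 2) := by gcongr
      _ = 2 * ((p ^ (-(b / 2)) * p ^ 2) * q ^ (-(b / 2))) + 2 * (p ^ (-(b / 2)) * (q ^ (-(b / 2)) * q ^ 2)) := by ring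
      _ ≤ 2 * (w p * w q) + 2 * (w p * w q) := by
          have : 0 ≤ w p := hp0.trans hp2
          gcongr
      _ = _ := by ring
  calc _ = (kerConst b * p ^ 2 * q ^ 2) * (p ^ (-(b / 2)) * q ^ (-(b / 2)) * (p + q) ^ 2) := by ring
    _ ≤ (kerConst b * p ^ 2 * q ^ 2) * (4 * (w p * w q)) := by gcongr
    _ = _ := by ring

/-- The constant in the estimate of the moment of order `-b/2` of the gain term. -/
def halfConst (b : ℝ) : ℝ := (4 + 2 / (1 - b / 2)) * kerConst b

lemma halfConst_pos (hb : b < 2) : 0 < halfConst b := by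
  have := kerConst_pos hb
  have : 0 < 1 - b / 2 := by linarith
  unfold halfConst; positivity

/-- The factor `(p+q)^(-b/2)` may be charged to either incoming energy. In the stability estimate it
is charged to the solution, so that the difference of solutions carries only the weight `r^(-b/2)`.
-/
lemma kernel_half_le (hb₁ : 1 < b) (hb : b < 2) (hp : 0 < p) (hq : 0 < q) :
    ∫⁻ x, kerE b p q x * ENNReal.ofReal |x ^ (-(b / 2))| ≤ ENNReal.ofReal
      (halfConst b * (p ^ 2 * p ^ (-(b / 2))) * (q ^ 2 * q ^ (-b))) ∧
    ∫⁻ x, kerE b p q x * ENNReal.ofReal |x ^ (-(b / 2))| ≤ ENNReal.ofReal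
      (halfConst b * (p ^ 2 * p ^ (-b)) * (q ^ 2 * q ^ (-(b / 2)))) := by
  have h0 : ∫⁻ x, kerE b p q x * ENNReal.ofReal |x ^ (-(b / 2))| =
      ∫⁻ x, kerE b p q x * ENNReal.ofReal (x ^ (-(b / 2))) := by
    refine lintegral_congr fun x => ?_
    by_cases hx : 0 < x ∧ x < p + q
    · rw [abs_of_nonneg (Real.rpow_nonneg hx.1.le _)]
    · simp [kerE_eq_zero (by positivity) hx]
  have h1 := lintegral_kerE_rpow_le hb₁ hb hp hq
  rw [← h0] at h1
  have h : ∀ r : ℝ, 0 < r → r ^ (2 - b / 2) = r ^ 2 * r ^ (-(b / 2)) := by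
    intro r hr; rw [← Real.rpow_natCast r 2, ← Real.rpow_add hr]; congr 1
  have h' : ∀ r : ℝ, 0 < r → r ^ (-b) = r ^ (-(b / 2)) * r ^ (-(b / 2)) := by
    intro r hr; rw [← Real.rpow_add hr]; congr 1; ring
  have hc := (halfConst_pos hb).le
  have hE1 : (p + q) ^ (-(b / 2)) ≤ q ^ (-(b / 2)) := Real.rpow_le_rpow_of_nonpos hq (by linarith) (by linarith)
  have hE2 : (p + q) ^ (-(b / 2)) ≤ p ^ (-(b / 2)) := Real.rpow_le_rpow_of_nonpos hp (by linarith) (by linarith)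
  constructor
  · refine h1.trans (ENNReal.ofReal_le_ofReal ?_)
    rw [Real.mul_rpow hp.le hq.le, h p hp, h q hq, h' q hq]
    calc _ = halfConst b * (p ^ 2 * p ^ (-(b / 2)) * (q ^ 2 * q ^ (-(b / 2)))) * (p + q) ^ (-(b / 2)) := by
          unfold halfConst kerConst; ring
      _ ≤ halfConst b * (p ^ 2 * p ^ (-(b / 2)) * (q ^ 2 * q ^ (-(b / 2)))) * q ^ (-(b / 2)) := by gcongr
      _ = _ := by ring
  · refine h1.trans (ENNReal.ofReal_le_ofReal ?_)
    rw [Real.mul_rpow hp.le hq.le, h p hp, h q hq, h' p hp]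
    calc _ = halfConst b * (p ^ 2 * p ^ (-(b / 2)) * (q ^ 2 * q ^ (-(b / 2)))) * (p + q) ^ (-(b / 2)) := by
          unfold halfConst kerConst; ring
      _ ≤ halfConst b * (p ^ 2 * p ^ (-(b / 2)) * (q ^ 2 * q ^ (-(b / 2)))) * p ^ (-(b / 2)) := by gcongr
      _ = _ := by ring

lemma kernel_neg_two_le {ε : ℝ} (hb : b < 2) (hp : 0 < p) (hq : 0 < q) (hε : 0 ≤ ε) :
    ∫⁻ x, kerE b p q x * ENNReal.ofReal |((x + ε) ^ 2)⁻¹| ≤ ENNReal.ofReal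
      (negTwoConst b * (p ^ 2 * (p ^ (-(b / 2)) / (p + ε))) * (q ^ 2 * (q ^ (-(b / 2)) / (q + ε)))) := by
  simp only [abs_inv, abs_pow, sq_abs]
  refine (lintegral_kerE_neg_two_le hb hp hq hε).trans_eq ?_
  have h : ∀ r : ℝ, 0 < r → r ^ (2 - b / 2) = r ^ 2 * r ^ (-(b / 2)) := by
    intro r hr; rw [← Real.rpow_natCast r 2, ← Real.rpow_add hr]; congr 1
  rw [Real.mul_rpow hp.le hq.le, h p hp, h q hq]
  congr 1
  field_simp

/-- The part `x⁻²` is the unregularised case `ε = 0` of `kernel_neg_two_le`. Both sides carry the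
same weight, which makes the gain term a bounded bilinear map on the weighted space. -/
lemma kernel_dataWeight_le (hb₁ : 1 < b) (hb : b < 2) (hp : 0 < p) (hq : 0 < q) :
    ∫⁻ x, kerE b p q x * ENNReal.ofReal |dataWeight x| ≤ ENNReal.ofReal
      ((negTwoConst b + 4 * kerConst b) * (p ^ 2 * dataWeight p) * (q ^ 2 * dataWeight q)) := by
  have h1 := kernel_neg_two_le (ε := 0) hb hp hq le_rfl
  have h2 := kernel_sq_le hb₁ hb hp hq (w := dataWeight) (fun s h1 h2 r hr => rpow_le_dataWeight hr (by linarith) h2)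
  have e : ∀ x, ENNReal.ofReal |dataWeight x| ≤ ENNReal.ofReal |((x + 0) ^ 2)⁻¹| + ENNReal.ofReal |x ^ 2| := by
    intro x
    rw [← ENNReal.ofReal_add (abs_nonneg _) (abs_nonneg _)]
    refine ENNReal.ofReal_le_ofReal ((abs_add_le _ _).trans_eq ?_)
    rw [Real.rpow_two, add_zero]
    congr 2
    rw [show (-2 : ℝ) = ((-2 : ℤ) : ℝ) by norm_num, Real.rpow_intCast]
    simp [zpow_neg]
  have hk : Measurable fun x => kerE b p q x := measurable_kerE measurable_const measurable_const measurable_id b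
  have hD : ∀ r, 0 < r → r ^ (-(b / 2)) / (r + 0) ≤ dataWeight r := by
    intro r hr
    rw [add_zero, div_eq_mul_inv, ← Real.rpow_neg_one, ← Real.rpow_add hr]
    exact rpow_le_dataWeight hr (by linarith) (by linarith)
  have hp1 := hD p hp
  have hq1 := hD q hq
  have hc := (negTwoConst_pos hb).le
  have hp2 := dataWeight_nonneg p hp
  have hq2 := dataWeight_nonneg q hq
  calc _ ≤ ∫⁻ x, (kerE b p q x * ENNReal.ofReal |((x + 0) ^ 2)⁻¹| + kerE b p q x * ENNReal.ofReal |x ^ 2|) := by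
        refine lintegral_mono fun x => ?_
        rw [← mul_add]; gcongr; exact e x
    _ = _ := lintegral_add_left (by fun_prop) _
    _ ≤ _ := add_le_add h1 h2
    _ ≤ _ := by
        have hc2 := (kerConst_pos hb).le
        rw [← ENNReal.ofReal_add (by positivity) (by positivity)]
        refine ENNReal.ofReal_le_ofReal ?_
        rw [add_mul, add_mul]
        gcongr

end Kernel

/-- The moment `∫ r^s n(r) dr`. -/
def mom (s : ℝ) (n : ℝ → ℝ) : ℝ := ∫ r, r ^ s * n r ∂radVol

/-- The coefficient of the loss term. -/
def lossConst (κ b : ℝ) : ℝ := 4 * Real.pi ^ 2 * κ * kerConst b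

lemma lossConst_pos {κ b : ℝ} (hκ : 0 < κ) (hb : b < 2) : 0 < lossConst κ b := by
  have := kerConst_pos hb
  unfold lossConst; positivity

variable {κ b : ℝ} {n m W : ℝ → ℝ}

lemma integral_kerN_mul {w p q : ℝ} (hb : b < 2) (hp : 0 < p) (hq : 0 < q) (hW : Measurable W)
    (hW0 : ∀ x, 0 < x → 0 ≤ W x) (hw : 0 ≤ w)
    (h : ∫⁻ x, kerE b p q x * ENNReal.ofReal |W x| = ENNReal.ofReal w) :
    ∫ x, (kerN b p q x : ℝ) * W x = w := by
  have hE : 0 ≤ p + q := by positivity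
  have hk : Measurable fun x => (kerN b p q x : ℝ) :=
    (measurable_kerE measurable_const measurable_const measurable_id b).ennreal_toNNReal.coe_nnreal_real
  rw [integral_eq_lintegral_of_nonneg_ae, ← ENNReal.toReal_ofReal hw, ← h]
  · congr 1
    refine lintegral_congr_ae ?_
    filter_upwards [ae_kerE_ne_top hb hp hq] with x hx
    by_cases hx' : 0 < x ∧ x < p + q
    · rw [abs_of_nonneg (hW0 x hx'.1), ENNReal.ofReal_mul (by positivity)]
      congr 1
      simp [kerN, ENNReal.coe_toNNReal hx]
    · simp [kerN, kerE_eq_zero hE hx']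
  · refine .of_forall fun x => ?_
    by_cases hx' : 0 < x ∧ x < p + q
    · exact mul_nonneg (NNReal.coe_nonneg _) (hW0 x hx'.1)
    · simp [kerN, kerE_eq_zero hE hx']
  · exact (hk.mul hW).aestronglyMeasurable

lemma integral_weakGain {w : ℝ → ℝ → ℝ} (h : Integrable (weakGain W n m) (radColl b))
    (hw : ∀ p q, 0 < p → 0 < q → ∫ x, (kerN b p q x : ℝ) * W x = w p q) :
    ∫ y, weakGain W n m y ∂radColl b =
      ∫ p, ∫ q, w p q * (n p / p ^ 2 * (m q / q ^ 2)) ∂radVol ∂radVol := by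
  rw [radColl, integrable_withDensity_iff_integrable_smul (measurable_kerN b)] at h
  rw [radColl, integral_withDensity_eq_integral_smul (measurable_kerN b), integral_prod _ h]
  refine integral_congr_ae ?_
  filter_upwards [ae_radVol_pos, h.prod_right_ae] with p hp hpi
  rw [integral_prod _ hpi]
  refine integral_congr_ae ?_
  filter_upwards [ae_radVol_pos] with q hq
  rw [← hw p q hp hq, ← integral_mul_const]
  refine integral_congr_ae (.of_forall fun x => ?_)
  simp only [weakGain, NNReal.smul_def, smul_eq_mul]; ring

lemma integrable_weakGain_one (hb : b < 2) (hn : AEStronglyMeasurable n radVol)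
    (hm : AEStronglyMeasurable m radVol) (hn1 : Integrable (fun r => r ^ (-(b / 2)) * n r) radVol)
    (hm1 : Integrable (fun r => r ^ (-(b / 2)) * m r) radVol) :
    Integrable (weakGain (fun _ => 1) n m) (radColl b) :=
  (integrable_weakGain hb measurable_const (fun _ hr => Real.rpow_nonneg hr.le _)
    (fun _ hr => Real.rpow_nonneg hr.le _) (kerConst_pos hb).le hn hm hn1 hm1
    (fun _ _ hp hq => kernel_one_le hb hp hq)).1

/-- Conservation of the number of particles. -/
lemma integral_gain_one (hb : b < 2) (hn : AEStronglyMeasurable n radVol)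
    (hm : AEStronglyMeasurable m radVol) (hn1 : Integrable (fun r => r ^ (-(b / 2)) * n r) radVol)
    (hm1 : Integrable (fun r => r ^ (-(b / 2)) * m r) radVol) :
    ∫ p, gain κ b n m p ∂radVol = lossConst κ b * mom (-(b / 2)) n * mom (-(b / 2)) m := by
  have hi := integrable_weakGain_one hb hn hm hn1 hm1
  have h := integral_gain (κ := κ) hi
  simp only [one_mul] at h
  rw [h, integral_weakGain hi (w := fun p q => kerConst b * (p ^ 2 * p ^ (-(b / 2))) * (q ^ 2 * q ^ (-(b / 2))))]
  · have : ∫ p, ∫ q, kerConst b * (p ^ 2 * p ^ (-(b / 2))) * (q ^ 2 * q ^ (-(b / 2))) *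
        (n p / p ^ 2 * (m q / q ^ 2)) ∂radVol ∂radVol =
        ∫ p, ∫ q, kerConst b * (p ^ (-(b / 2)) * n p) * (q ^ (-(b / 2)) * m q) ∂radVol ∂radVol := by
      refine integral_congr_ae ?_
      filter_upwards [ae_radVol_pos] with p hp
      refine integral_congr_ae ?_
      filter_upwards [ae_radVol_pos] with q hq
      field_simp
    rw [this]
    simp only [integral_const_mul, integral_mul_const, mom, lossConst]
    ring
  · intro p q hp hq
    have hc := (kerConst_pos hb).le
    refine integral_kerN_mul hb hp hq measurable_const (fun _ _ => zero_le_one) (by positivity) ?_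
    rw [← kerConst_mul hp hq]
    simp [lintegral_kerE_one hb hp hq]

lemma integrable_mul_of_le {w v : ℝ → ℝ} (hw : Measurable w) (hn : AEStronglyMeasurable n radVol)
    (hv : Integrable (fun r => v r * n r) radVol) (h0 : ∀ r, 0 < r → 0 ≤ w r) {C : ℝ}
    (h : ∀ r, 0 < r → w r ≤ C * v r) : Integrable (fun r => w r * n r) radVol := by
  refine (hv.const_mul C).mono (hw.aestronglyMeasurable.mul hn) ?_
  filter_upwards [ae_radVol_pos] with r hr
  rw [← mul_assoc, norm_mul, norm_mul]
  gcongr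
  rw [Real.norm_of_nonneg (h0 r hr)]
  exact (h r hr).trans (le_abs_self _)

/-- Conservation of energy. -/
lemma integral_gain_id (hb₁ : 1 < b) (hb : b < 2) (hn : AEStronglyMeasurable n radVol)
    (hn1 : Integrable (fun r => solWeight r * n r) radVol) :
    Integrable (fun p => p * gain κ b n n p) radVol ∧
    ∫ p, p * gain κ b n n p ∂radVol = lossConst κ b * mom (-(b / 2)) n * mom (1 - b / 2) n := by
  have hc := (kerConst_pos hb).le
  have hsol : ∀ s : ℝ, -1 ≤ s → s ≤ 2 → Integrable (fun r : ℝ => r ^ s * n r) radVol := by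
    intro s h1 h2
    exact integrable_mul_of_le (by fun_prop) hn hn1 (fun r hr => Real.rpow_nonneg hr.le _) (C := 1)
      (fun r hr => by rw [one_mul]; exact rpow_le_solWeight hr h1 h2)
  have hi : Integrable (weakGain (fun x => x) n n) (radColl b) := by
    refine (integrable_weakGain hb measurable_id solWeight_nonneg solWeight_nonneg (C := kerConst b) hc hn hn hn1 hn1
      fun p q hp hq => ?_).1
    refine (kernel_abs_id_eq hb hp hq).trans_le ?_
    refine ENNReal.ofReal_le_ofReal ?_
    have h : ∀ r : ℝ, 0 < r → r ^ (-(b / 2)) * r ≤ solWeight r := by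
      intro r hr
      nth_rw 2 [← Real.rpow_one r]
      rw [← Real.rpow_add hr]
      exact rpow_le_solWeight hr (by linarith) (by linarith)
    have hp1 := h p hp
    have hq1 := h q hq
    have hp2 := rpow_le_solWeight hp (s := -(b / 2)) (by linarith) (by linarith)
    have hq2 := rpow_le_solWeight hq (s := -(b / 2)) (by linarith) (by linarith)
    have hp0 := Real.rpow_nonneg hp.le (-(b / 2))
    have hq0 := Real.rpow_nonneg hq.le (-(b / 2))
    have hp3 := solWeight_nonneg p hp
    calc _ = (kerConst b * p ^ 2 * q ^ 2 / 2) * ((p ^ (-(b / 2)) * p) * q ^ (-(b / 2)) +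
          p ^ (-(b / 2)) * (q ^ (-(b / 2)) * q)) := by ring
      _ ≤ (kerConst b * p ^ 2 * q ^ 2 / 2) * (solWeight p * solWeight q + solWeight p * solWeight q) := by gcongr
      _ = _ := by ring
  refine ⟨integrable_gain hi, ?_⟩
  rw [integral_gain (κ := κ) hi, integral_weakGain hi
    (w := fun p q => kerConst b * (p ^ 2 * p ^ (-(b / 2))) * (q ^ 2 * q ^ (-(b / 2))) * ((p + q) / 2))]
  · have h1 := hsol (-(b / 2)) (by linarith) (by linarith)
    have h2 := hsol (1 - b / 2) (by linarith) (by linarith)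
    have e1 : ∀ p, 0 < p → ∫ q, kerConst b * (p ^ 2 * p ^ (-(b / 2))) * (q ^ 2 * q ^ (-(b / 2))) * ((p + q) / 2) *
        (n p / p ^ 2 * (n q / q ^ 2)) ∂radVol = kerConst b / 2 * (p ^ (1 - b / 2) * n p) * mom (-(b / 2)) n +
          kerConst b / 2 * (p ^ (-(b / 2)) * n p) * mom (1 - b / 2) n := by
      intro p hp
      rw [mom, mom, ← integral_const_mul, ← integral_const_mul, ← integral_add (h1.const_mul _) (h2.const_mul _)]
      refine integral_congr_ae ?_
      filter_upwards [ae_radVol_pos] with q hq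
      rw [show 1 - b / 2 = -(b / 2) + 1 by ring, Real.rpow_add hp, Real.rpow_add hq, Real.rpow_one, Real.rpow_one]
      field_simp
    have e2 : ∫ p, ∫ q, kerConst b * (p ^ 2 * p ^ (-(b / 2))) * (q ^ 2 * q ^ (-(b / 2))) * ((p + q) / 2) *
        (n p / p ^ 2 * (n q / q ^ 2)) ∂radVol ∂radVol =
        ∫ p, (kerConst b / 2 * (p ^ (1 - b / 2) * n p) * mom (-(b / 2)) n +
          kerConst b / 2 * (p ^ (-(b / 2)) * n p) * mom (1 - b / 2) n) ∂radVol := by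
      refine integral_congr_ae ?_
      filter_upwards [ae_radVol_pos] with p hp using e1 p hp
    rw [e2, integral_add ((h2.const_mul _).mul_const _) ((h1.const_mul _).mul_const _)]
    simp only [integral_mul_const, integral_const_mul]
    change 4 * Real.pi ^ 2 * κ * (kerConst b / 2 * mom (1 - b / 2) n * mom (-(b / 2)) n +
      kerConst b / 2 * mom (-(b / 2)) n * mom (1 - b / 2) n) = _
    rw [lossConst]; ring
  · intro p q hp hq
    exact integral_kerN_mul hb hp hq measurable_id (fun x hx => hx.le) (by positivity) (kernel_abs_id_eq hb hp hq)

end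

/-! ### Radial functions and their collision operator -/

lemma toSphere_real_univ : (volume : Measure Mom).toSphere.real univ = 4 * Real.pi := by
  rw [Measure.toSphere_real_apply_univ, measureReal_def, EuclideanSpace.volume_ball_fin_three]
  simp
  rw [ENNReal.toReal_ofReal (by positivity)]
  ring

lemma quasiMeasurePreserving_norm : Measure.QuasiMeasurePreserving (fun x : Mom => ‖x‖) volume radVol := by
  refine ⟨measurable_norm, Measure.AbsolutelyContinuous.mk fun s hs h0 => ?_⟩
  rw [Measure.map_apply measurable_norm hs, ← lintegral_indicator_one (measurable_norm hs),
    lintegral_polar (measurable_one.indicator (measurable_norm hs))]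
  have h1 : ∀ᵐ r ∂radVol, r ∉ s := measure_eq_zero_iff_ae_notMem.1 h0
  have : ∀ᵐ r ∂radVol, ENNReal.ofReal (r ^ 2) * ∫⁻ w : Sph,
      ((fun x : Mom => ‖x‖) ⁻¹' s).indicator (1 : Mom → ℝ≥0∞) (r • (w : Mom)) ∂sphMeasure = 0 := by
    filter_upwards [h1, ae_radVol_pos] with r hr hr0
    have h2 : ∀ w : Sph, ((fun x : Mom => ‖x‖) ⁻¹' s).indicator (1 : Mom → ℝ≥0∞) (r • (w : Mom)) = 0 := by
      intro w
      refine indicator_of_notMem ?_ _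
      rw [mem_preimage, norm_smul, norm_sph, mul_one, Real.norm_of_nonneg hr0.le]
      exact hr
    simp only [h2, lintegral_zero, mul_zero]
  rw [show (volume : Measure ℝ).restrict (Ioi 0) = radVol from rfl, lintegral_congr_ae this, lintegral_zero]

lemma integrable_norm_iff {f : ℝ → ℝ} :
    Integrable (fun x : Mom => f ‖x‖) ↔ Integrable (fun r => r ^ 2 * f r) radVol := by
  rw [integrable_fun_norm_addHaar]
  simp [IntegrableOn, radVol]

lemma integral_norm (f : ℝ → ℝ) : ∫ x : Mom, f ‖x‖ = 4 * Real.pi * ∫ r, r ^ 2 * f r ∂radVol := by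
  rw [integral_fun_norm_addHaar, ← toSphere_real_univ, Measure.toSphere_real_apply_univ, radVol]
  simp [mul_assoc]

/-- The radial function on momentum space with density `n` (with respect to `4 π dr`). -/
def radFun (n : ℝ → ℝ) (x : Mom) : ℝ := n ‖x‖ / ‖x‖ ^ 2

lemma integrable_radFun {n : ℝ → ℝ} : Integrable (radFun n) ↔ Integrable n radVol := by
  unfold radFun
  rw [integrable_norm_iff (f := fun r => n r / r ^ 2)]
  refine integrable_congr ?_
  filter_upwards [ae_radVol_pos] with r hr
  field_simp

lemma integral_radFun_mul (n w : ℝ → ℝ) :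
    ∫ x : Mom, radFun n x * w ‖x‖ = 4 * Real.pi * ∫ r, w r * n r ∂radVol := by
  unfold radFun
  rw [integral_norm (f := fun r => n r / r ^ 2 * w r)]
  congr 1
  refine integral_congr_ae ?_
  filter_upwards [ae_radVol_pos] with r hr
  field_simp

lemma integrable_radFun_mul {n w : ℝ → ℝ} :
    Integrable (fun x : Mom => radFun n x * w ‖x‖) ↔ Integrable (fun r => w r * n r) radVol := by
  unfold radFun
  rw [integrable_norm_iff (f := fun r => n r / r ^ 2 * w r)]
  refine integrable_congr ?_
  filter_upwards [ae_radVol_pos] with r hr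
  field_simp

lemma radFun_congr {n m : ℝ → ℝ} (h : n =ᵐ[radVol] m) : radFun n =ᵐ[volume] radFun m := by
  filter_upwards [quasiMeasurePreserving_norm.ae_eq_comp h] with x hx
  simp only [Function.comp] at hx
  simp only [radFun, hx]

/-- The collision integral for a function of the energies involved. -/
lemma integral_collMeasure {b : ℝ} (hb : b < 2) {p : Mom} (hp : p ≠ 0) {F : ℝ → ℝ → ℝ}
    (hF : Measurable (Function.uncurry F)) (hF0 : ∀ q x, 0 ≤ F q x)
    (hi : Integrable (fun z : ℝ × ℝ => (kerN b ‖p‖ z.1 z.2 : ℝ) * F z.1 z.2) (radVol.prod volume)) :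
    Integrable (fun z : Mom × Sph => relMom p z.1 ^ (2 - b) / (‖p‖ * ‖z.1‖) *
      F ‖z.1‖ ‖postMom p z.1 (z.2 : Mom)‖) collMeasure ∧
    ∫ z, relMom p z.1 ^ (2 - b) / (‖p‖ * ‖z.1‖) * F ‖z.1‖ ‖postMom p z.1 (z.2 : Mom)‖ ∂collMeasure =
      4 * Real.pi ^ 2 / ‖p‖ ^ 2 * ∫ z, (kerN b ‖p‖ z.1 z.2 : ℝ) * F z.1 z.2 ∂(radVol.prod volume) := by
  have hn : 0 < ‖p‖ := norm_pos_iff.2 hp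
  have hF' : Measurable (Function.uncurry fun q x => ENNReal.ofReal (F q x)) := hF.ennreal_ofReal
  have h := lintegral_collMeasure (b := b) hp hF'
  have hmp := measurable_postMom.comp (by fun_prop : Measurable fun z : Mom × Sph => (p, z))
  have hmr : Measurable fun q : Mom => relMom p q := by unfold relMom; fun_prop
  have hmF : Measurable fun z : Mom × Sph => F ‖z.1‖ ‖postMom p z.1 (z.2 : Mom)‖ :=
    hF.comp (Measurable.prodMk (by fun_prop) hmp.norm)
  have hw : ∀ q : Mom, 0 ≤ relMom p q ^ (2 - b) / (‖p‖ * ‖q‖) := fun q =>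
    div_nonneg (Real.rpow_nonneg (relMom_nonneg _ _) _) (by positivity)
  have hm : AEStronglyMeasurable (fun z : Mom × Sph => relMom p z.1 ^ (2 - b) / (‖p‖ * ‖z.1‖) *
      F ‖z.1‖ ‖postMom p z.1 (z.2 : Mom)‖) collMeasure := by
    refine Measurable.aestronglyMeasurable ?_; fun_prop
  have h0 : ∀ z : Mom × Sph, 0 ≤ relMom p z.1 ^ (2 - b) / (‖p‖ * ‖z.1‖) *
      F ‖z.1‖ ‖postMom p z.1 (z.2 : Mom)‖ := fun z => mul_nonneg (hw _) (hF0 _ _)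
  have hk : Measurable fun z : ℝ × ℝ => (kerN b ‖p‖ z.1 z.2 : ℝ≥0∞) * ENNReal.ofReal (F z.1 z.2) :=
    (((measurable_kerN b).comp (by fun_prop : Measurable fun z : ℝ × ℝ => (‖p‖, z))).coe_nnreal_ennreal).mul hF'
  have e1 : ∫⁻ q in Ioi (0 : ℝ), ∫⁻ x, kerE b ‖p‖ q x * ENNReal.ofReal (F q x) =
      ENNReal.ofReal (∫ z, (kerN b ‖p‖ z.1 z.2 : ℝ) * F z.1 z.2 ∂(radVol.prod volume)) := by
    rw [ofReal_integral_eq_lintegral_ofReal hi (.of_forall fun z => mul_nonneg (NNReal.coe_nonneg _) (hF0 _ _))]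
    simp only [ENNReal.ofReal_mul (NNReal.coe_nonneg _), ENNReal.ofReal_coe_nnreal]
    rw [lintegral_prod _ hk.aemeasurable]
    refine lintegral_congr_ae ?_
    filter_upwards [ae_radVol_pos] with q hq
    refine lintegral_congr_ae ?_
    filter_upwards [ae_kerE_ne_top hb hn hq] with x hx
    simp only [kerN, ENNReal.coe_toNNReal hx]
  have e2 : ∫⁻ z, ENNReal.ofReal (relMom p z.1 ^ (2 - b) / (‖p‖ * ‖z.1‖) *
      F ‖z.1‖ ‖postMom p z.1 (z.2 : Mom)‖) ∂collMeasure = ENNReal.ofReal (4 * Real.pi ^ 2 / ‖p‖ ^ 2 *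
        ∫ z, (kerN b ‖p‖ z.1 z.2 : ℝ) * F z.1 z.2 ∂(radVol.prod volume)) := by
    rw [ENNReal.ofReal_mul (by positivity), ← e1, ← h]
    refine lintegral_congr fun z => ?_
    rw [ENNReal.ofReal_mul (hw _)]
  constructor
  · refine ⟨hm, ?_⟩
    rw [hasFiniteIntegral_iff_ofReal (.of_forall h0), e2]
    exact ENNReal.ofReal_lt_top
  · rw [integral_eq_lintegral_of_nonneg_ae (.of_forall h0) hm, e2, ENNReal.toReal_ofReal]
    exact mul_nonneg (by positivity) (integral_nonneg fun z => mul_nonneg (NNReal.coe_nonneg _) (hF0 _ _))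

lemma integrable_kerN_loss {b : ℝ} (hb : b < 2) {p : ℝ} (hp : 0 < p) {n : ℝ → ℝ} (hn : Measurable n)
    (hn0 : ∀ r, 0 ≤ n r) (hi : Integrable (fun r => r ^ (-(b / 2)) * n r) radVol) :
    Integrable (fun z : ℝ × ℝ => (kerN b p z.1 z.2 : ℝ) * (n z.1 / z.1 ^ 2)) (radVol.prod volume) ∧
    ∫ z, (kerN b p z.1 z.2 : ℝ) * (n z.1 / z.1 ^ 2) ∂(radVol.prod volume) =
      kerConst b * (p ^ 2 * p ^ (-(b / 2))) * mom (-(b / 2)) n := by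
  have hc := (kerConst_pos hb).le
  have hk : Measurable fun z : ℝ × ℝ => (kerN b p z.1 z.2 : ℝ) :=
    ((measurable_kerN b).comp (by fun_prop : Measurable fun z : ℝ × ℝ => (p, z))).coe_nnreal_real
  have e1 : ∀ q, 0 < q → ∫ x, (kerN b p q x : ℝ) * (n q / q ^ 2) =
      kerConst b * (p ^ 2 * p ^ (-(b / 2))) * (q ^ (-(b / 2)) * n q) := by
    intro q hq
    have := integral_kerN_mul (W := fun _ => 1) hb hp hq measurable_const (fun _ _ => zero_le_one)
      (w := kerConst b * (p ^ 2 * p ^ (-(b / 2))) * (q ^ 2 * q ^ (-(b / 2)))) (by positivity)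
      (by rw [← kerConst_mul hp hq]; simp [lintegral_kerE_one hb hp hq])
    simp only [mul_one] at this
    rw [integral_mul_const, this]
    field_simp
  have hint : Integrable (fun z : ℝ × ℝ => (kerN b p z.1 z.2 : ℝ) * (n z.1 / z.1 ^ 2)) (radVol.prod volume) := by
    rw [integrable_prod_iff (by refine Measurable.aestronglyMeasurable ?_; fun_prop)]
    constructor
    · filter_upwards [ae_radVol_pos] with q hq
      refine Integrable.mul_const ?_ _
      refine ⟨(hk.comp measurable_prodMk_left).aestronglyMeasurable, ?_⟩
      rw [hasFiniteIntegral_iff_ofReal (.of_forall fun x => NNReal.coe_nonneg _)]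
      refine lt_of_le_of_lt (lintegral_mono (g := fun x => kerE b p q x) fun x => ?_) ?_
      · simp only [kerN, ENNReal.ofReal_coe_nnreal]; exact ENNReal.coe_toNNReal_le_self
      · rw [lintegral_kerE_one hb hp hq]; exact ENNReal.ofReal_lt_top
    · refine (hi.const_mul (kerConst b * (p ^ 2 * p ^ (-(b / 2))))).congr ?_
      filter_upwards [ae_radVol_pos] with q hq
      rw [← e1 q hq]
      refine integral_congr_ae (.of_forall fun x => ?_)
      simp only []
      rw [Real.norm_of_nonneg]
      have := hn0 q
      positivity
  refine ⟨hint, ?_⟩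
  rw [integral_prod _ hint, mom, ← integral_const_mul]
  refine integral_congr_ae ?_
  filter_upwards [ae_radVol_pos] with q hq using e1 q hq

/-- The collision operator for radial densities. -/
def collRad (κ b : ℝ) (n : ℝ → ℝ) (r : ℝ) : ℝ :=
  gain κ b n n r - lossConst κ b * mom (-(b / 2)) n * (r ^ (-(b / 2)) * n r)

/-- Gain and loss are integrable separately, so each is reduced to energies on its own. The function
`f` is only almost everywhere radial; `ae_postMom` permits the substitution at the outgoing momenta.
-/
lemma collision_radFun_of_measurable {κ b : ℝ} (hb : b < 2) {n : ℝ → ℝ} (hn : Measurable n)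
    (hn0 : ∀ r, 0 ≤ n r) (hi : Integrable (fun r => r ^ (-(b / 2)) * n r) radVol) {f : Mom → ℝ}
    (hf : f =ᵐ[volume] radFun n) :
    ∀ᵐ p : Mom, Integrable (collIntegrand κ b f p) collMeasure ∧
      collision κ b f p = radFun (collRad κ b n) p := by
  have h1 := integrable_weakGain_one (b := b) hb hn.aestronglyMeasurable hn.aestronglyMeasurable hi hi
  have hp0 : ∀ᵐ p : Mom, p ≠ 0 := by simp [ae_iff]
  have hfq : ∀ᵐ z ∂collMeasure, f z.1 = radFun n z.1 := Measure.quasiMeasurePreserving_fst.ae hf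
  filter_upwards [hp0, hf, ae_postMom hf, quasiMeasurePreserving_norm.ae (ae_integrable_gainKer h1)] with p hp hfp hpost hg
  have hnp : 0 < ‖p‖ := norm_pos_iff.2 hp
  set φ : ℝ → ℝ := fun r => n r / r ^ 2 with hφ
  have hφm : Measurable φ := by fun_prop
  have hφ0 : ∀ r, 0 ≤ φ r := fun r => div_nonneg (hn0 r) (sq_nonneg r)
  obtain ⟨hG1, hG2⟩ := integral_collMeasure hb hp (F := fun q x => φ x * φ (‖p‖ + q - x))
    (by unfold Function.uncurry; fun_prop) (fun q x => mul_nonneg (hφ0 _) (hφ0 _)) hg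
  obtain ⟨hl1, hl2⟩ := integrable_kerN_loss hb hnp hn hn0 hi
  obtain ⟨hL1, hL2⟩ := integral_collMeasure hb hp (F := fun q _ => φ q)
    (by unfold Function.uncurry; fun_prop) (fun q x => hφ0 _) hl1
  have hae : collIntegrand κ b f p =ᵐ[collMeasure] fun z : Mom × Sph =>
      κ * (relMom p z.1 ^ (2 - b) / (‖p‖ * ‖z.1‖) * (φ ‖postMom p z.1 (z.2 : Mom)‖ *
        φ (‖p‖ + ‖z.1‖ - ‖postMom p z.1 (z.2 : Mom)‖))) -
      κ * φ ‖p‖ * (relMom p z.1 ^ (2 - b) / (‖p‖ * ‖z.1‖) * φ ‖z.1‖) := by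
    filter_upwards [hfq, hpost] with z h1 h2
    simp only [collIntegrand, gainLoss]
    rw [h1, h2.1, h2.2, hfp]
    simp only [radFun, hφ, norm_postMom_neg]
    ring
  have hint := (hG1.const_mul κ).sub (hL1.const_mul (κ * φ ‖p‖))
  refine ⟨hint.congr hae.symm, ?_⟩
  rw [collision, integral_congr_ae hae, integral_sub (hG1.const_mul κ) (hL1.const_mul (κ * φ ‖p‖)),
    integral_const_mul, integral_const_mul, hG2, hL2, hl2, radFun, collRad, gain, lossConst,
    show (fun z : ℝ × ℝ => (kerN b ‖p‖ z.1 z.2 : ℝ) * (φ z.2 * φ (‖p‖ + z.1 - z.2))) = gainKer b n n ‖p‖ from rfl]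
  simp only [hφ]
  field_simp

lemma collision_radFun {κ b : ℝ} (hb : b < 2) {n : ℝ → ℝ} (hn : AEStronglyMeasurable n radVol)
    (hn0 : ∀ᵐ r ∂radVol, 0 ≤ n r) (hi : Integrable (fun r => r ^ (-(b / 2)) * n r) radVol) {f : Mom → ℝ}
    (hf : f =ᵐ[volume] radFun n) :
    ∀ᵐ p : Mom, Integrable (collIntegrand κ b f p) collMeasure ∧
      collision κ b f p = radFun (collRad κ b n) p := by
  set n' : ℝ → ℝ := fun r => max (hn.mk n r) 0 with hn'
  have hm : Measurable n' := hn.stronglyMeasurable_mk.measurable.max measurable_const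
  have he : n =ᵐ[radVol] n' := by
    filter_upwards [hn.ae_eq_mk, hn0] with r h1 h2
    change n r = max (hn.mk n r) 0
    rw [← h1, max_eq_left h2]
  have he' : (fun r => r ^ (-(b / 2)) * n r) =ᵐ[radVol] fun r => r ^ (-(b / 2)) * n' r := by
    filter_upwards [he] with r hr; rw [hr]
  have h := collision_radFun_of_measurable (κ := κ) hb hm (fun r => le_max_right _ _) (hi.congr he')
    (hf.trans (radFun_congr he))
  have hc : collRad κ b n =ᵐ[radVol] collRad κ b n' := by
    filter_upwards [he, gain_congr (b := b) he he] with r h1 h2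
    have h3 : mom (-(b / 2)) n = mom (-(b / 2)) n' := integral_congr_ae he'
    rw [collRad, collRad, gain, gain, integral_congr_ae h2, h1, h3]
  filter_upwards [h, radFun_congr hc] with p h1 h2
  exact ⟨h1.1, h1.2.trans h2.symm⟩

/-! ### Solutions in terms of radial densities -/

/-- The space of radial densities. -/
abbrev RadL : Type := Lp ℝ 1 radVol

lemma RadL.integrable (n : RadL) : Integrable n radVol := L1.integrable_coeFn n

lemma RadL.aesm (n : RadL) : AEStronglyMeasurable n radVol := (Lp.stronglyMeasurable n).aestronglyMeasurable

lemma RadL.norm_eq (n : RadL) : ‖n‖ = ∫ r, |n r| ∂radVol := by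
  rw [L1.norm_eq_integral_norm]; rfl

lemma RadL.nonneg_iff {n : RadL} : 0 ≤ n ↔ ∀ᵐ r ∂radVol, 0 ≤ n r := by
  rw [← Lp.coeFn_nonneg]; rfl

/-- The class of a radial function, from the class of its density, as a linear map. -/
def radEmbLin : RadL →ₗ[ℝ] L1 where
  toFun n := (integrable_radFun.2 n.integrable).toL1 _
  map_add' n m := by
    rw [← Integrable.toL1_add, Integrable.toL1_eq_toL1_iff]
    filter_upwards [radFun_congr (Lp.coeFn_add n m)] with x hx
    rw [hx]; simp [radFun, add_div]
  map_smul' c n := by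
    rw [RingHom.id_apply, ← Integrable.toL1_smul, Integrable.toL1_eq_toL1_iff]
    filter_upwards [radFun_congr (Lp.coeFn_smul c n)] with x hx
    rw [hx]; simp [radFun, mul_div_assoc]

lemma coe_radEmbLin (n : RadL) : radEmbLin n =ᵐ[volume] radFun n :=
  (integrable_radFun.2 n.integrable).coeFn_toL1

lemma norm_radEmbLin (n : RadL) : ‖radEmbLin n‖ = 4 * Real.pi * ‖n‖ := by
  rw [L1.norm_eq_integral_norm, RadL.norm_eq]
  have h := integral_radFun_mul (fun r => |n r|) (fun _ => 1)
  simp only [one_mul, mul_one] at h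
  rw [← h]
  refine integral_congr_ae ?_
  filter_upwards [coe_radEmbLin n] with x hx
  rw [hx, radFun, radFun, Real.norm_eq_abs, abs_div, abs_of_nonneg (sq_nonneg ‖x‖)]

/-- The class of a radial function, from the class of its density. -/
def radEmb : RadL →L[ℝ] L1 := radEmbLin.mkContinuous (4 * Real.pi) fun n => (norm_radEmbLin n).le

lemma coe_radEmb (n : RadL) : radEmb n =ᵐ[volume] radFun n := coe_radEmbLin n

lemma norm_radEmb (n : RadL) : ‖radEmb n‖ = 4 * Real.pi * ‖n‖ := norm_radEmbLin n

lemma radEmb_eq_of_ae {n : RadL} {f : L1} (h : f =ᵐ[volume] radFun n) : radEmb n = f :=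
  Lp.ext ((coe_radEmb n).trans h.symm)

lemma isInducing_radEmb : IsInducing radEmb := by
  have h : AntilipschitzWith (Real.toNNReal (4 * Real.pi)⁻¹) radEmb := by
    refine AddMonoidHomClass.antilipschitz_of_bound radEmb fun n => ?_
    rw [norm_radEmb, Real.coe_toNNReal _ (by positivity), inv_mul_cancel_left₀ (by positivity)]
  exact (h.isUniformInducing radEmb.uniformContinuous).isInducing

lemma hasDerivWithinAt_of_radEmb {n : ℝ → RadL} {n' : RadL} {S : Set ℝ} {s : ℝ}
    (h : HasDerivWithinAt (fun s => radEmb (n s)) (radEmb n') S s) : HasDerivWithinAt n n' S s := by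
  rw [hasDerivWithinAt_iff_isLittleO] at h ⊢
  refine Asymptotics.IsBigO.trans_isLittleO (Asymptotics.IsBigO.of_bound (4 * Real.pi)⁻¹ (.of_forall fun x => ?_)) h
  rw [← map_smul, ← map_sub, ← map_sub, norm_radEmb, inv_mul_cancel_left₀ (by positivity)]

lemma isIsotropic_radEmb (n : RadL) : IsIsotropic (radEmb n) := by
  have := (Lp.stronglyMeasurable n).measurable
  exact ⟨fun r => n r / r ^ 2, by fun_prop, coe_radEmb n⟩

lemma radEmb_nonneg {n : RadL} (h : 0 ≤ n) : 0 ≤ radEmb n := by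
  rw [← Lp.coeFn_nonneg]
  filter_upwards [coe_radEmb n, quasiMeasurePreserving_norm.ae (RadL.nonneg_iff.1 h)] with x h1 h2
  rw [h1]
  exact div_nonneg h2 (sq_nonneg _)

lemma exists_radEmb_eq {f : L1} (h : IsIsotropic f) (h0 : 0 ≤ f) : ∃ n : RadL, 0 ≤ n ∧ radEmb n = f := by
  obtain ⟨φ, hφ, hf⟩ := h
  rw [← Lp.coeFn_nonneg] at h0
  set m : ℝ → ℝ := fun r => max (φ r) 0 * r ^ 2
  have hx0 : ∀ᵐ x : Mom, x ≠ 0 := by simp [ae_iff]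
  have hm : f =ᵐ[volume] radFun m := by
    filter_upwards [hf, h0, hx0] with x h1 h2 h3
    have : ‖x‖ ≠ 0 := norm_ne_zero_iff.2 h3
    rw [Pi.zero_apply, h1] at h2
    simp only [radFun, m]
    rw [h1, max_eq_left h2]
    field_simp
  have hi : Integrable m radVol := integrable_radFun.1 ((L1.integrable_coeFn f).congr hm)
  refine ⟨hi.toL1 m, ?_, ?_⟩
  · rw [RadL.nonneg_iff]
    filter_upwards [hi.coeFn_toL1] with r hr
    rw [hr]; exact mul_nonneg (le_max_right _ _) (sq_nonneg _)
  · exact radEmb_eq_of_ae (hm.trans (radFun_congr hi.coeFn_toL1.symm))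

lemma radEmb_injective : Function.Injective radEmb := by
  refine (injective_iff_map_eq_zero radEmb).2 fun n hn => ?_
  have := norm_radEmb n
  rw [hn, norm_zero, eq_comm, mul_eq_zero] at this
  rcases this with h | h
  · exact absurd h (by positivity)
  · exact norm_eq_zero.1 h

/-- The radial form of a solution of the Boltzmann equation. -/
structure IsRadSolution (κ b T : ℝ) (n : ℝ → RadL) : Prop where
  nonneg : ∀ s ∈ Icc 0 T, 0 ≤ n s
  moments : ∃ C : ℝ, ∀ s ∈ Icc 0 T, Integrable (fun r => solWeight r * n s r) radVol ∧
    ∫ r, solWeight r * n s r ∂radVol ≤ C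
  equation : ∃ g : ℝ → RadL, ContinuousOn g (Icc 0 T) ∧
    ∀ s ∈ Icc 0 T, HasDerivWithinAt n (g s) (Icc 0 T) s ∧ g s =ᵐ[radVol] collRad κ b (n s)

lemma measurable_solWeight : Measurable solWeight := by unfold solWeight; fun_prop

lemma integrable_rpow_mul_of_solWeight {n : RadL} (h : Integrable (fun r => solWeight r * n r) radVol) {s : ℝ}
    (h₁ : -1 ≤ s) (h₂ : s ≤ 2) : Integrable (fun r => r ^ s * n r) radVol :=
  integrable_mul_of_le (by fun_prop) n.aesm h (fun r hr => Real.rpow_nonneg hr.le _) (C := 1)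
    (fun r hr => by rw [one_mul]; exact rpow_le_solWeight hr h₁ h₂)

lemma mom_le_of_solWeight {n : RadL} (h0 : 0 ≤ n) (h : Integrable (fun r => solWeight r * n r) radVol) {s : ℝ}
    (h₁ : -1 ≤ s) (h₂ : s ≤ 2) : mom s n ≤ ∫ r, solWeight r * n r ∂radVol := by
  refine integral_mono_ae (integrable_rpow_mul_of_solWeight h h₁ h₂) h ?_
  filter_upwards [ae_radVol_pos, RadL.nonneg_iff.1 h0] with r hr h0
  exact mul_le_mul_of_nonneg_right (rpow_le_solWeight hr h₁ h₂) h0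

lemma integral_radEmb_mul (n : RadL) (w : ℝ → ℝ) :
    ∫ x : Mom, radEmb n x * w ‖x‖ = 4 * Real.pi * ∫ r, w r * n r ∂radVol := by
  rw [← integral_radFun_mul]
  refine integral_congr_ae ?_
  filter_upwards [coe_radEmb n] with x hx
  rw [hx]

lemma integrable_radEmb_mul {n : RadL} {w : ℝ → ℝ} :
    Integrable (fun x : Mom => radEmb n x * w ‖x‖) ↔ Integrable (fun r => w r * n r) radVol := by
  rw [← integrable_radFun_mul]
  refine integrable_congr ?_
  filter_upwards [coe_radEmb n] with x hx
  rw [hx]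

lemma IsRadSolution.isSolution {κ b T : ℝ} (hb₁ : 1 < b) (hb : b < 2) {n : ℝ → RadL} (h : IsRadSolution κ b T n) :
    IsSolution κ b T (radEmb (n 0)) (fun s => radEmb (n s)) where
  init := rfl
  nonneg s hs := radEmb_nonneg (h.nonneg s hs)
  isotropic s _ := isIsotropic_radEmb _
  moments := by
    obtain ⟨C, hC⟩ := h.moments
    refine ⟨4 * Real.pi * C, fun s hs m h₁ h₂ => ?_⟩
    have h1 := integrable_rpow_mul_of_solWeight (hC s hs).1 h₁ h₂
    refine ⟨(integrable_radEmb_mul (w := fun r => r ^ m)).2 h1, ?_⟩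
    rw [integral_radEmb_mul (n s) (fun r => r ^ m)]
    have := (mom_le_of_solWeight (h.nonneg s hs) (hC s hs).1 h₁ h₂).trans (hC s hs).2
    exact mul_le_mul_of_nonneg_left this (by positivity)
  converges s hs := by
    obtain ⟨C, hC⟩ := h.moments
    have h1 := integrable_rpow_mul_of_solWeight (hC s hs).1 (s := -(b / 2)) (by linarith) (by linarith)
    filter_upwards [collision_radFun (κ := κ) hb (n s).aesm (RadL.nonneg_iff.1 (h.nonneg s hs)) h1 (coe_radEmb _)]
      with p hp using hp.1
  equation := by
    obtain ⟨C, hC⟩ := h.moments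
    obtain ⟨g, hg, hd⟩ := h.equation
    refine ⟨fun s => radEmb (g s), radEmb.continuous.comp_continuousOn hg, fun s hs => ⟨?_, ?_⟩⟩
    · exact radEmb.hasFDerivAt.comp_hasDerivWithinAt s (hd s hs).1
    · have h1 := integrable_rpow_mul_of_solWeight (hC s hs).1 (s := -(b / 2)) (by linarith) (by linarith)
      filter_upwards [collision_radFun (κ := κ) hb (n s).aesm (RadL.nonneg_iff.1 (h.nonneg s hs)) h1 (coe_radEmb _),
        coe_radEmb (g s), radFun_congr (hd s hs).2] with p h1 h2 h3
      rw [h2, h3, h1.2]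

/-- Since `radEmb` multiplies norms by `4π`, continuity and differentiability pass back from the
functions to their densities. The density of the derivative exists because the derivative is in `L¹`
and is almost everywhere the radial collision term. -/
lemma IsSolution.exists_isRadSolution {κ b T : ℝ} (hb₁ : 1 < b) (hb : b < 2) {f₀ : L1} {f : ℝ → L1}
    (h : IsSolution κ b T f₀ f) :
    ∃ n : ℝ → RadL, IsRadSolution κ b T n ∧ ∀ s ∈ Icc 0 T, radEmb (n s) = f s := by
  have hex : ∀ s, ∃ n : RadL, s ∈ Icc 0 T → 0 ≤ n ∧ radEmb n = f s := by
    intro s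
    by_cases hs : s ∈ Icc 0 T
    · obtain ⟨n, hn⟩ := exists_radEmb_eq (h.isotropic s hs) (h.nonneg s hs)
      exact ⟨n, fun _ => hn⟩
    · exact ⟨0, fun h => absurd h hs⟩
  choose n hn using hex
  obtain ⟨C, hC⟩ := h.moments
  have hw : ∀ s ∈ Icc 0 T, ∀ m : ℝ, -1 ≤ m → m ≤ 2 → Integrable (fun r => r ^ m * n s r) radVol ∧
      4 * Real.pi * ∫ r, r ^ m * n s r ∂radVol ≤ C := by
    intro s hs m h₁ h₂
    have h1 := hC s hs m h₁ h₂
    rw [← (hn s hs).2] at h1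
    exact ⟨(integrable_radEmb_mul (w := fun r => r ^ m)).1 h1.1,
      (integral_radEmb_mul (n s) (fun r => r ^ m)).symm.trans_le h1.2⟩
  have hcol : ∀ s ∈ Icc 0 T, ∀ᵐ p : Mom, Integrable (collIntegrand κ b (f s) p) collMeasure ∧
      collision κ b (f s) p = radFun (collRad κ b (n s)) p := by
    intro s hs
    have := coe_radEmb (n s)
    rw [(hn s hs).2] at this
    exact collision_radFun hb (n s).aesm (RadL.nonneg_iff.1 (hn s hs).1)
      (hw s hs (-(b / 2)) (by linarith) (by linarith)).1 this
  obtain ⟨g, hgc, hg⟩ := h.equation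
  have hge : ∀ s ∈ Icc 0 T, g s =ᵐ[volume] radFun (collRad κ b (n s)) := by
    intro s hs
    filter_upwards [(hg s hs).2, hcol s hs] with p h1 h2
    rw [h1, h2.2]
  have hgi : ∀ s ∈ Icc 0 T, Integrable (collRad κ b (n s)) radVol := fun s hs =>
    integrable_radFun.1 ((L1.integrable_coeFn (g s)).congr (hge s hs))
  have hex2 : ∀ s, ∃ η : RadL, s ∈ Icc 0 T → η =ᵐ[radVol] collRad κ b (n s) ∧ radEmb η = g s := by
    intro s
    by_cases hs : s ∈ Icc 0 T
    · exact ⟨(hgi s hs).toL1 _, fun _ => ⟨(hgi s hs).coeFn_toL1, radEmb_eq_of_ae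
        ((hge s hs).trans (radFun_congr (hgi s hs).coeFn_toL1.symm))⟩⟩
    · exact ⟨0, fun h => absurd h hs⟩
  choose η hη using hex2
  refine ⟨n, ⟨fun s hs => (hn s hs).1, ⟨C / (4 * Real.pi) + C / (4 * Real.pi), fun s hs => ?_⟩, η, ?_, fun s hs => ⟨?_, (hη s hs).1⟩⟩,
    fun s hs => (hn s hs).2⟩
  · have h1 := hw s hs (-1) le_rfl (by norm_num)
    have h2 := hw s hs 2 (by norm_num) le_rfl
    simp only [solWeight, add_mul]
    refine ⟨h1.1.add h2.1, ?_⟩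
    rw [integral_add h1.1 h2.1]
    refine add_le_add ?_ ?_
    · rw [le_div_iff₀ (by positivity), mul_comm]; exact h1.2
    · rw [le_div_iff₀ (by positivity), mul_comm]; exact h2.2
  · rw [isInducing_radEmb.continuousOn_iff]
    exact hgc.congr fun s hs => (hη s hs).2
  · apply hasDerivWithinAt_of_radEmb
    rw [(hη s hs).2]
    exact (hg s hs).1.congr (fun x hx => (hn x hx).2) (hn s hs).2

/-! ### Testing with bounded weights; conservation of number and energy -/

section

/-- `W` is measurable and bounded by `B` on the positive half-line. -/
structure IsBddWeight (W : ℝ → ℝ) (B : ℝ) : Prop where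
  meas : Measurable W
  bound : ∀ r, 0 < r → |W r| ≤ B

variable {W : ℝ → ℝ} {B : ℝ}

lemma IsBddWeight.integrable (hW : IsBddWeight W B) {f : ℝ → ℝ} (hf : Integrable f radVol) :
    Integrable (fun r => W r * f r) radVol := by
  refine hf.bdd_mul hW.meas.aestronglyMeasurable (c := B) ?_
  filter_upwards [ae_radVol_pos] with r hr using hW.bound r hr

/-- Multiplication by a bounded weight. -/
def mulLin (hW : IsBddWeight W B) : RadL →ₗ[ℝ] RadL where
  toFun n := (hW.integrable n.integrable).toL1 _
  map_add' n m := by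
    rw [← Integrable.toL1_add, Integrable.toL1_eq_toL1_iff]
    filter_upwards [Lp.coeFn_add n m] with x hx
    rw [hx]; simp [mul_add]
  map_smul' c n := by
    rw [RingHom.id_apply, ← Integrable.toL1_smul, Integrable.toL1_eq_toL1_iff]
    filter_upwards [Lp.coeFn_smul c n] with x hx
    rw [hx]; simp [mul_left_comm]

lemma coe_mulLin (hW : IsBddWeight W B) (n : RadL) : mulLin hW n =ᵐ[radVol] fun r => W r * n r :=
  (hW.integrable n.integrable).coeFn_toL1

lemma norm_mulLin_le (hW : IsBddWeight W B) (n : RadL) : ‖mulLin hW n‖ ≤ B * ‖n‖ := by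
  rw [RadL.norm_eq, RadL.norm_eq, ← integral_const_mul]
  refine integral_mono_ae (mulLin hW n).integrable.abs (n.integrable.abs.const_mul _) ?_
  filter_upwards [coe_mulLin hW n, ae_radVol_pos] with r h hr
  rw [h, abs_mul]
  exact mul_le_mul_of_nonneg_right (hW.bound r hr) (abs_nonneg _)

/-- Multiplication by a bounded weight, as a bounded operator. -/
def mulL (hW : IsBddWeight W B) : RadL →L[ℝ] RadL := (mulLin hW).mkContinuous B (norm_mulLin_le hW)

lemma coe_mulL (hW : IsBddWeight W B) (n : RadL) : mulL hW n =ᵐ[radVol] fun r => W r * n r := coe_mulLin hW n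

lemma norm_mulL_le (hW : IsBddWeight W B) (n : RadL) : ‖mulL hW n‖ ≤ B * ‖n‖ := norm_mulLin_le hW n

/-- The integral against a bounded weight, as a bounded functional. -/
def wInt (hW : IsBddWeight W B) : RadL →L[ℝ] ℝ := L1.integralCLM.comp (mulL hW)

lemma wInt_apply (hW : IsBddWeight W B) (n : RadL) : wInt hW n = ∫ r, W r * n r ∂radVol := by
  rw [← integral_congr_ae (coe_mulL hW n), ← L1.integral_eq_integral, L1.integral_eq]; rfl

variable {κ b T : ℝ} {n : ℝ → RadL}

lemma hasDerivWithinAt_integral_weight (hW : IsBddWeight W B) {g : RadL} {S : Set ℝ} {s : ℝ}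
    (h : HasDerivWithinAt n g S s) :
    HasDerivWithinAt (fun s => ∫ r, W r * n s r ∂radVol) (∫ r, W r * g r ∂radVol) S s := by
  simp only [← wInt_apply hW]
  exact (wInt hW).hasFDerivAt.comp_hasDerivWithinAt s h

/-- The rate of change of the integral of a solution against a bounded weight. -/
lemma IsRadSolution.hasDerivWithinAt_integral (h : IsRadSolution κ b T n) (hW : IsBddWeight W B) {s : ℝ}
    (hs : s ∈ Icc 0 T) : HasDerivWithinAt (fun s => ∫ r, W r * n s r ∂radVol)
      (∫ r, W r * collRad κ b (n s) r ∂radVol) (Icc 0 T) s := by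
  obtain ⟨g, -, hg⟩ := h.equation
  have h1 := hasDerivWithinAt_integral_weight hW (hg s hs).1
  rwa [integral_congr_ae (g := fun r => W r * collRad κ b (n s) r)] at h1
  filter_upwards [(hg s hs).2] with r hr
  rw [hr]

lemma IsRadSolution.integrable_rpow (h : IsRadSolution κ b T n) {s : ℝ} (hs : s ∈ Icc 0 T) {m : ℝ}
    (h₁ : -1 ≤ m) (h₂ : m ≤ 2) : Integrable (fun r => r ^ m * n s r) radVol := by
  obtain ⟨C, hC⟩ := h.moments
  exact integrable_rpow_mul_of_solWeight (hC s hs).1 h₁ h₂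

lemma IsRadSolution.integrable_gain (h : IsRadSolution κ b T n) (hb₁ : 1 < b) (hb : b < 2) {s : ℝ} (hs : s ∈ Icc 0 T) :
    Integrable (gain κ b (n s) (n s)) radVol := by
  have h1 := h.integrable_rpow hs (m := -(b / 2)) (by linarith) (by linarith)
  simpa using FLRWBoltzmann.integrable_gain (κ := κ) (integrable_weakGain_one hb (n s).aesm (n s).aesm h1 h1)

lemma IsRadSolution.integral_mul_collRad (h : IsRadSolution κ b T n) (hb₁ : 1 < b) (hb : b < 2)
    (hW : IsBddWeight W B) {s : ℝ} (hs : s ∈ Icc 0 T) :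
    ∫ r, W r * collRad κ b (n s) r ∂radVol = ∫ r, W r * gain κ b (n s) (n s) r ∂radVol -
      lossConst κ b * mom (-(b / 2)) (n s) * ∫ r, W r * (r ^ (-(b / 2)) * n s r) ∂radVol := by
  have h1 := h.integrable_rpow hs (m := -(b / 2)) (by linarith) (by linarith)
  rw [← integral_const_mul, ← integral_sub (hW.integrable (h.integrable_gain hb₁ hb hs))
    ((hW.integrable h1).const_mul _)]
  refine integral_congr_ae (.of_forall fun r => ?_)
  simp only [collRad]; ring

/-- Conservation of the number of particles for solutions. -/
lemma IsRadSolution.mass_eq (h : IsRadSolution κ b T n) (hb₁ : 1 < b) (hb : b < 2) {s : ℝ} (hs : s ∈ Icc 0 T) :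
    ∫ r, n s r ∂radVol = ∫ r, n 0 r ∂radVol := by
  have hW : IsBddWeight (fun _ => 1) 1 := ⟨measurable_const, by simp⟩
  have hd : ∀ s ∈ Icc 0 T, HasDerivWithinAt (fun s => ∫ r, n s r ∂radVol) 0 (Icc 0 T) s := by
    intro s hs
    have h1 := h.hasDerivWithinAt_integral hW hs
    have h2 := h.integrable_rpow hs (m := -(b / 2)) (by linarith) (by linarith)
    rw [h.integral_mul_collRad hb₁ hb hW hs] at h1
    simp only [one_mul] at h1
    rwa [integral_gain_one hb (n s).aesm (n s).aesm h2 h2,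
      show ∫ r, r ^ (-(b / 2)) * n s r ∂radVol = mom (-(b / 2)) (n s) from rfl, sub_self] at h1
  have := norm_image_sub_le_of_norm_deriv_le_segment' hd (C := 0) (by simp) s hs
  rw [zero_mul, norm_le_zero_iff, sub_eq_zero] at this
  exact this

/-- Conservation of energy for solutions. -/
lemma IsRadSolution.mom_one_eq (h : IsRadSolution κ b T n) (hκ : 0 < κ) (hb₁ : 1 < b) (hb : b < 2) {s : ℝ}
    (hs : s ∈ Icc 0 T) : mom 1 (n s) = mom 1 (n 0) := by
  -- The weight `r` is unbounded and so cannot be tested directly. It is replaced by `min r R`, and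
  -- `0 ≤ r - min r R ≤ r²/R` bounds the error by `1/R` times second-order quantities, both for the
  -- moment itself and for its rate of change.
  obtain ⟨C, hC⟩ := h.moments
  have h0T : (0 : ℝ) ∈ Icc 0 T := ⟨le_rfl, hs.1.trans hs.2⟩
  have hkc := kerConst_pos hb
  have hC0 : 0 ≤ C := by
    refine le_trans ?_ (hC 0 h0T).2
    refine integral_nonneg_of_ae ?_
    filter_upwards [ae_radVol_pos, RadL.nonneg_iff.1 (h.nonneg 0 h0T)] with r h1 h2
    exact mul_nonneg (solWeight_nonneg r h1) h2
  set a := lossConst κ b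
  have ha : 0 < a := lossConst_pos hκ hb
  set C₁ : ℝ := 4 * Real.pi ^ 2 * κ * (4 * kerConst b * C * C) + a * C * C
  -- the collision operator against the weights `r` and `r²`
  have key : ∀ R : ℝ, 0 < R → ∀ s ∈ Icc 0 T,
      |∫ r, min r R * collRad κ b (n s) r ∂radVol| ≤ C₁ / R := by
    intro R hR s hs
    have hn0 := RadL.nonneg_iff.1 (h.nonneg s hs)
    have hI := (hC s hs).1
    have hW : IsBddWeight (fun r => min r R) R := ⟨by fun_prop, fun r hr => by
      rw [abs_of_nonneg (le_min hr.le hR.le)]; exact min_le_right _ _⟩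
    have hM1 := integrable_rpow_mul_of_solWeight hI (s := 1 - b / 2) (by linarith) (by linarith)
    have hM2 := integrable_rpow_mul_of_solWeight hI (s := 2 - b / 2) (by linarith) (by linarith)
    obtain ⟨he1, he2⟩ := integral_gain_id (κ := κ) hb₁ hb (n s).aesm hI
    have habs : ∫ r, solWeight r * |n s r| ∂radVol ≤ C := by
      refine le_trans (le_of_eq (integral_congr_ae ?_)) (hC s hs).2
      filter_upwards [hn0] with r hr
      rw [abs_of_nonneg hr]
    have habs0 : 0 ≤ ∫ r, solWeight r * |n s r| ∂radVol := by
      refine integral_nonneg_of_ae ?_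
      filter_upwards [ae_radVol_pos] with r h1
      exact mul_nonneg (solWeight_nonneg r h1) (abs_nonneg _)
    obtain ⟨hg1, hg2⟩ := integrable_weakGain (W := fun x => x ^ 2) (A := solWeight) (B := solWeight)
      (C := 4 * kerConst b) hb (by fun_prop) solWeight_nonneg solWeight_nonneg (by positivity) (n s).aesm (n s).aesm
      hI hI (fun p q hp hq => kernel_sq_le hb₁ hb hp hq fun s h1 h2 r hr => rpow_le_solWeight hr h1 h2)
    have hg3 := integral_abs_gain_le hg1 hκ.le
    have hgb : ∫ r, |r ^ 2 * gain κ b (n s) (n s) r| ∂radVol ≤ 4 * Real.pi ^ 2 * κ * (4 * kerConst b * C * C) := by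
      refine hg3.trans (mul_le_mul_of_nonneg_left (hg2.trans ?_) (by positivity))
      gcongr
    have hMc : ∀ m : ℝ, -1 ≤ m → m ≤ 2 → mom m (n s) ≤ C := fun m h1 h2 =>
      (mom_le_of_solWeight (h.nonneg s hs) hI h1 h2).trans (hC s hs).2
    have hM0 : ∀ m : ℝ, 0 ≤ mom m (n s) := by
      intro m
      refine integral_nonneg_of_ae ?_
      filter_upwards [ae_radVol_pos, hn0] with r h1 h2
      exact mul_nonneg (Real.rpow_nonneg h1.le _) h2
    -- the total energy production vanishes
    have hr1 : (fun r : ℝ => r * (r ^ (-(b / 2)) * n s r)) =ᵐ[radVol] fun r => r ^ (1 - b / 2) * n s r := by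
      filter_upwards [ae_radVol_pos] with r hr
      rw [sub_eq_add_neg, Real.rpow_add hr, Real.rpow_one, mul_assoc]
    have hr2 : (fun r : ℝ => r ^ 2 * (r ^ (-(b / 2)) * n s r)) =ᵐ[radVol] fun r => r ^ (2 - b / 2) * n s r := by
      filter_upwards [ae_radVol_pos] with r hr
      rw [sub_eq_add_neg, Real.rpow_add hr, Real.rpow_two, mul_assoc]
    have hi1 : Integrable (fun r => r * collRad κ b (n s) r) radVol := by
      refine (he1.sub ((hM1.congr hr1.symm).const_mul (a * mom (-(b / 2)) (n s)))).congr (.of_forall fun r => ?_)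
      simp only [Pi.sub_apply, collRad]; ring
    have hz : ∫ r, r * collRad κ b (n s) r ∂radVol = 0 := by
      have e : ∀ r, r * collRad κ b (n s) r = r * gain κ b (n s) (n s) r -
          a * mom (-(b / 2)) (n s) * (r * (r ^ (-(b / 2)) * n s r)) := by intro r; simp only [collRad]; ring
      simp only [e]
      rw [integral_sub he1 ((hM1.congr hr1.symm).const_mul _), he2, integral_const_mul, integral_congr_ae hr1]
      exact sub_self _
    obtain ⟨g, -, hg⟩ := h.equation
    have hiQ : Integrable (collRad κ b (n s)) radVol := (g s).integrable.congr (hg s hs).2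
    have hi2 := hW.integrable hiQ
    have hgsq := FLRWBoltzmann.integrable_gain (κ := κ) hg1
    have hmaj : Integrable (fun r => R⁻¹ * (|r ^ 2 * gain κ b (n s) (n s) r| +
        a * mom (-(b / 2)) (n s) * (r ^ (2 - b / 2) * n s r))) radVol :=
      (hgsq.abs.add (hM2.const_mul _)).const_mul _
    rw [← sub_zero (∫ r, min r R * collRad κ b (n s) r ∂radVol), ← hz, ← integral_sub hi2 hi1]
    refine (abs_integral_le_integral_abs).trans ((integral_mono_ae (hi2.sub hi1).abs hmaj ?_).trans ?_)
    · filter_upwards [ae_radVol_pos, hn0, hr2] with r hr h0 hr2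
      have h1 : |min r R - r| ≤ R⁻¹ * r ^ 2 := by
        rcases le_total r R with h | h
        · rw [min_eq_left h, sub_self, abs_zero]; positivity
        · rw [min_eq_right h, abs_sub_comm, abs_of_nonneg (by linarith), inv_mul_eq_div, le_div_iff₀ hR]
          nlinarith
      rw [← hr2, Pi.sub_apply, ← sub_mul, abs_mul]
      refine (mul_le_mul_of_nonneg_right h1 (abs_nonneg _)).trans ?_
      rw [mul_assoc]
      refine mul_le_mul_of_nonneg_left ?_ (by positivity)
      have h2 : 0 ≤ r ^ (-(b / 2)) * n s r := mul_nonneg (Real.rpow_nonneg hr.le _) h0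
      have h3 : |collRad κ b (n s) r| ≤ |gain κ b (n s) (n s) r| + a * mom (-(b / 2)) (n s) * (r ^ (-(b / 2)) * n s r) := by
        rw [collRad]
        refine (abs_sub _ _).trans_eq ?_
        rw [abs_of_nonneg (mul_nonneg (mul_nonneg ha.le (hM0 _)) h2)]
      rw [abs_mul, abs_of_nonneg (sq_nonneg r)]
      calc _ ≤ r ^ 2 * (|gain κ b (n s) (n s) r| + a * mom (-(b / 2)) (n s) * (r ^ (-(b / 2)) * n s r)) := by gcongr
        _ = _ := by ring
    · rw [integral_const_mul, inv_mul_eq_div, integral_add hgsq.abs (hM2.const_mul _), integral_const_mul]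
      exact div_le_div_of_nonneg_right (add_le_add hgb (mul_le_mul (mul_le_mul_of_nonneg_left
        (hMc _ (by linarith) (by linarith)) ha.le) (hMc (2 - b / 2) (by linarith) (by linarith))
        (hM0 (2 - b / 2)) (by positivity))) hR.le
  have happ : ∀ R : ℝ, 0 < R → ∀ s ∈ Icc 0 T, |mom 1 (n s) - ∫ r, min r R * n s r ∂radVol| ≤ C / R := by
    intro R hR s hs
    have hn0 := RadL.nonneg_iff.1 (h.nonneg s hs)
    have h1 := h.integrable_rpow hs (m := 1) (by norm_num) (by norm_num)
    have h2 := h.integrable_rpow hs (m := 2) (by norm_num) le_rfl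
    have hW : IsBddWeight (fun r => min r R) R := ⟨by fun_prop, fun r hr => by
      rw [abs_of_nonneg (le_min hr.le hR.le)]; exact min_le_right _ _⟩
    have h3 := hW.integrable (n s).integrable
    rw [mom, ← integral_sub h1 h3]
    refine (abs_integral_le_integral_abs).trans ((integral_mono_ae (h1.sub h3).abs (h2.const_mul R⁻¹) ?_).trans ?_)
    · filter_upwards [ae_radVol_pos, hn0] with r hr h0
      rw [Pi.sub_apply, Real.rpow_one, Real.rpow_two, ← sub_mul, abs_mul, abs_of_nonneg h0, ← mul_assoc]
      refine mul_le_mul_of_nonneg_right ?_ h0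
      rcases le_total r R with h | h
      · rw [min_eq_left h, sub_self, abs_zero]; positivity
      · rw [min_eq_right h, abs_of_nonneg (by linarith), inv_mul_eq_div, le_div_iff₀ hR]
        nlinarith
    · rw [integral_const_mul, inv_mul_eq_div]
      gcongr
      exact (mom_le_of_solWeight (h.nonneg s hs) (hC s hs).1 (by norm_num) le_rfl).trans (hC s hs).2
  have hle : ∀ R : ℝ, 0 < R → |mom 1 (n s) - mom 1 (n 0)| ≤ (C + C + C₁ * s) / R := by
    intro R hR
    have hW : IsBddWeight (fun r => min r R) R := ⟨by fun_prop, fun r hr => by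
      rw [abs_of_nonneg (le_min hr.le hR.le)]; exact min_le_right _ _⟩
    have h1 := norm_image_sub_le_of_norm_deriv_le_segment' (fun s hs => h.hasDerivWithinAt_integral hW hs)
      (fun s hs => key R hR s ⟨hs.1, hs.2.le⟩) s hs
    have h2 := happ R hR s hs
    have h3 := happ R hR 0 h0T
    rw [Real.norm_eq_abs] at h1
    rw [sub_zero] at h1
    rw [add_div, add_div, mul_div_right_comm]
    rw [abs_le] at *
    constructor <;> linarith [h1.1, h1.2, h2.1, h2.2, h3.1, h3.2]
  have hC1 : 0 ≤ C₁ := by positivity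
  rw [← sub_eq_zero, ← abs_nonpos_iff]
  -- The change of energy does not depend on `R`, while its bound is of order `1/R`.
  refine ge_of_tendsto (x := atTop) ((tendsto_const_nhds (x := C + C + C₁ * s)).div_atTop tendsto_id) ?_
  filter_upwards [eventually_gt_atTop 0] with R hR using hle R hR

end

/-! ### Lower bound of the loss rate and propagation of the moment of order `-2` -/

section

variable {κ b T : ℝ} {n : ℝ → RadL}

lemma mom_nonneg {m : RadL} (hm : 0 ≤ m) (s : ℝ) : 0 ≤ mom s m := by
  refine integral_nonneg_of_ae ?_
  filter_upwards [ae_radVol_pos, RadL.nonneg_iff.1 hm] with r h1 h2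
  exact mul_nonneg (Real.rpow_nonneg h1.le _) h2

lemma RadL.integral_pos {m : RadL} (hm : 0 ≤ m) (h0 : m ≠ 0) : 0 < ∫ r, m r ∂radVol := by
  have h : ∫ r, m r ∂radVol = ‖m‖ := by
    rw [RadL.norm_eq]
    refine integral_congr_ae ?_
    filter_upwards [RadL.nonneg_iff.1 hm] with r hr using (abs_of_nonneg hr).symm
  rw [h]; exact norm_pos_iff.2 h0

/-- The moment of order `-b/2` is bounded below by mass and energy. -/
lemma mass_le_mom {m : RadL} (hm : 0 ≤ m) (hb : 0 < b)
    (h1 : Integrable (fun r => r ^ (-(b / 2)) * m r) radVol) (h2 : Integrable (fun r => r ^ (1 : ℝ) * m r) radVol)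
    {K : ℝ} (hK : 0 < K) :
    ∫ r, m r ∂radVol ≤ K ^ (b / 2) * mom (-(b / 2)) m + mom 1 m / K := by
  rw [mom, mom, ← integral_const_mul, ← integral_div, ← integral_add (h1.const_mul _) (h2.div_const _)]
  refine integral_mono_ae m.integrable ((h1.const_mul _).add (h2.div_const _)) ?_
  filter_upwards [ae_radVol_pos, RadL.nonneg_iff.1 hm] with r hr h0
  -- Energies below `K` are paid for by the first term, energies above `K` by the second.
  have h : 1 ≤ K ^ (b / 2) * r ^ (-(b / 2)) + r / K := by
    rw [Real.rpow_neg hr.le, ← div_eq_mul_inv, ← Real.div_rpow hK.le hr.le]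
    rcases le_total r K with h | h
    · have := Real.one_le_rpow ((one_le_div hr).2 h) (z := b / 2) (by linarith)
      have : 0 ≤ r / K := by positivity
      linarith
    · have := (one_le_div hK).2 h
      have : 0 ≤ (K / r) ^ (b / 2) := by positivity
      linarith
  calc m r = 1 * m r := (one_mul _).symm
    _ ≤ (K ^ (b / 2) * r ^ (-(b / 2)) + r / K) * m r := mul_le_mul_of_nonneg_right h h0
    _ = _ := by rw [Real.rpow_one]; ring

/-- The moment of order `-b/2` of a solution stays away from zero. -/
lemma IsRadSolution.exists_le_mom (h : IsRadSolution κ b T n) (hκ : 0 < κ) (hb₁ : 1 < b) (hb : b < 2)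
    (h0 : n 0 ≠ 0) : ∃ m₀ : ℝ, 0 < m₀ ∧ ∀ s ∈ Icc 0 T, m₀ ≤ mom (-(b / 2)) (n s) := by
  by_cases hT : 0 ≤ T
  swap
  · exact ⟨1, one_pos, fun s hs => absurd (hs.1.trans hs.2) hT⟩
  have h0T : (0 : ℝ) ∈ Icc 0 T := ⟨le_rfl, hT⟩
  set N := ∫ r, n 0 r ∂radVol
  have hN : 0 < N := RadL.integral_pos (h.nonneg 0 h0T) h0
  set E := mom 1 (n 0)
  have hE : 0 ≤ E := mom_nonneg (h.nonneg 0 h0T) 1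
  -- Large enough that energies above `K` hold at most half of the particles; the summand `1` keeps
  -- `K` positive.
  set K := 2 * E / N + 1
  have hK : 0 < K := by positivity
  refine ⟨N / (2 * K ^ (b / 2)), by positivity, fun s hs => ?_⟩
  have h1 := mass_le_mom (h.nonneg s hs) (by linarith)
    (h.integrable_rpow hs (m := -(b / 2)) (by linarith) (by linarith))
    (h.integrable_rpow hs (m := 1) (by norm_num) (by norm_num)) hK
  rw [h.mass_eq hb₁ hb hs, h.mom_one_eq hκ hb₁ hb hs] at h1
  have h2 : E / K ≤ N / 2 := by
    rw [div_le_div_iff₀ hK (by norm_num)]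
    have : N * K = 2 * E + N := by simp only [K]; field_simp
    linarith
  rw [div_le_iff₀ (by positivity)]
  have h3 : ∫ r, n 0 r ∂radVol = N := rfl
  have h4 : mom 1 (n 0) = E := rfl
  rw [h3, h4] at h1
  linarith

/-- The pointwise interpolation inequality behind the propagation of the moment of order `-2`. -/
lemma rpow_div_le {r ε δ t : ℝ} (hb : b < 2) (hr : 0 < r) (hε : 0 < ε) (hδ : 0 < δ) (ht : 0 < t) :
    r ^ (-(b / 2)) / (r + ε) ≤ t / 2 * (r ^ (-(b / 2)) * ((r + ε) ^ 2)⁻¹) +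
      δ ^ (1 - b / 2) / (2 * t) * r ^ (-1 : ℝ) + δ⁻¹ * r ^ (-(b / 2)) := by
  set x := (r + ε)⁻¹ with hx
  have hx0 : 0 < x := by positivity
  rw [div_eq_mul_inv, ← hx, ← inv_pow, ← hx]
  set y := r ^ (-(b / 2))
  have hy : 0 < y := by positivity
  -- Below `δ` Young's inequality with parameter `t` is applied to `(r+ε)⁻¹`, and `r^(-b/2)` is
  -- traded for the small factor `δ^(1-b/2)` times `r⁻¹`. Above `δ` nothing is singular.
  rcases le_total r δ with h | h
  · have h1 : y ≤ δ ^ (1 - b / 2) * r ^ (-1 : ℝ) := by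
      have : y = r ^ (1 - b / 2) * r ^ (-1 : ℝ) := by
        rw [← Real.rpow_add hr, show 1 - b / 2 + -1 = -(b / 2) by ring]
      rw [this]
      gcongr
      linarith
    have h2 : x ≤ t / 2 * x ^ 2 + 1 / (2 * t) := by
      have : t / 2 * x ^ 2 + 1 / (2 * t) - x = (t * x - 1) ^ 2 / (2 * t) := by field_simp; ring
      have : 0 ≤ (t * x - 1) ^ 2 / (2 * t) := by positivity
      linarith
    calc y * x ≤ y * (t / 2 * x ^ 2 + 1 / (2 * t)) := by gcongr
      _ = t / 2 * (y * x ^ 2) + y / (2 * t) := by ring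
      _ ≤ t / 2 * (y * x ^ 2) + (δ ^ (1 - b / 2) * r ^ (-1 : ℝ)) / (2 * t) := by gcongr
      _ = t / 2 * (y * x ^ 2) + δ ^ (1 - b / 2) / (2 * t) * r ^ (-1 : ℝ) := by ring
      _ ≤ _ := le_add_of_nonneg_right (by positivity)
  · have h1 : x ≤ δ⁻¹ := by rw [hx]; gcongr; linarith
    calc y * x ≤ δ⁻¹ * y := by rw [mul_comm]; gcongr
      _ ≤ _ := le_add_of_nonneg_left (by positivity)

/-- The choice `t = A/P` optimises the parameter. A family of pointwise Young inequalities thereby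
acts as the Cauchy–Schwarz inequality. -/
lemma sq_le_of_forall_young {A P Q : ℝ} (hA : 0 < A) (hP : 0 < P)
    (h : ∀ t, 0 < t → A ≤ t / 2 * P + 1 / (2 * t) * Q) : A ^ 2 ≤ P * Q := by
  have h1 := h (A / P) (by positivity)
  have h2 : A / P / 2 * P + 1 / (2 * (A / P)) * Q = A / 2 + P * Q / (2 * A) := by field_simp
  rw [h2] at h1
  have h3 : A / 2 ≤ P * Q / (2 * A) := by linarith
  rw [div_le_div_iff₀ (by norm_num) (by positivity)] at h3
  nlinarith

/-- The moment of order `-2` of a solution stays bounded. -/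
lemma IsRadSolution.exists_mom_neg_two_le (h : IsRadSolution κ b T n) (hκ : 0 < κ) (hb₁ : 1 < b) (hb : b < 2)
    (h0 : n 0 ≠ 0) (hi : Integrable (fun r => r ^ (-2 : ℝ) * n 0 r) radVol) :
    ∃ C : ℝ, ∀ s ∈ Icc 0 T, Integrable (fun r => r ^ (-2 : ℝ) * n s r) radVol ∧ mom (-2) (n s) ≤ C := by
  by_cases hT : 0 ≤ T
  swap
  · exact ⟨1, fun s hs => absurd (hs.1.trans hs.2) hT⟩
  have h0T : (0 : ℝ) ∈ Icc 0 T := ⟨le_rfl, hT⟩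
  obtain ⟨C, hC⟩ := h.moments
  obtain ⟨m₀, hm₀, hm⟩ := h.exists_le_mom hκ hb₁ hb h0
  have hkc := negTwoConst_pos hb
  have hMc : ∀ s ∈ Icc 0 T, ∀ m : ℝ, -1 ≤ m → m ≤ 2 → mom m (n s) ≤ C := fun s hs m h1 h2 =>
    (mom_le_of_solWeight (h.nonneg s hs) (hC s hs).1 h1 h2).trans (hC s hs).2
  have hC0 : 0 ≤ C := (mom_nonneg (h.nonneg 0 h0T) 0).trans (hMc 0 h0T 0 (by norm_num) (by norm_num))
  set a := lossConst κ b
  have ha : 0 < a := lossConst_pos hκ hb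
  set C₁ := 4 * Real.pi ^ 2 * κ * negTwoConst b
  have hC₁ : 0 < C₁ := by positivity
  -- choice of the splitting radius
  obtain ⟨δ, hδ, hδ'⟩ : ∃ δ : ℝ, 0 < δ ∧ C₁ * (2 * (δ ^ (1 - b / 2) * C)) ≤ a * m₀ := by
    set η := a * m₀ / (2 * C₁ * C + 1)
    have hη : 0 < η := by positivity
    refine ⟨η ^ (1 - b / 2)⁻¹, by positivity, ?_⟩
    rw [← Real.rpow_mul hη.le, inv_mul_cancel₀ (by linarith), Real.rpow_one]
    have : η * (2 * C₁ * C + 1) = a * m₀ := by simp only [η]; field_simp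
    nlinarith
  -- What survives when the loss `a m₀ D` is subtracted from the bound `a m₀ (D+1) + 2 C₁ (C/δ)²` of
  -- the gain. It does not depend on `ε`.
  set C₂ := a * m₀ + 2 * C₁ * (C / δ) ^ 2
  have hC₂ : 0 ≤ C₂ := by positivity
  -- For the bounded weight `(r+ε)⁻²` the gain contributes at most `C₁ A²` and the loss removes at
  -- least `a m₀ D`. Cauchy–Schwarz bounds `A²` by a multiple of `δ^(1-b/2) C (D+1)` plus a
  -- constant, and `δ` was chosen so that the loss absorbs the first part.
  have key : ∀ ε : ℝ, 0 < ε → ∀ s ∈ Icc 0 T,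
      ∫ r, ((r + ε) ^ 2)⁻¹ * n s r ∂radVol ≤ mom (-2) (n 0) + C₂ * T := by
    intro ε hε
    set W : ℝ → ℝ := fun r => ((r + ε) ^ 2)⁻¹ with hWdef
    have hW : IsBddWeight W (ε ^ 2)⁻¹ := ⟨by fun_prop, fun r hr => by
      rw [abs_of_nonneg (by positivity)]
      have : ε ≤ r + ε := by linarith
      simp only [W]; gcongr⟩
    have hd : ∀ s ∈ Icc 0 T, ∫ r, W r * collRad κ b (n s) r ∂radVol ≤ C₂ := by
      intro s hs
      have hn0 := RadL.nonneg_iff.1 (h.nonneg s hs)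
      have hMb := h.integrable_rpow hs (m := -(b / 2)) (by linarith) (by linarith)
      have hM1 := h.integrable_rpow hs (m := -1) le_rfl (by norm_num)
      have hD := hW.integrable hMb
      have hD' : Integrable (fun r => r ^ (-(b / 2)) * ((r + ε) ^ 2)⁻¹ * n s r) radVol :=
        hD.congr (.of_forall fun r => by simp only [W]; ring)
      have hA : Integrable (fun r => r ^ (-(b / 2)) / (r + ε) * n s r) radVol := by
        refine integrable_mul_of_le (by fun_prop) (n s).aesm hMb (C := ε⁻¹) (fun r hr => by positivity) fun r hr => ?_
        rw [div_eq_inv_mul]; gcongr; linarith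
      set A := ∫ r, r ^ (-(b / 2)) / (r + ε) * n s r ∂radVol
      set D := ∫ r, W r * (r ^ (-(b / 2)) * n s r) ∂radVol
      have hDD : D = ∫ r, r ^ (-(b / 2)) * ((r + ε) ^ 2)⁻¹ * n s r ∂radVol :=
        integral_congr_ae (.of_forall fun r => by simp only [W]; ring)
      have hD0 : 0 ≤ D := by
        refine integral_nonneg_of_ae ?_
        filter_upwards [ae_radVol_pos, hn0] with r h1 h2
        simp only [W, Pi.zero_apply]; positivity
      have hA0 : 0 ≤ A := by
        refine integral_nonneg_of_ae ?_
        filter_upwards [ae_radVol_pos, hn0] with r h1 h2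
        simp only [Pi.zero_apply]; positivity
      -- Subtracting `C/δ` removes the contribution of energies above `δ`; `D + 1` in place of `D`
      -- provides the strict positivity needed in `sq_le_of_forall_young`.
      have hyoung : ∀ t, 0 < t → A - C / δ ≤ t / 2 * (D + 1) + 1 / (2 * t) * (δ ^ (1 - b / 2) * C) := by
        intro t ht
        have h1 : A ≤ t / 2 * D + δ ^ (1 - b / 2) / (2 * t) * mom (-1) (n s) + δ⁻¹ * mom (-(b / 2)) (n s) := by
          have hi2 : Integrable (fun r => t / 2 * (r ^ (-(b / 2)) * ((r + ε) ^ 2)⁻¹ * n s r) +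
              δ ^ (1 - b / 2) / (2 * t) * (r ^ (-1 : ℝ) * n s r)) radVol :=
            (hD'.const_mul _).add (hM1.const_mul _)
          rw [hDD, mom, mom, ← integral_const_mul, ← integral_const_mul, ← integral_const_mul,
            ← integral_add (hD'.const_mul _) (hM1.const_mul _), ← integral_add hi2 (hMb.const_mul _)]
          refine integral_mono_ae hA (hi2.add (hMb.const_mul _)) ?_
          filter_upwards [ae_radVol_pos, hn0] with r hr h0
          refine (mul_le_mul_of_nonneg_right (rpow_div_le hb hr hε hδ ht) h0).trans_eq ?_
          ring
        have h2 := hMc s hs (-1) le_rfl (by norm_num)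
        have h3 := hMc s hs (-(b / 2)) (by linarith) (by linarith)
        have h4 : δ ^ (1 - b / 2) / (2 * t) * mom (-1) (n s) ≤ δ ^ (1 - b / 2) / (2 * t) * C := by gcongr
        have h5 : δ⁻¹ * mom (-(b / 2)) (n s) ≤ δ⁻¹ * C := by gcongr
        have h6 : t / 2 * D ≤ t / 2 * (D + 1) := by gcongr; linarith
        have h7 : C / δ = δ⁻¹ * C := by ring
        have h8 : 1 / (2 * t) * (δ ^ (1 - b / 2) * C) = δ ^ (1 - b / 2) / (2 * t) * C := by ring
        rw [h7, h8]; linarith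
      have hA2 : A ^ 2 ≤ 2 * ((D + 1) * (δ ^ (1 - b / 2) * C)) + 2 * (C / δ) ^ 2 := by
        have hCδ : 0 ≤ C / δ := by positivity
        have hp : 0 ≤ (D + 1) * (δ ^ (1 - b / 2) * C) := by positivity
        rcases le_or_gt (A - C / δ) 0 with h | h
        · have : A ^ 2 ≤ (C / δ) ^ 2 := by gcongr; linarith
          nlinarith
        · have := sq_le_of_forall_young h (by linarith) hyoung
          nlinarith [sq_nonneg (A - C / δ - C / δ)]
      obtain ⟨hg1, hg2⟩ := integrable_weakGain (W := W) (A := fun r => r ^ (-(b / 2)) / (r + ε))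
        (B := fun r => r ^ (-(b / 2)) / (r + ε)) (C := negTwoConst b) hb hW.meas
        (fun r hr => by positivity) (fun r hr => by positivity) hkc.le (n s).aesm (n s).aesm hA hA
        (fun p q hp hq => kernel_neg_two_le hb hp hq hε.le)
      have hg3 := integral_abs_gain_le hg1 hκ.le
      have hAabs : ∫ r, r ^ (-(b / 2)) / (r + ε) * |n s r| ∂radVol = A := by
        refine integral_congr_ae ?_
        filter_upwards [hn0] with r hr
        rw [abs_of_nonneg hr]
      rw [hAabs] at hg2
      have hgain : ∫ r, W r * gain κ b (n s) (n s) r ∂radVol ≤ C₁ * A ^ 2 := by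
        refine (le_abs_self _).trans (abs_integral_le_integral_abs.trans (hg3.trans ?_))
        refine (mul_le_mul_of_nonneg_left hg2 (by positivity)).trans_eq ?_
        simp only [C₁]; ring
      rw [h.integral_mul_collRad hb₁ hb hW hs]
      have h1 : a * m₀ * D ≤ a * mom (-(b / 2)) (n s) * D := by have := hm s hs; gcongr
      have h2 : C₁ * A ^ 2 ≤ C₁ * (2 * ((D + 1) * (δ ^ (1 - b / 2) * C)) + 2 * (C / δ) ^ 2) := by gcongr
      have h3 : C₁ * (2 * (δ ^ (1 - b / 2) * C)) * (D + 1) ≤ a * m₀ * (D + 1) := by gcongr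
      change _ - a * mom (-(b / 2)) (n s) * D ≤ a * m₀ + 2 * C₁ * (C / δ) ^ 2
      nlinarith
    intro s hs
    have h1 := image_le_of_deriv_right_le_deriv_boundary (f := fun s => ∫ r, W r * n s r ∂radVol)
      (f' := fun s => ∫ r, W r * collRad κ b (n s) r ∂radVol) (a := 0) (b := T)
      (B := fun s => ∫ r, W r * n 0 r ∂radVol + C₂ * s) (B' := fun _ => C₂)
      (fun s hs => (h.hasDerivWithinAt_integral hW hs).continuousWithinAt)
      (fun s hs => ((h.hasDerivWithinAt_integral hW ⟨hs.1, hs.2.le⟩).mono_of_mem_nhdsWithin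
        (Icc_mem_nhdsGE_of_mem hs)))
      (by simp) (by fun_prop)
      (fun s _ => (((hasDerivAt_id' s).const_mul C₂).const_add _).hasDerivWithinAt.congr_deriv (mul_one _))
      (fun s hs => hd s ⟨hs.1, hs.2.le⟩) hs
    refine h1.trans (add_le_add ?_ (mul_le_mul_of_nonneg_left hs.2 hC₂))
    refine integral_mono_ae (hW.integrable (n 0).integrable) hi ?_
    filter_upwards [ae_radVol_pos, RadL.nonneg_iff.1 (h.nonneg 0 h0T)] with r hr h0
    refine mul_le_mul_of_nonneg_right ?_ h0
    rw [Real.rpow_neg hr.le, Real.rpow_two]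
    simp only [W]
    gcongr
    linarith
  refine ⟨mom (-2) (n 0) + C₂ * T, fun s hs => ?_⟩
  have hn0 := RadL.nonneg_iff.1 (h.nonneg s hs)
  have hB0 : 0 ≤ mom (-2) (n 0) + C₂ * T := add_nonneg (mom_nonneg (h.nonneg 0 h0T) _) (by positivity)
  have hlim : Tendsto (fun k : ℕ => 1 / ((k : ℝ) + 1)) atTop (𝓝 0) := tendsto_one_div_add_atTop_nhds_zero_nat
  -- Fatou's lemma along `ε = 1/(k+1)` removes the regularisation.
  have hlin : ∫⁻ r, ENNReal.ofReal (r ^ (-2 : ℝ) * n s r) ∂radVol ≤ ENNReal.ofReal (mom (-2) (n 0) + C₂ * T) := by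
    calc ∫⁻ r, ENNReal.ofReal (r ^ (-2 : ℝ) * n s r) ∂radVol
        = ∫⁻ r, liminf (fun k : ℕ => ENNReal.ofReal (((r + 1 / ((k : ℝ) + 1)) ^ 2)⁻¹ * n s r)) atTop ∂radVol := by
          refine lintegral_congr_ae ?_
          filter_upwards [ae_radVol_pos] with r hr
          symm
          refine Tendsto.liminf_eq ((ENNReal.continuous_ofReal.tendsto _).comp (Tendsto.mul_const _ ?_))
          rw [Real.rpow_neg hr.le, Real.rpow_two]
          refine Tendsto.inv₀ ?_ (by positivity)
          simpa using (hlim.const_add r).pow 2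
      _ ≤ liminf (fun k : ℕ => ∫⁻ r, ENNReal.ofReal (((r + 1 / ((k : ℝ) + 1)) ^ 2)⁻¹ * n s r) ∂radVol) atTop := by
          refine lintegral_liminf_le' fun k => ?_
          exact (((by fun_prop : Measurable fun r : ℝ => ((r + 1 / ((k : ℝ) + 1)) ^ 2)⁻¹).aemeasurable).mul
            (n s).aesm.aemeasurable).ennreal_ofReal
      _ ≤ _ := by
          refine liminf_le_of_le (by isBoundedDefault) fun c hc => ?_
          obtain ⟨k, hk⟩ := hc.exists
          refine hk.trans ?_
          have hε : (0 : ℝ) < 1 / ((k : ℝ) + 1) := by positivity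
          have hW : IsBddWeight (fun r : ℝ => ((r + 1 / ((k : ℝ) + 1)) ^ 2)⁻¹) ((1 / ((k : ℝ) + 1)) ^ 2)⁻¹ :=
            ⟨by fun_prop, fun r hr => by
              rw [abs_of_nonneg (by positivity)]
              gcongr; linarith⟩
          rw [← ofReal_integral_eq_lintegral_ofReal (hW.integrable (n s).integrable)]
          · exact ENNReal.ofReal_le_ofReal (key _ hε s hs)
          · filter_upwards [ae_radVol_pos, hn0] with r hr h0
            simp only [Pi.zero_apply]; positivity
  have hpos : 0 ≤ᵐ[radVol] fun r => r ^ (-2 : ℝ) * n s r := by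
    filter_upwards [ae_radVol_pos, hn0] with r hr h0
    exact mul_nonneg (Real.rpow_nonneg hr.le _) h0
  have hmeas : AEStronglyMeasurable (fun r : ℝ => r ^ (-2 : ℝ) * n s r) radVol :=
    (by fun_prop : Measurable fun r : ℝ => r ^ (-2 : ℝ)).aestronglyMeasurable.mul (n s).aesm
  have hint : Integrable (fun r => r ^ (-2 : ℝ) * n s r) radVol := by
    refine ⟨hmeas, ?_⟩
    rw [hasFiniteIntegral_iff_ofReal hpos]
    exact hlin.trans_lt ENNReal.ofReal_lt_top
  refine ⟨hint, ?_⟩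
  rw [← ofReal_integral_eq_lintegral_ofReal hint hpos] at hlin
  exact (ENNReal.ofReal_le_ofReal_iff hB0).1 hlin

end

/-! ### The stability estimate -/

section

/-- Comparison of a function with a primitive of an upper bound for its left slopes. -/
lemma sub_le_sub_of_left_slope {z B B' : ℝ → ℝ} {T : ℝ} (hT : 0 ≤ T) (hz : ContinuousOn z (Icc 0 T))
    (hB : ∀ x, HasDerivAt B (B' x) x)
    (bound : ∀ x ∈ Ioc 0 T, ∀ r, B' x < r → ∀ᶠ x' in 𝓝[<] x, slope z x x' < r) : z T - z 0 ≤ B T - B 0 := by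
  have hBd : ∀ τ, HasDerivAt (fun τ => B T - B (T - τ)) (B' (T - τ)) τ := fun τ => by
    have := (hB (T - τ)).comp τ ((hasDerivAt_id' τ).const_sub T)
    simpa [Function.comp_def] using this.const_sub (B T)
  -- Time is reversed, so that left slopes become the right slopes of the comparison principle.
  have h := image_le_of_liminf_slope_right_le_deriv_boundary (f := fun τ => z T - z (T - τ)) (a := 0) (b := T)
    (B := fun τ => B T - B (T - τ)) (B' := fun τ => B' (T - τ)) ?_ (by simp)
    (fun τ _ => (hBd τ).continuousAt.continuousWithinAt) (fun τ _ => (hBd τ).hasDerivWithinAt) ?_ (x := T) ⟨hT, le_rfl⟩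
  · simpa using h
  · refine continuousOn_const.sub (hz.comp (by fun_prop) fun τ hτ => ⟨by linarith [hτ.2], by linarith [hτ.1]⟩)
  · intro τ hτ r hr
    have h1 : Tendsto (fun τ' => T - τ') (𝓝[>] τ) (𝓝[<] (T - τ)) := by
      refine tendsto_nhdsWithin_iff.2 ⟨((continuous_const.sub continuous_id).tendsto τ).mono_left nhdsWithin_le_nhds, ?_⟩
      filter_upwards [self_mem_nhdsWithin] with τ' hτ'
      rw [mem_Ioi] at hτ'
      rw [mem_Iio]; linarith
    refine Eventually.frequently ?_
    filter_upwards [h1.eventually (bound (T - τ) ⟨by linarith [hτ.2], by linarith [hτ.1]⟩ r hr)] with τ' h2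
    refine lt_of_eq_of_lt ?_ h2
    simp only [slope_def_field]
    rw [← neg_div_neg_eq]
    congr 1 <;> ring

variable {κ b T : ℝ}

lemma gain_sub {n m : ℝ → ℝ} (hb : b < 2) (hn : AEStronglyMeasurable n radVol) (hm : AEStronglyMeasurable m radVol)
    (hni : Integrable (fun r => r ^ (-(b / 2)) * n r) radVol) (hmi : Integrable (fun r => r ^ (-(b / 2)) * m r) radVol) :
    ∀ᵐ p ∂radVol, gain κ b n n p - gain κ b m m p =
      gain κ b n (fun r => n r - m r) p + gain κ b (fun r => n r - m r) m p := by
  filter_upwards [ae_integrable_gainKer (integrable_weakGain_one hb hn hn hni hni),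
    ae_integrable_gainKer (integrable_weakGain_one hb hn hm hni hmi),
    ae_integrable_gainKer (integrable_weakGain_one hb hm hm hmi hmi)] with p h1 h2 h3
  have e1 : gainKer b n (fun r => n r - m r) p = fun z => gainKer b n n p z - gainKer b n m p z := by
    ext z; simp only [gainKer]; ring
  have e2 : gainKer b (fun r => n r - m r) m p = fun z => gainKer b n m p z - gainKer b m m p z := by
    ext z; simp only [gainKer]; ring
  simp only [gain]
  rw [e1, e2, integral_sub h1 h2, integral_sub h2 h3]
  ring

/-- The constant in the stability estimate. -/
def stabConst (κ b C : ℝ) : ℝ := (2 * (4 * Real.pi ^ 2 * κ * halfConst b) + lossConst κ b) * C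

/-- The stability estimate for the collision operator. -/
lemma integral_sign_mul_collRad_sub_le (hκ : 0 < κ) (hb₁ : 1 < b) (hb : b < 2) {n m W σ : ℝ → ℝ} {B C : ℝ}
    (hnm : AEStronglyMeasurable n radVol) (hmm : AEStronglyMeasurable m radVol)
    (hn : ∀ᵐ r ∂radVol, 0 ≤ n r) (hm : ∀ᵐ r ∂radVol, 0 ≤ m r)
    (hni : Integrable (fun r => r ^ (-(b / 2)) * n r) radVol) (hmi : Integrable (fun r => r ^ (-(b / 2)) * m r) radVol)
    (hnb : Integrable (fun r => r ^ (-b) * n r) radVol) (hmb : Integrable (fun r => r ^ (-b) * m r) radVol)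
    (hnC : mom (-b) n ≤ C) (hmC : mom (-b) m ≤ C)
    (hnQ : Integrable (collRad κ b n) radVol) (hmQ : Integrable (collRad κ b m) radVol)
    (hW : IsBddWeight (fun r => W r * σ r) B) (hW0 : ∀ r, 0 < r → 0 ≤ W r)
    (hWle : ∀ r, 0 < r → W r ≤ r ^ (-(b / 2))) (hσ : ∀ r, |σ r| ≤ 1) (hσ' : ∀ r, 0 ≤ σ r * (n r - m r)) :
    ∫ r, W r * σ r * (collRad κ b n r - collRad κ b m r) ∂radVol ≤
      stabConst κ b C * ∫ r, r ^ (-(b / 2)) * |n r - m r| ∂radVol := by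
  set d : ℝ → ℝ := fun r => n r - m r with hd
  set a := lossConst κ b
  have ha : 0 < a := lossConst_pos hκ hb
  have hh := halfConst_pos hb
  have hdm : AEStronglyMeasurable d radVol := hnm.sub hmm
  have hdi : Integrable (fun r => r ^ (-(b / 2)) * d r) radVol :=
    (hni.sub hmi).congr (.of_forall fun r => by simp only [Pi.sub_apply, d]; ring)
  have hdi' : Integrable (fun r => r ^ (-(b / 2)) * |d r|) radVol := by
    refine hdi.abs.congr ?_
    filter_upwards [ae_radVol_pos] with r hr
    rw [abs_mul, abs_of_nonneg (Real.rpow_nonneg hr.le _)]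
  set y := ∫ r, r ^ (-(b / 2)) * |d r| ∂radVol
  have hy : 0 ≤ y := by
    refine integral_nonneg_of_ae ?_
    filter_upwards [ae_radVol_pos] with r hr
    exact mul_nonneg (Real.rpow_nonneg hr.le _) (abs_nonneg _)
  have hmeas : Measurable fun r : ℝ => r ^ (-(b / 2)) := by fun_prop
  have hr0 : ∀ s r : ℝ, 0 < r → 0 ≤ r ^ s := fun s r hr => Real.rpow_nonneg hr.le s
  have habs : ∀ f : ℝ → ℝ, (∀ᵐ r ∂radVol, 0 ≤ f r) → ∫ r, r ^ (-b) * |f r| ∂radVol = mom (-b) f := by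
    intro f hf
    refine integral_congr_ae ?_
    filter_upwards [hf] with r hr
    rw [abs_of_nonneg hr]
  -- In both bilinear terms the difference `d` carries `r^(-b/2)` and the solution carries `r^(-b)`;
  -- the two forms of `kernel_half_le` serve the two positions of `d`.
  obtain ⟨hw1, hw1'⟩ := integrable_weakGain (W := fun r => r ^ (-(b / 2))) hb hmeas (hr0 (-b)) (hr0 (-(b / 2)))
    hh.le hnm hdm hnb hdi (fun p q hp hq => (kernel_half_le hb₁ hb hp hq).2)
  obtain ⟨hw2, hw2'⟩ := integrable_weakGain (W := fun r => r ^ (-(b / 2))) hb hmeas (hr0 (-(b / 2))) (hr0 (-b))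
    hh.le hdm hmm hdi hmb (fun p q hp hq => (kernel_half_le hb₁ hb hp hq).1)
  have hg1 := integral_abs_gain_le hw1 hκ.le
  have hg2 := integral_abs_gain_le hw2 hκ.le
  rw [habs n hn] at hw1'
  rw [habs m hm] at hw2'
  have hi1 := (integrable_gain (κ := κ) hw1).abs
  have hi2 := (integrable_gain (κ := κ) hw2).abs
  have hM : |mom (-(b / 2)) n - mom (-(b / 2)) m| ≤ y := by
    rw [mom, mom, ← integral_sub hni hmi]
    refine abs_integral_le_integral_abs.trans_eq (integral_congr_ae ?_)
    filter_upwards [ae_radVol_pos] with r hr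
    rw [← mul_sub, abs_mul, abs_of_nonneg (hr0 _ r hr)]
  have hi3 : Integrable (fun r => |r ^ (-(b / 2)) * gain κ b n d r| + |r ^ (-(b / 2)) * gain κ b d m r|) radVol :=
    hi1.add hi2
  have hMn : 0 ≤ mom (-(b / 2)) n := by
    refine integral_nonneg_of_ae ?_
    filter_upwards [ae_radVol_pos, hn] with r h1 h2
    exact mul_nonneg (hr0 _ r h1) h2
  calc ∫ r, W r * σ r * (collRad κ b n r - collRad κ b m r) ∂radVol
      ≤ ∫ r, ((|r ^ (-(b / 2)) * gain κ b n d r| + |r ^ (-(b / 2)) * gain κ b d m r|) +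
          a * y * (r ^ (-b) * m r)) ∂radVol := by
        refine integral_mono_ae (hW.integrable (hnQ.sub hmQ)) (hi3.add (hmb.const_mul _)) ?_
        filter_upwards [ae_radVol_pos, hn, hm, gain_sub (κ := κ) hb hnm hmm hni hmi] with r hr hn hm hs
        have hρ := hr0 (-(b / 2)) r hr
        have hWr := hW0 r hr
        have hWl := hWle r hr
        have hWσ : |W r * σ r| ≤ r ^ (-(b / 2)) := by
          rw [abs_mul, abs_of_nonneg hWr]
          nlinarith [hσ r, abs_nonneg (σ r)]
        have e1 : collRad κ b n r - collRad κ b m r = gain κ b n d r + gain κ b d m r -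
            a * mom (-(b / 2)) n * (r ^ (-(b / 2)) * d r) -
            a * (mom (-(b / 2)) n - mom (-(b / 2)) m) * (r ^ (-(b / 2)) * m r) := by
          simp only [collRad]
          have : gain κ b n d r + gain κ b d m r = gain κ b n n r - gain κ b m m r := hs.symm
          rw [this]; simp only [d, a]; ring
        rw [e1]
        have t1 : ∀ x, W r * σ r * x ≤ |r ^ (-(b / 2)) * x| := by
          intro x
          refine (le_abs_self _).trans ?_
          rw [abs_mul, abs_mul (r ^ (-(b / 2))), abs_of_nonneg hρ]
          exact mul_le_mul_of_nonneg_right hWσ (abs_nonneg _)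
        -- The part of the loss acting on the difference has a good sign because `σ` is a sign of `n
        -- - m`; its unbounded coefficient therefore never has to be estimated.
        have t2 : 0 ≤ W r * σ r * (a * mom (-(b / 2)) n * (r ^ (-(b / 2)) * d r)) := by
          have := mul_nonneg (mul_nonneg hWr (mul_nonneg ha.le hMn)) (mul_nonneg hρ (hσ' r))
          refine this.trans_eq ?_
          simp only [d]; ring
        have t3 : -(W r * σ r * (a * (mom (-(b / 2)) n - mom (-(b / 2)) m) * (r ^ (-(b / 2)) * m r))) ≤
            a * y * (r ^ (-b) * m r) := by
          have h1 : r ^ (-b) = r ^ (-(b / 2)) * r ^ (-(b / 2)) := by rw [← Real.rpow_add hr]; congr 1; ring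
          rw [h1]
          refine (neg_le_abs _).trans ?_
          rw [abs_mul (W r * σ r), abs_mul (a * _), abs_mul a, abs_of_nonneg ha.le, abs_of_nonneg (mul_nonneg hρ hm)]
          calc _ ≤ r ^ (-(b / 2)) * (a * y * (r ^ (-(b / 2)) * m r)) := by gcongr
            _ = _ := by ring
        have t4 := t1 (gain κ b n d r)
        have t5 := t1 (gain κ b d m r)
        simp only [mul_sub, mul_add] at *
        linarith
    _ = ∫ r, |r ^ (-(b / 2)) * gain κ b n d r| ∂radVol + ∫ r, |r ^ (-(b / 2)) * gain κ b d m r| ∂radVol +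
          a * y * mom (-b) m := by
        rw [integral_add hi3 (hmb.const_mul _), integral_add hi1 hi2, integral_const_mul]; rfl
    _ ≤ 4 * Real.pi ^ 2 * κ * (halfConst b * C * y) + 4 * Real.pi ^ 2 * κ * (halfConst b * y * C) + a * y * C := by
        refine add_le_add (add_le_add (hg1.trans ?_) (hg2.trans ?_)) ?_
        · refine mul_le_mul_of_nonneg_left (hw1'.trans ?_) (by positivity)
          change halfConst b * mom (-b) n * y ≤ _
          gcongr
        · refine mul_le_mul_of_nonneg_left (hw2'.trans ?_) (by positivity)
          change halfConst b * y * mom (-b) m ≤ _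
          gcongr
        · gcongr
    _ = _ := by simp only [stabConst]; ring

end

/-! ### Uniqueness -/

section

variable {κ b T : ℝ}

lemma IsRadSolution.integrable_collRad {n : ℝ → RadL} (h : IsRadSolution κ b T n) {s : ℝ} (hs : s ∈ Icc 0 T) :
    Integrable (collRad κ b (n s)) radVol := by
  obtain ⟨g, -, hg⟩ := h.equation
  exact (g s).integrable.congr (hg s hs).2

/-- A radial solution of the Boltzmann equation is determined by its data. -/
theorem IsRadSolution.eqOn (hκ : 0 < κ) (hb₁ : 1 < b) (hb : b < 2) {n m : ℝ → RadL}
    (hn : IsRadSolution κ b T n) (hm : IsRadSolution κ b T m) (h0 : n 0 = m 0) (hne : n 0 ≠ 0)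
    (hi : Integrable (fun r => r ^ (-2 : ℝ) * n 0 r) radVol) : EqOn n m (Icc 0 T) := by
  obtain ⟨Cn, hCn⟩ := hn.exists_mom_neg_two_le hκ hb₁ hb hne hi
  obtain ⟨Cm, hCm⟩ := hm.exists_mom_neg_two_le hκ hb₁ hb (h0 ▸ hne) (h0 ▸ hi)
  obtain ⟨Dn, hDn⟩ := hn.moments
  obtain ⟨Dm, hDm⟩ := hm.moments
  -- Order `-b` lies strictly between `-2` and `-1`, hence the need for the propagated moment of
  -- order `-2`.
  have hbound : ∀ (C D : ℝ) (u : RadL), 0 ≤ u → Integrable (fun r => r ^ (-2 : ℝ) * u r) radVol → mom (-2) u ≤ C →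
      Integrable (fun r => solWeight r * u r) radVol → ∫ r, solWeight r * u r ∂radVol ≤ D →
      Integrable (fun r => r ^ (-b) * u r) radVol ∧ mom (-b) u ≤ C + D := by
    intro C D u hu h1 h2 h3 h4
    have h5 : ∀ r : ℝ, 0 < r → r ^ (-b) ≤ r ^ (-2 : ℝ) + solWeight r := by
      intro r hr
      have := rpow_le_rpow_add hr (s := -b) (s₁ := -2) (s₂ := 2) (by linarith) (by linarith)
      unfold solWeight
      linarith [Real.rpow_nonneg hr.le (-1)]
    have h6 : Integrable (fun r => (r ^ (-2 : ℝ) + solWeight r) * u r) radVol := by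
      simp only [add_mul]; exact h1.add h3
    have h7 : Integrable (fun r => r ^ (-b) * u r) radVol :=
      integrable_mul_of_le (by fun_prop) u.aesm h6 (C := 1) (fun r hr => Real.rpow_nonneg hr.le _)
        fun r hr => (h5 r hr).trans_eq (one_mul _).symm
    refine ⟨h7, (integral_mono_ae h7 h6 ?_).trans ?_⟩
    · filter_upwards [ae_radVol_pos, RadL.nonneg_iff.1 hu] with r hr h0
      exact mul_le_mul_of_nonneg_right (h5 r hr) h0
    · simp only [add_mul]
      rw [integral_add h1 h3]
      exact add_le_add h2 h4
  set C := max (Cn + Dn) (Cm + Dm)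
  set K := stabConst κ b C
  set y : ℝ → ℝ := fun s => ∫ r, r ^ (-(b / 2)) * |n s r - m s r| ∂radVol with hy
  have hni : ∀ s ∈ Icc 0 T, Integrable (fun r => r ^ (-(b / 2)) * n s r) radVol := fun s hs =>
    hn.integrable_rpow hs (by linarith) (by linarith)
  have hmi : ∀ s ∈ Icc 0 T, Integrable (fun r => r ^ (-(b / 2)) * m s r) radVol := fun s hs =>
    hm.integrable_rpow hs (by linarith) (by linarith)
  have hyi : ∀ s ∈ Icc 0 T, Integrable (fun r => r ^ (-(b / 2)) * |n s r - m s r|) radVol := by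
    intro s hs
    refine ((hni s hs).sub (hmi s hs)).abs.congr ?_
    filter_upwards [ae_radVol_pos] with r hr
    rw [Pi.sub_apply, ← mul_sub, abs_mul, abs_of_nonneg (Real.rpow_nonneg hr.le _)]
  have hy0 : ∀ s, 0 ≤ y s := by
    intro s
    refine integral_nonneg_of_ae ?_
    filter_upwards [ae_radVol_pos] with r hr
    exact mul_nonneg (Real.rpow_nonneg hr.le _) (abs_nonneg _)
  have hyD : ∀ s ∈ Icc 0 T, y s ≤ Dn + Dm := by
    intro s hs
    have h1 := (mom_le_of_solWeight (hn.nonneg s hs) (hDn s hs).1 (s := -(b / 2)) (by linarith) (by linarith)).trans (hDn s hs).2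
    have h2 := (mom_le_of_solWeight (hm.nonneg s hs) (hDm s hs).1 (s := -(b / 2)) (by linarith) (by linarith)).trans (hDm s hs).2
    refine le_trans ?_ (add_le_add h1 h2)
    rw [mom, mom, ← integral_add (hni s hs) (hmi s hs)]
    refine integral_mono_ae (hyi s hs) ((hni s hs).add (hmi s hs)) ?_
    filter_upwards [ae_radVol_pos, RadL.nonneg_iff.1 (hn.nonneg s hs), RadL.nonneg_iff.1 (hm.nonneg s hs)]
      with r hr h1 h2
    rw [← mul_add]
    refine mul_le_mul_of_nonneg_left ?_ (Real.rpow_nonneg hr.le _)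
    rw [abs_le]; constructor <;> linarith
  obtain ⟨gn, -, hgn⟩ := hn.equation
  obtain ⟨gm, -, hgm⟩ := hm.equation
  -- one step of the iteration
  have step : ∀ B B' : ℝ → ℝ, (∀ x, HasDerivAt B (B' x) x) → B 0 = 0 → (∀ s ∈ Icc 0 T, K * y s ≤ B' s) →
      ∀ s ∈ Icc 0 T, y s ≤ B s := by
    intro B B' hB hB0 hK t ht
    -- Truncations of `r^(-b/2)` make the weighted norm continuous in time; dominated convergence
    -- removes them at the end of the step.
    set W : ℕ → ℝ → ℝ := fun k r => min (r ^ (-(b / 2))) k with hWdef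
    have hWm : ∀ k, Measurable (W k) := fun k => by simp only [W]; fun_prop
    have hW0 : ∀ k r, 0 < r → 0 ≤ W k r := fun k r hr => le_min (Real.rpow_nonneg hr.le _) (Nat.cast_nonneg k)
    have hWb : ∀ k, IsBddWeight (W k) k := fun k => ⟨hWm k, fun r hr => by
      rw [abs_of_nonneg (hW0 k r hr)]; exact min_le_right _ _⟩
    have hz : ∀ k : ℕ, ∫ r, W k r * |n t r - m t r| ∂radVol ≤ B t := by
      intro k
      set z : ℝ → ℝ := fun s => ∫ r, W k r * |n s r - m s r| ∂radVol with hzdef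
      have hzn : ∀ s, z s = ‖mulL (hWb k) (n s - m s)‖ := by
        intro s
        rw [RadL.norm_eq]
        refine integral_congr_ae ?_
        filter_upwards [ae_radVol_pos, coe_mulL (hWb k) (n s - m s), Lp.coeFn_sub (n s) (m s)] with r hr h1 h2
        rw [h1, h2, Pi.sub_apply, abs_mul, abs_of_nonneg (hW0 k r hr)]
      have hz0 : z 0 = 0 := by rw [hzn, h0, sub_self, map_zero, norm_zero]
      have hsub : Icc 0 t ⊆ Icc 0 T := Icc_subset_Icc_right ht.2
      have hmain := sub_le_sub_of_left_slope (z := z) ht.1 ?_ hB ?_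
      · rw [hz0, hB0, sub_zero, sub_zero] at hmain
        exact hmain
      · have : z = fun s => ‖mulL (hWb k) (n s - m s)‖ := funext hzn
        rw [this]
        refine ((mulL (hWb k)).continuous.comp_continuousOn fun s hs => ?_).norm
        exact (((hgn s (hsub hs)).1.sub (hgm s (hsub hs)).1).continuousWithinAt).mono hsub
      · intro s hs r hr
        have hsT : s ∈ Icc 0 T := hsub ⟨hs.1.le, hs.2⟩
        have hnmeas := (Lp.stronglyMeasurable (n s)).measurable
        have hmmeas := (Lp.stronglyMeasurable (m s)).measurable
        -- The sign is frozen at time `s`. The linear functional `φ` agrees with the weighted norm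
        -- at `s` and stays below it at other times, so left slopes of the norm at `s` are bounded
        -- by those of a differentiable function.
        set σ : ℝ → ℝ := fun r => if m s r ≤ n s r then 1 else -1 with hσdef
        have hσm : Measurable σ := Measurable.ite (measurableSet_le hmmeas hnmeas) measurable_const measurable_const
        have hσ1 : ∀ r, |σ r| = 1 := by intro r; simp only [σ]; split_ifs <;> simp
        have hσ2 : ∀ r, σ r * (n s r - m s r) = |n s r - m s r| := by
          intro r; simp only [σ]; split_ifs with h
          · rw [one_mul, abs_of_nonneg (by linarith)]
          · rw [abs_of_neg (by linarith), neg_one_mul]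
        have hWσ : IsBddWeight (fun r => W k r * σ r) k := ⟨(hWm k).mul hσm, fun r hr => by
          rw [abs_mul, hσ1, mul_one]; exact (hWb k).bound r hr⟩
        set φ := wInt hWσ
        have hφs : z s = φ (n s - m s) := by
          rw [wInt_apply]
          refine integral_congr_ae ?_
          filter_upwards [Lp.coeFn_sub (n s) (m s)] with r h1
          rw [h1, Pi.sub_apply, mul_assoc, hσ2]
        have hφle : ∀ x, φ (n x - m x) ≤ z x := by
          intro x
          rw [wInt_apply]
          refine integral_mono_ae (hWσ.integrable (n x - m x).integrable)
            ((hWb k).integrable ((n x).integrable.sub (m x).integrable).abs) ?_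
          filter_upwards [ae_radVol_pos, Lp.coeFn_sub (n x) (m x)] with r hr h1
          rw [h1, Pi.sub_apply]
          refine (le_abs_self _).trans_eq ?_
          rw [abs_mul, abs_mul, hσ1, mul_one, abs_of_nonneg (hW0 k r hr)]
        have hder : HasDerivWithinAt (fun x => φ (n x - m x)) (φ (gn s - gm s)) (Iio s) s := by
          refine (φ.hasFDerivAt.comp_hasDerivWithinAt s ((hgn s hsT).1.sub (hgm s hsT).1)).mono_of_mem_nhdsWithin ?_
          exact Icc_mem_nhdsLT_of_mem ⟨hs.1, hsT.2⟩
        have hle : φ (gn s - gm s) ≤ B' s := by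
          refine le_trans ?_ (hK s hsT)
          obtain ⟨hnb1, hnb2⟩ := hbound Cn Dn (n s) (hn.nonneg s hsT) (hCn s hsT).1 (hCn s hsT).2 (hDn s hsT).1 (hDn s hsT).2
          obtain ⟨hmb1, hmb2⟩ := hbound Cm Dm (m s) (hm.nonneg s hsT) (hCm s hsT).1 (hCm s hsT).2 (hDm s hsT).1 (hDm s hsT).2
          have h1 := integral_sign_mul_collRad_sub_le (C := C) hκ hb₁ hb (n s).aesm (m s).aesm
            (RadL.nonneg_iff.1 (hn.nonneg s hsT)) (RadL.nonneg_iff.1 (hm.nonneg s hsT)) (hni s hsT) (hmi s hsT)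
            hnb1 hmb1 (hnb2.trans (le_max_left _ _)) (hmb2.trans (le_max_right _ _))
            (hn.integrable_collRad hsT) (hm.integrable_collRad hsT) hWσ (hW0 k) (fun r _ => min_le_left _ _)
            (fun r => (hσ1 r).le) (fun r => by rw [hσ2]; exact abs_nonneg _)
          refine le_trans (le_of_eq ?_) h1
          rw [wInt_apply]
          refine integral_congr_ae ?_
          filter_upwards [Lp.coeFn_sub (gn s) (gm s), (hgn s hsT).2, (hgm s hsT).2] with r h1 h2 h3
          rw [h1, Pi.sub_apply, h2, h3]
        have hslope := (hasDerivWithinAt_iff_tendsto_slope' (by simp)).1 hder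
        filter_upwards [hslope.eventually (gt_mem_nhds (hle.trans_lt hr)), self_mem_nhdsWithin] with x hx hxs
        refine lt_of_le_of_lt ?_ hx
        rw [mem_Iio] at hxs
        rw [slope_comm z, slope_comm (fun x => φ (n x - m x)), slope_def_field, slope_def_field]
        have : 0 ≤ s - x := by linarith
        have := hφle x
        rw [hφs]
        gcongr
    have hlim : Tendsto (fun k : ℕ => ∫ r, W k r * |n t r - m t r| ∂radVol) atTop (𝓝 (y t)) := by
      refine tendsto_integral_of_dominated_convergence _ (fun k => ((hWb k).integrable
        ((n t).integrable.sub (m t).integrable).abs).aestronglyMeasurable) (hyi t ht) (fun k => ?_) ?_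
      · filter_upwards [ae_radVol_pos] with r hr
        rw [norm_mul, Real.norm_of_nonneg (hW0 k r hr), Real.norm_eq_abs, abs_abs]
        exact mul_le_mul_of_nonneg_right (min_le_left _ _) (abs_nonneg _)
      · refine .of_forall fun r => tendsto_const_nhds.congr' ?_
        filter_upwards [tendsto_natCast_atTop_atTop.eventually (eventually_ge_atTop (r ^ (-(b / 2))))] with k hk
        simp only [W]; rw [min_eq_left hk]
    exact le_of_tendsto' hlim hz
  -- `y` is not known to be continuous, so Gronwall's lemma is replaced by iteration: each
  -- application of `step` integrates the previous bound, starting from the crude constant `Dn +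
  -- Dm`.
  have iter : ∀ j : ℕ, ∀ s ∈ Icc 0 T, y s ≤ (Dn + Dm) * ((K * s) ^ j / (j.factorial : ℝ)) := by
    have hK0 : 0 ≤ K ∨ ¬ (0 : ℝ) ∈ Icc 0 T := by
      by_cases h : (0 : ℝ) ∈ Icc 0 T
      · left
        have hC0 : 0 ≤ C := by
          obtain ⟨-, h2⟩ := hbound Cn Dn (n 0) (hn.nonneg 0 h) (hCn 0 h).1 (hCn 0 h).2 (hDn 0 h).1 (hDn 0 h).2
          exact (mom_nonneg (hn.nonneg 0 h) _).trans (h2.trans (le_max_left _ _))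
        have := lossConst_pos hκ hb
        have := halfConst_pos hb
        simp only [K, stabConst]; positivity
      · exact Or.inr h
    rcases hK0 with hK0 | hK0
    swap
    · exact fun j s hs => absurd ⟨le_rfl, hs.1.trans hs.2⟩ hK0
    intro j
    induction j with
    | zero => intro s hs; simpa using hyD s hs
    | succ j ih =>
      refine step _ (fun s => K * ((Dn + Dm) * ((K * s) ^ j / (j.factorial : ℝ)))) (fun x => ?_) (by simp)
        fun s hs => mul_le_mul_of_nonneg_left (ih s hs) hK0
      have h1 := ((((hasDerivAt_id' x).const_mul K).pow (j + 1)).div_const ((j + 1).factorial : ℝ)).const_mul (Dn + Dm)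
      refine h1.congr_deriv ?_
      have h2 : (j.factorial : ℝ) ≠ 0 := by positivity
      rw [Nat.factorial_succ]
      push_cast
      field_simp
  intro s hs
  have hlim : Tendsto (fun j : ℕ => (Dn + Dm) * ((K * s) ^ j / (j.factorial : ℝ))) atTop (𝓝 0) := by
    simpa using (FloorSemiring.tendsto_pow_div_factorial_atTop (K * s)).const_mul (Dn + Dm)
  have hys : y s = 0 := le_antisymm (ge_of_tendsto' hlim fun j => iter j s hs) (hy0 s)
  rw [hy, integral_eq_zero_iff_of_nonneg_ae _ (hyi s hs)] at hys
  · refine Lp.ext ?_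
    filter_upwards [hys, ae_radVol_pos] with r h1 hr
    have : r ^ (-(b / 2)) ≠ 0 := (Real.rpow_pos_of_pos hr _).ne'
    simpa [this, sub_eq_zero] using h1
  · filter_upwards [ae_radVol_pos] with r hr
    exact mul_nonneg (Real.rpow_nonneg hr.le _) (abs_nonneg _)

end

/-! ### Duhamel's formula and mild solutions in a Banach space -/

section

section Mild

variable {E : Type*} [NormedAddCommGroup E] [NormedSpace ℝ E] {S : ℝ → E →L[ℝ] E}

/-- The right-hand side of Duhamel's formula. -/
def duhamel (S : ℝ → E →L[ℝ] E) (x₀ : E) (y : ℝ → E) (θ : ℝ) : E := S θ x₀ + ∫ τ in (0 : ℝ)..θ, S (θ - τ) (y τ)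

lemma continuous_duhamel_integrand (hS : Continuous fun z : ℝ × E => S z.1 z.2) {y : ℝ → E} (hy : Continuous y) :
    Continuous fun z : ℝ × ℝ => S (z.1 - z.2) (y z.2) :=
  hS.comp (by fun_prop : Continuous fun z : ℝ × ℝ => (z.1 - z.2, y z.2))

lemma continuous_duhamel (hS : Continuous fun z : ℝ × E => S z.1 z.2) (x₀ : E) {y : ℝ → E} (hy : Continuous y) :
    Continuous (duhamel S x₀ y) :=
  (hS.comp (by fun_prop : Continuous fun θ : ℝ => (θ, x₀))).add
    (intervalIntegral.continuous_parametric_intervalIntegral_of_continuous (f := fun θ τ => S (θ - τ) (y τ))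
      (continuous_duhamel_integrand hS hy) continuous_id)

/-- Existence of mild solutions of a semilinear equation in an invariant closed set. -/
lemma exists_eq_duhamel [CompleteSpace E] (hS : Continuous fun z : ℝ × E => S z.1 z.2) (hS1 : ∀ θ x, ‖S θ x‖ ≤ ‖x‖)
    {N : E → E} (hN : Continuous N) {X : Set E} (hX : IsClosed X) {x₀ : E} (hx₀ : x₀ ∈ X) {K Θ : ℝ} (hΘ : 0 ≤ Θ)
    (hK : 0 ≤ K) (hKΘ : K * Θ < 1) (hNK : ∀ x ∈ X, ∀ y ∈ X, ‖N x - N y‖ ≤ K * ‖x - y‖)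
    (hinv : ∀ y : ℝ → E, Continuous y → (∀ τ, y τ ∈ N '' X) → ∀ θ ∈ Icc 0 Θ, duhamel S x₀ y θ ∈ X) :
    ∃ u : ℝ → E, Continuous u ∧ (∀ θ, u θ ∈ X) ∧ ∀ θ ∈ Icc 0 Θ, u θ = duhamel S x₀ (fun τ => N (u τ)) θ := by
  -- Paths are extended by their end values, so the integrand is continuous on the whole line and
  -- still takes values in `X`.
  let ext : C(Icc 0 Θ, E) → ℝ → E := fun u => IccExtend hΘ u
  have hext : ∀ u, Continuous (ext u) := fun u => u.continuous.Icc_extend'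
  let Φ : C(Icc 0 Θ, E) → C(Icc 0 Θ, E) := fun u =>
    ⟨fun θ => duhamel S x₀ (fun τ => N (ext u τ)) θ,
      (continuous_duhamel hS x₀ (hN.comp (hext u))).comp continuous_subtype_val⟩
  let Y : Set C(Icc 0 Θ, E) := {u | ∀ θ, u θ ∈ X}
  have hYc : IsClosed Y := by
    have : Y = ⋂ θ, (fun u : C(Icc 0 Θ, E) => u θ) ⁻¹' X := by ext u; simp [Y]
    rw [this]
    exact isClosed_iInter fun θ => hX.preimage (continuous_eval_const θ)
  have hYX : ∀ u ∈ Y, ∀ τ, ext u τ ∈ X := fun u hu τ => hu _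
  have hmaps : MapsTo Φ Y Y := fun u hu θ =>
    hinv _ (hN.comp (hext u)) (fun τ => mem_image_of_mem N (hYX u hu τ)) θ θ.2
  have hcontr : ContractingWith (Real.toNNReal (K * Θ)) (hmaps.restrict Φ Y Y) := by
    refine ⟨by rw [← NNReal.coe_lt_coe, Real.coe_toNNReal _ (by positivity)]; exact_mod_cast hKΘ,
      LipschitzWith.of_dist_le_mul fun u u' => ?_⟩
    rw [Real.coe_toNNReal _ (by positivity)]
    change dist (Φ u) (Φ u') ≤ K * Θ * dist (u : C(Icc 0 Θ, E)) u'
    rw [ContinuousMap.dist_le (by positivity)]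
    intro θ
    have hi : ∀ u : C(Icc 0 Θ, E), IntervalIntegrable (fun τ => S (θ - τ) (N (ext u τ))) volume 0 θ := fun u =>
      ((continuous_duhamel_integrand hS (hN.comp (hext u))).comp
        (by fun_prop : Continuous fun τ : ℝ => ((θ : ℝ), τ))).intervalIntegrable _ _
    rw [dist_eq_norm]
    change ‖S θ x₀ + _ - (S θ x₀ + _)‖ ≤ _
    rw [add_sub_add_left_eq_sub, ← intervalIntegral.integral_sub (hi u) (hi u')]
    have hbd : ∀ τ ∈ uIoc (0 : ℝ) θ, ‖S (θ - τ) (N (ext u τ)) - S (θ - τ) (N (ext u' τ))‖ ≤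
        K * dist (u : C(Icc 0 Θ, E)) u' := by
      intro τ _
      rw [← map_sub]
      refine (hS1 _ _).trans ((hNK _ (hYX u u.2 τ) _ (hYX u' u'.2 τ)).trans ?_)
      rw [← dist_eq_norm]
      exact mul_le_mul_of_nonneg_left (ContinuousMap.dist_apply_le_dist _) hK
    refine (intervalIntegral.norm_integral_le_of_norm_le_const hbd).trans ?_
    rw [sub_zero, abs_of_nonneg θ.2.1]
    have := θ.2.2
    have hd : 0 ≤ dist (u : C(Icc 0 Θ, E)) u' := dist_nonneg
    calc K * dist (u : C(Icc 0 Θ, E)) u' * θ ≤ K * dist (u : C(Icc 0 Θ, E)) u' * Θ := by gcongr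
      _ = _ := by ring
  obtain ⟨u, hu, hfix, -⟩ := hcontr.exists_fixedPoint' hYc.isComplete hmaps
    (x := ContinuousMap.const _ x₀) (fun _ => hx₀) (edist_ne_top _ _)
  refine ⟨ext u, hext u, hYX u hu, fun θ hθ => ?_⟩
  have h1 : ext u θ = u ⟨θ, hθ⟩ := IccExtend_of_mem _ _ hθ
  rw [h1]
  exact (DFunLike.congr_fun hfix ⟨θ, hθ⟩).symm

lemma duhamel_eq_add [CompleteSpace E] (hS : Continuous fun z : ℝ × E => S z.1 z.2) (hadd : ∀ s t, 0 ≤ s → 0 ≤ t → ∀ x, S (s + t) x = S s (S t x))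
    {y : ℝ → E} (hy : Continuous y) (x₀ : E) {θ θ' : ℝ} (hθ : 0 ≤ θ) (h : θ ≤ θ') :
    duhamel S x₀ y θ' = S (θ' - θ) (duhamel S x₀ y θ) + ∫ τ in θ..θ', S (θ' - τ) (y τ) := by
  have hi : ∀ t a c, IntervalIntegrable (fun τ => S (t - τ) (y τ)) volume a c := fun t a c =>
    ((continuous_duhamel_integrand hS hy).comp (by fun_prop : Continuous fun τ : ℝ => (t, τ))).intervalIntegrable _ _
  rw [duhamel, duhamel, map_add, ← hadd _ _ (by linarith) hθ, sub_add_cancel, add_assoc,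
    ← ContinuousLinearMap.intervalIntegral_comp_comm _ (hi θ 0 θ),
    ← intervalIntegral.integral_add_adjacent_intervals (hi θ' 0 θ) (hi θ' θ θ')]
  congr 2
  refine intervalIntegral.integral_congr fun τ hτ => ?_
  rw [uIcc_of_le hθ] at hτ
  rw [← hadd _ _ (by linarith) (by linarith [hτ.2])]
  congr 2; ring

/-- A mild solution is differentiable after application of a regularising operator `V`. -/
lemma hasDerivWithinAt_of_eq_duhamel [CompleteSpace E] (hS : Continuous fun z : ℝ × E => S z.1 z.2) (hS0 : ∀ x, S 0 x = x)
    (hadd : ∀ s t, 0 ≤ s → 0 ≤ t → ∀ x, S (s + t) x = S s (S t x)) {V A : E →L[ℝ] E} {c : ℝ}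
    (hA : ∀ h, 0 ≤ h → ∀ x, ‖V (S h x) - V x - h • A x‖ ≤ c * h ^ 2 * ‖x‖)
    {u y : ℝ → E} (hu : Continuous u) (hy : Continuous y) {x₀ : E} {Θ : ℝ}
    (hd : ∀ θ ∈ Icc 0 Θ, u θ = duhamel S x₀ y θ) :
    ∀ θ ∈ Icc 0 Θ, HasDerivWithinAt (fun θ => V (u θ)) (A (u θ) + V (y θ)) (Icc 0 Θ) θ := by
  -- Restarting Duhamel's formula at `θ` gives right derivatives only, since the semigroup law is
  -- assumed for nonnegative times. The right derivative is continuous, so comparison with its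
  -- primitive upgrades it to a derivative on the interval.
  have hright : ∀ θ ∈ Ico 0 Θ, HasDerivWithinAt (fun θ => V (u θ)) (A (u θ) + V (y θ)) (Ici θ) θ := by
    intro θ hθ
    have h1 : HasDerivWithinAt (fun θ' => V (S (θ' - θ) (u θ))) (A (u θ)) (Ici θ) θ := by
      rw [hasDerivWithinAt_iff_isLittleO]
      have hsq : (fun θ' : ℝ => (θ' - θ) ^ 2) =o[𝓝[≥] θ] fun θ' => θ' - θ := by
        have : (fun x : ℝ => x ^ 2) =o[𝓝 0] fun x => x := by
          simpa using Asymptotics.isLittleO_pow_pow (𝕜 := ℝ) (m := 1) (n := 2) (by norm_num)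
        refine this.comp_tendsto ?_
        have : Tendsto (fun θ' : ℝ => θ' - θ) (𝓝 θ) (𝓝 (θ - θ)) := (continuous_id.sub continuous_const).tendsto θ
        rw [sub_self] at this
        exact this.mono_left nhdsWithin_le_nhds
      refine Asymptotics.IsBigO.trans_isLittleO (Asymptotics.IsBigO.of_bound (c * ‖u θ‖) ?_) hsq
      filter_upwards [self_mem_nhdsWithin] with θ' hθ'
      have := hA (θ' - θ) (sub_nonneg.2 hθ') (u θ)
      rw [sub_self, hS0]
      refine this.trans_eq ?_
      rw [Real.norm_of_nonneg (sq_nonneg _)]; ring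
    have h2 : HasDerivWithinAt (fun θ' => ∫ τ in θ..θ', S (θ' - τ) (y τ)) (y θ) (Ici θ) θ := by
      rw [hasDerivWithinAt_iff_isLittleO, Asymptotics.isLittleO_iff]
      intro ε hε
      have hc := (continuous_duhamel_integrand hS hy).tendsto (θ, θ)
      rw [sub_self, hS0] at hc
      obtain ⟨δ, hδ, hball⟩ := Metric.tendsto_nhds_nhds.1 hc ε hε
      filter_upwards [self_mem_nhdsWithin, mem_nhdsWithin_of_mem_nhds (Metric.ball_mem_nhds θ hδ)] with θ' h1 h2
      rw [Metric.mem_ball] at h2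
      rw [mem_Ici] at h1
      have hi : IntervalIntegrable (fun τ => S (θ' - τ) (y τ)) volume θ θ' :=
        ((continuous_duhamel_integrand hS hy).comp (by fun_prop : Continuous fun τ : ℝ => (θ', τ))).intervalIntegrable _ _
      rw [intervalIntegral.integral_same, sub_zero, ← intervalIntegral.integral_const,
        ← intervalIntegral.integral_sub hi intervalIntegrable_const]
      refine intervalIntegral.norm_integral_le_of_norm_le_const fun τ hτ => ?_
      rw [uIoc_of_le h1] at hτ
      have := hball (x := (θ', τ)) (by
        rw [Prod.dist_eq, max_lt_iff]
        refine ⟨h2, ?_⟩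
        rw [Real.dist_eq, abs_lt] at h2 ⊢
        constructor <;> linarith [hτ.1, hτ.2, h2.2])
      rw [dist_eq_norm] at this
      exact this.le
    have h3 := h1.add ((V.hasFDerivAt (x := ∫ τ in θ..θ, S (θ - τ) (y τ))).comp_hasDerivWithinAt θ h2)
    refine h3.congr_of_eventuallyEq ?_ ?_
    · filter_upwards [Icc_mem_nhdsGE_of_mem hθ, self_mem_nhdsWithin] with θ' hθ' hle
      rw [hd θ' hθ', duhamel_eq_add hS hadd hy x₀ hθ.1 hle, ← hd θ ⟨hθ.1, hθ.2.le⟩, map_add]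
      rfl
    · simp [hS0]
  set h : ℝ → E := fun θ => A (u θ) + V (y θ)
  have hh : Continuous h := (A.continuous.comp hu).add (V.continuous.comp hy)
  have hF : ∀ θ, HasDerivAt (fun θ => ∫ τ in (0 : ℝ)..θ, h τ) (h θ) θ := fun θ =>
    (hh.integral_hasStrictDerivAt 0 θ).hasDerivAt
  intro θ hθ
  have hconst : ∀ x ∈ Icc 0 Θ, V (u x) - ∫ τ in (0 : ℝ)..x, h τ = V (u 0) := by
    intro x hx
    have := constant_of_has_deriv_right_zero (f := fun x => V (u x) - ∫ τ in (0 : ℝ)..x, h τ) (a := 0) (b := Θ)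
      (((V.continuous.comp hu).sub (continuous_iff_continuousAt.2 fun x => (hF x).continuousAt)).continuousOn)
      (fun x hx => ((hright x hx).sub (hF x).hasDerivWithinAt).congr_deriv (sub_self _)) x hx
    simpa using this
  refine ((hF θ).const_add (V (u 0))).hasDerivWithinAt.congr (fun x hx => ?_) ?_
  · rw [← hconst x hx, sub_add_cancel]
  · rw [← hconst θ hθ, sub_add_cancel]

end Mild

end

/-! ### The weighted space, its semigroup and its gain term -/

section

lemma RadL.smul_nonneg {c : ℝ} (hc : 0 ≤ c) {n : RadL} (hn : 0 ≤ n) : 0 ≤ c • n := by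
  rw [RadL.nonneg_iff] at *
  filter_upwards [hn, Lp.coeFn_smul c n] with r h1 h2
  rw [h2]; exact mul_nonneg hc h1

instance : IsOrderedModule ℝ RadL where
  toPosSMulMono := PosSMulMono.of_smul_nonneg fun _ hc _ hn => RadL.smul_nonneg hc hn
  toSMulPosMono := SMulPosMono.of_pos fun n hn c d hcd => by
    rw [← sub_nonneg, ← sub_smul]
    exact RadL.smul_nonneg (sub_nonneg.2 hcd) hn.le

variable {κ b : ℝ}

/-! ### The semigroup generated by the loss term -/

/-- Replacing `θ` by `max θ 0` makes the operators contractions for every real `θ`, as the fixed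
point argument asks; the semigroup law concerns nonnegative times only. -/
lemma isBddWeight_exp (b θ : ℝ) : IsBddWeight (fun r => Real.exp (-(max θ 0 * r ^ (-(b / 2))))) 1 := by
  refine ⟨by fun_prop, fun r hr => ?_⟩
  rw [Real.abs_exp, Real.exp_le_one_iff, neg_nonpos]
  positivity

/-- The semigroup generated by `-r^(-b/2)`. -/
def lossSemi (b θ : ℝ) : RadL →L[ℝ] RadL := mulL (isBddWeight_exp b θ)

lemma norm_lossSemi_le (θ : ℝ) (x : RadL) : ‖lossSemi b θ x‖ ≤ ‖x‖ := (norm_mulL_le _ x).trans_eq (one_mul _)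

lemma coe_lossSemi {θ : ℝ} (hθ : 0 ≤ θ) (x : RadL) :
    lossSemi b θ x =ᵐ[radVol] fun r => Real.exp (-(θ * r ^ (-(b / 2)))) * x r := by
  refine (coe_mulL _ x).trans (.of_forall fun r => ?_)
  simp only []
  rw [max_eq_left hθ]

lemma lossSemi_zero (x : RadL) : lossSemi b 0 x = x := by
  refine Lp.ext ((coe_lossSemi le_rfl x).trans (.of_forall fun r => ?_))
  simp

lemma lossSemi_add (s t : ℝ) (hs : 0 ≤ s) (ht : 0 ≤ t) (x : RadL) :
    lossSemi b (s + t) x = lossSemi b s (lossSemi b t x) := by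
  refine Lp.ext ?_
  filter_upwards [coe_lossSemi (b := b) (add_nonneg hs ht) x, coe_lossSemi (b := b) hs (lossSemi b t x),
    coe_lossSemi (b := b) ht x] with r h1 h2 h3
  rw [h1, h2, h3, ← mul_assoc, ← Real.exp_add]
  congr 2; ring

lemma norm_lossSemi_sub (θ θ' : ℝ) (x : RadL) : ‖lossSemi b θ x - lossSemi b θ' x‖ =
    ∫ r, |Real.exp (-(max θ 0 * r ^ (-(b / 2)))) - Real.exp (-(max θ' 0 * r ^ (-(b / 2))))| * |x r| ∂radVol := by
  rw [RadL.norm_eq]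
  refine integral_congr_ae ?_
  filter_upwards [Lp.coeFn_sub (lossSemi b θ x) (lossSemi b θ' x), coe_mulL (isBddWeight_exp b θ) x,
    coe_mulL (isBddWeight_exp b θ') x] with r h1 h2 h3
  rw [h1, Pi.sub_apply, lossSemi, lossSemi, h2, h3, ← sub_mul, abs_mul]

lemma continuous_lossSemi : Continuous fun z : ℝ × RadL => lossSemi b z.1 z.2 := by
  refine continuous_prod_of_continuous_lipschitzWith' _ 1 (fun θ => ?_) fun x => ?_
  · refine LipschitzWith.of_dist_le_mul fun x y => ?_
    rw [dist_eq_norm, dist_eq_norm, ← map_sub, NNReal.coe_one, one_mul]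
    exact norm_lossSemi_le θ _
  · refine continuous_iff_continuousAt.2 fun θ₀ => ?_
    rw [ContinuousAt, tendsto_iff_norm_sub_tendsto_zero]
    simp only [norm_lossSemi_sub]
    have h0 : (0 : ℝ) = ∫ r, |Real.exp (-(max θ₀ 0 * r ^ (-(b / 2)))) -
        Real.exp (-(max θ₀ 0 * r ^ (-(b / 2))))| * |x r| ∂radVol := by simp
    suffices key : Tendsto (fun θ => ∫ r, |Real.exp (-(max θ 0 * r ^ (-(b / 2)))) -
        Real.exp (-(max θ₀ 0 * r ^ (-(b / 2))))| * |x r| ∂radVol) (𝓝 θ₀) (𝓝 (∫ r, |Real.exp (-(max θ₀ 0 * r ^ (-(b / 2)))) -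
        Real.exp (-(max θ₀ 0 * r ^ (-(b / 2))))| * |x r| ∂radVol)) by
      rw [← h0] at key; exact key
    have hb : ∀ θ r : ℝ, 0 < r → |Real.exp (-(max θ 0 * r ^ (-(b / 2))))| ≤ 1 := fun θ => (isBddWeight_exp b θ).bound
    refine tendsto_integral_filter_of_dominated_convergence (fun r => 2 * |x r|) (.of_forall fun θ => ?_)
      (.of_forall fun θ => ?_) (x.integrable.abs.const_mul 2) (.of_forall fun r => ?_)
    · exact (by fun_prop : Measurable fun r : ℝ => |Real.exp (-(max θ 0 * r ^ (-(b / 2)))) -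
        Real.exp (-(max θ₀ 0 * r ^ (-(b / 2))))|).aestronglyMeasurable.mul x.integrable.abs.aestronglyMeasurable
    · filter_upwards [ae_radVol_pos] with r hr
      rw [norm_mul, Real.norm_eq_abs, Real.norm_eq_abs, abs_abs, abs_abs]
      refine mul_le_mul_of_nonneg_right ?_ (abs_nonneg _)
      refine (abs_sub _ _).trans ?_
      linarith [hb θ r hr, hb θ₀ r hr]
    · have : Continuous fun θ : ℝ => |Real.exp (-(max θ 0 * r ^ (-(b / 2)))) -
        Real.exp (-(max θ₀ 0 * r ^ (-(b / 2))))| * |x r| := by fun_prop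
      exact this.tendsto θ₀

/-! ### Densities weighted by `r⁻² + r²` -/

lemma measurable_dataWeight : Measurable dataWeight := by unfold dataWeight; fun_prop

lemma dataWeight_pos {r : ℝ} (hr : 0 < r) : 0 < dataWeight r := by unfold dataWeight; positivity

lemma isBddWeight_div {s : ℝ} (h₁ : -2 ≤ s) (h₂ : s ≤ 2) : IsBddWeight (fun r => r ^ s / dataWeight r) 1 := by
  have := measurable_dataWeight
  refine ⟨by fun_prop, fun r hr => ?_⟩
  have := dataWeight_pos hr
  rw [abs_of_nonneg (by positivity), div_le_one this]
  exact rpow_le_dataWeight hr h₁ h₂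

/-- The density `u / (r⁻² + r²)`. -/
def den (u : ℝ → ℝ) (r : ℝ) : ℝ := u r / dataWeight r

lemma rpow_div_mul_eq (u : ℝ → ℝ) (s r : ℝ) : r ^ s / dataWeight r * u r = r ^ s * den u r := by
  rw [den]; ring

lemma integrable_rpow_den (u : RadL) {s : ℝ} (h₁ : -2 ≤ s) (h₂ : s ≤ 2) :
    Integrable (fun r => r ^ s * den u r) radVol := by
  simpa only [rpow_div_mul_eq] using (isBddWeight_div h₁ h₂).integrable u.integrable

lemma aesm_den (u : RadL) : AEStronglyMeasurable (den u) radVol := by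
  simpa using (integrable_rpow_den u (s := 0) (by norm_num) (by norm_num)).aestronglyMeasurable

lemma dataWeight_mul_den (u : ℝ → ℝ) : (fun r => dataWeight r * den u r) =ᵐ[radVol] u := by
  filter_upwards [ae_radVol_pos] with r hr
  rw [den, mul_div_cancel₀ _ (dataWeight_pos hr).ne']

lemma integrable_dataWeight_den (u : RadL) : Integrable (fun r => dataWeight r * den u r) radVol :=
  u.integrable.congr (dataWeight_mul_den u).symm

lemma integral_dataWeight_abs_den (u : RadL) : ∫ r, dataWeight r * |den u r| ∂radVol = ‖u‖ := by
  rw [RadL.norm_eq]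
  refine integral_congr_ae ?_
  filter_upwards [ae_radVol_pos, dataWeight_mul_den u] with r hr h
  rw [← h, abs_mul, abs_of_pos (dataWeight_pos hr)]

lemma den_sub (u v : RadL) : den (u - v : RadL) =ᵐ[radVol] fun r => den u r - den v r := by
  filter_upwards [Lp.coeFn_sub u v] with r hr
  rw [den, hr, Pi.sub_apply, den, den, sub_div]

lemma den_nonneg {u : RadL} (hu : 0 ≤ u) : ∀ᵐ r ∂radVol, 0 ≤ den u r := by
  filter_upwards [ae_radVol_pos, RadL.nonneg_iff.1 hu] with r h1 h2
  exact div_nonneg h2 (dataWeight_nonneg r h1)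

lemma isBddWeight_inv : IsBddWeight (fun r => (dataWeight r)⁻¹) 1 := by
  simpa using isBddWeight_div (s := 0) (by norm_num) (by norm_num)

/-- Passage from the weighted density to the density. -/
def denL : RadL →L[ℝ] RadL := mulL isBddWeight_inv

lemma coe_denL (u : RadL) : denL u =ᵐ[radVol] den u := by
  refine (coe_mulL _ u).trans (.of_forall fun r => ?_)
  simp only [den]; ring

lemma isBddWeight_loss (hb₁ : 1 < b) (hb : b < 2) : IsBddWeight (fun r => -(r ^ (-(b / 2)) / dataWeight r)) 1 := by
  have h := isBddWeight_div (s := -(b / 2)) (by linarith) (by linarith)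
  exact ⟨h.meas.neg, fun r hr => by rw [abs_neg]; exact h.bound r hr⟩

/-- The generator `-r^(-b/2)` followed by passage to the density. -/
def lossL (hb₁ : 1 < b) (hb : b < 2) : RadL →L[ℝ] RadL := mulL (isBddWeight_loss hb₁ hb)

lemma coe_lossL (hb₁ : 1 < b) (hb : b < 2) (u : RadL) :
    lossL hb₁ hb u =ᵐ[radVol] fun r => -(r ^ (-(b / 2)) * den u r) := by
  refine (coe_mulL _ u).trans (.of_forall fun r => ?_)
  simp only [den]; ring

/-- The remainder of the exponential is at most `(h r^(-b/2))² = h² r^(-b)`, and dividing by the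
weight absorbs `r^(-b)`, because `b < 2`. The semigroup, whose generator is unbounded, thus becomes
differentiable after passage to the unweighted density. -/
lemma norm_denL_lossSemi_sub_le (hb₁ : 1 < b) (hb : b < 2) (h : ℝ) (hh : 0 ≤ h) (x : RadL) :
    ‖denL (lossSemi b h x) - denL x - h • lossL hb₁ hb x‖ ≤ 1 * h ^ 2 * ‖x‖ := by
  rw [RadL.norm_eq, RadL.norm_eq, ← integral_const_mul]
  refine integral_mono_ae (denL (lossSemi b h x) - denL x - h • lossL hb₁ hb x).integrable.abs
    (x.integrable.abs.const_mul _) ?_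
  filter_upwards [ae_radVol_pos, Lp.coeFn_sub (denL (lossSemi b h x) - denL x) (h • lossL hb₁ hb x),
    Lp.coeFn_sub (denL (lossSemi b h x)) (denL x), Lp.coeFn_smul h (lossL hb₁ hb x), coe_denL (lossSemi b h x),
    coe_denL x, coe_lossL hb₁ hb x, coe_lossSemi (b := b) hh x] with r hr h1 h2 h3 h4 h5 h6 h7
  rw [h1, Pi.sub_apply, h2, Pi.sub_apply, h3, Pi.smul_apply, h4, h5, h6, smul_eq_mul]
  simp only [den]
  rw [h7]
  set ρ := r ^ (-(b / 2)) with hρ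
  have hρ0 : 0 < ρ := by positivity
  have hw := dataWeight_pos hr
  have e : Real.exp (-(h * ρ)) * x r / dataWeight r - x r / dataWeight r - h * -(ρ * (x r / dataWeight r)) =
      (Real.exp (-(h * ρ)) - 1 + h * ρ) / dataWeight r * x r := by ring
  rw [e, abs_mul]
  refine mul_le_mul_of_nonneg_right ?_ (abs_nonneg _)
  have h8 : 0 ≤ Real.exp (-(h * ρ)) - 1 + h * ρ := by linarith [Real.add_one_le_exp (-(h * ρ))]
  have h9 : Real.exp (-(h * ρ)) - 1 + h * ρ ≤ (h * ρ) ^ 2 := by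
    have hp : 0 ≤ h * ρ := by positivity
    rcases le_total (h * ρ) 1 with hx | hx
    · have := Real.abs_exp_sub_one_sub_id_le (x := -(h * ρ)) (by rwa [abs_neg, abs_of_nonneg hp])
      have := (le_abs_self _).trans this
      linarith
    · have : Real.exp (-(h * ρ)) ≤ 1 := Real.exp_le_one_iff.2 (by linarith)
      nlinarith
  rw [abs_of_nonneg (by positivity), div_le_iff₀ hw]
  have h10 : ρ ^ 2 ≤ dataWeight r := by
    rw [hρ, ← Real.rpow_natCast, ← Real.rpow_mul hr.le]
    exact rpow_le_dataWeight hr (by push_cast; linarith) (by push_cast; linarith)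
  calc _ ≤ (h * ρ) ^ 2 := h9
    _ = h ^ 2 * ρ ^ 2 := by ring
    _ ≤ h ^ 2 * dataWeight r := by gcongr
    _ = _ := by ring

/-- The moment of order `-b/2` of the density, as a functional of the weighted density. -/
def momL (hb₁ : 1 < b) (hb : b < 2) : RadL →L[ℝ] ℝ :=
  wInt (isBddWeight_div (s := -(b / 2)) (by linarith) (by linarith))

lemma momL_apply (hb₁ : 1 < b) (hb : b < 2) (u : RadL) : momL hb₁ hb u = mom (-(b / 2)) (den u) := by
  rw [momL, wInt_apply]; simp only [rpow_div_mul_eq]; rfl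

lemma abs_momL_le (hb₁ : 1 < b) (hb : b < 2) (u : RadL) : |momL hb₁ hb u| ≤ ‖u‖ := by
  have hW := isBddWeight_div (s := -(b / 2)) (by linarith) (by linarith)
  rw [momL, wInt_apply, RadL.norm_eq]
  refine abs_integral_le_integral_abs.trans (integral_mono_ae (hW.integrable u.integrable).abs u.integrable.abs ?_)
  filter_upwards [ae_radVol_pos] with r hr
  rw [abs_mul]
  exact mul_le_of_le_one_left (abs_nonneg _) (hW.bound r hr)

lemma momL_mono (hb₁ : 1 < b) (hb : b < 2) {u v : RadL} (h : u ≤ v) : momL hb₁ hb u ≤ momL hb₁ hb v := by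
  have hW := isBddWeight_div (s := -(b / 2)) (by linarith) (by linarith)
  rw [momL, wInt_apply, wInt_apply]
  refine integral_mono_ae (hW.integrable u.integrable) (hW.integrable v.integrable) ?_
  filter_upwards [ae_radVol_pos, (Lp.coeFn_le u v).2 h] with r hr h
  have := dataWeight_pos hr
  exact mul_le_mul_of_nonneg_left h (by positivity)

lemma momL_pos (hb₁ : 1 < b) (hb : b < 2) {u : RadL} (h : 0 ≤ u) (h0 : u ≠ 0) : 0 < momL hb₁ hb u := by
  have hW := isBddWeight_div (s := -(b / 2)) (by linarith) (by linarith)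
  have hnn : 0 ≤ᵐ[radVol] fun r => r ^ (-(b / 2)) / dataWeight r * u r := by
    filter_upwards [ae_radVol_pos, RadL.nonneg_iff.1 h] with r hr h
    have := dataWeight_pos hr
    simp only [Pi.zero_apply]; positivity
  rw [momL, wInt_apply]
  refine lt_of_le_of_ne (integral_nonneg_of_ae hnn) fun he => h0 ?_
  rw [eq_comm, integral_eq_zero_iff_of_nonneg_ae hnn (hW.integrable u.integrable)] at he
  refine Lp.ext ?_
  filter_upwards [he, ae_radVol_pos, Lp.coeFn_zero ℝ 1 radVol] with r h1 hr h2
  have h3 := dataWeight_pos hr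
  have h4 : r ^ (-(b / 2)) / dataWeight r ≠ 0 := by positivity
  rw [h2]
  simpa [h4, h3.ne'] using h1

/-! ### The gain term on weighted densities -/

/-- The constant in the estimate of the gain term. -/
def gainConst (κ b : ℝ) : ℝ := 4 * Real.pi ^ 2 * κ * (negTwoConst b + 4 * kerConst b)

lemma gainConst_pos (hκ : 0 < κ) (hb : b < 2) : 0 < gainConst κ b := by
  have := negTwoConst_pos hb
  have := kerConst_pos hb
  unfold gainConst; positivity

lemma integral_dataWeight_gain_le (hκ : 0 < κ) (hb₁ : 1 < b) (hb : b < 2) {n m : ℝ → ℝ}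
    (hn : AEStronglyMeasurable n radVol) (hm : AEStronglyMeasurable m radVol)
    (hni : Integrable (fun r => dataWeight r * n r) radVol) (hmi : Integrable (fun r => dataWeight r * m r) radVol) :
    Integrable (fun r => dataWeight r * gain κ b n m r) radVol ∧ ∫ r, |dataWeight r * gain κ b n m r| ∂radVol ≤
      gainConst κ b * (∫ r, dataWeight r * |n r| ∂radVol) * ∫ r, dataWeight r * |m r| ∂radVol := by
  have h1 := negTwoConst_pos hb
  have h2 := kerConst_pos hb
  obtain ⟨h3, h4⟩ := integrable_weakGain (C := negTwoConst b + 4 * kerConst b) hb measurable_dataWeight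
    dataWeight_nonneg dataWeight_nonneg (by positivity) hn hm hni hmi
    (fun p q hp hq => kernel_dataWeight_le hb₁ hb hp hq)
  refine ⟨integrable_gain h3, (integral_abs_gain_le h3 hκ.le).trans ?_⟩
  refine (mul_le_mul_of_nonneg_left h4 (by positivity)).trans_eq ?_
  rw [gainConst]; ring

/-- The gain term on weighted densities. -/
def gainL (hκ : 0 < κ) (hb₁ : 1 < b) (hb : b < 2) (u : RadL) : RadL :=
  (integral_dataWeight_gain_le hκ hb₁ hb (aesm_den u) (aesm_den u) (integrable_dataWeight_den u)
    (integrable_dataWeight_den u)).1.toL1 _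

section GainL
variable (hκ : 0 < κ) (hb₁ : 1 < b) (hb : b < 2)

lemma coe_gainL (u : RadL) :
    gainL hκ hb₁ hb u =ᵐ[radVol] fun r => dataWeight r * gain κ b (den u) (den u) r := Integrable.coeFn_toL1 (integral_dataWeight_gain_le hκ hb₁ hb (aesm_den u) (aesm_den u) (integrable_dataWeight_den u)
    (integrable_dataWeight_den u)).1

lemma norm_gainL_le (u : RadL) : ‖gainL hκ hb₁ hb u‖ ≤ gainConst κ b * ‖u‖ ^ 2 := by
  have h := (integral_dataWeight_gain_le hκ hb₁ hb (aesm_den u) (aesm_den u) (integrable_dataWeight_den u)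
    (integrable_dataWeight_den u)).2
  rw [integral_dataWeight_abs_den] at h
  rw [RadL.norm_eq]
  calc _ = _ := integral_congr_ae (by filter_upwards [coe_gainL hκ hb₁ hb u] with r hr; rw [hr])
    _ ≤ _ := h
    _ = _ := by ring

lemma gainL_nonneg {u : RadL} (hu : 0 ≤ u) : 0 ≤ gainL hκ hb₁ hb u := by
  have h0 : den u =ᵐ[radVol] fun r => max (den u r) 0 := by
    filter_upwards [den_nonneg hu] with r hr
    rw [max_eq_left hr]
  rw [RadL.nonneg_iff]
  filter_upwards [coe_gainL hκ hb₁ hb u, ae_radVol_pos, gain_congr (b := b) h0 h0] with r h1 hr h2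
  rw [h1, gain, integral_congr_ae h2]
  refine mul_nonneg (dataWeight_nonneg r hr) (mul_nonneg (by positivity) (integral_nonneg fun z => ?_))
  exact mul_nonneg (NNReal.coe_nonneg _) (mul_nonneg (div_nonneg (le_max_right _ _) (sq_nonneg _))
    (div_nonneg (le_max_right _ _) (sq_nonneg _)))

lemma norm_gainL_sub_le (u v : RadL) :
    ‖gainL hκ hb₁ hb u - gainL hκ hb₁ hb v‖ ≤ gainConst κ b * (‖u‖ + ‖v‖) * ‖u - v‖ := by
  set d : ℝ → ℝ := fun r => den u r - den v r
  have hd := den_sub u v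
  have hdi : Integrable (fun r => dataWeight r * d r) radVol := by
    refine (integrable_dataWeight_den (u - v)).congr ?_
    filter_upwards [hd] with r hr; rw [hr]
  have hdn : ∫ r, dataWeight r * |d r| ∂radVol = ‖u - v‖ := by
    rw [← integral_dataWeight_abs_den]
    refine integral_congr_ae ?_
    filter_upwards [hd] with r hr; rw [hr]
  have hdm : AEStronglyMeasurable d radVol := (aesm_den u).sub (aesm_den v)
  obtain ⟨h1, h1'⟩ := integral_dataWeight_gain_le hκ hb₁ hb (aesm_den u) hdm (integrable_dataWeight_den u) hdi
  obtain ⟨h2, h2'⟩ := integral_dataWeight_gain_le hκ hb₁ hb hdm (aesm_den v) hdi (integrable_dataWeight_den v)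
  rw [integral_dataWeight_abs_den, hdn] at h1' h2'
  rw [RadL.norm_eq]
  calc ∫ r, |(gainL hκ hb₁ hb u - gainL hκ hb₁ hb v : RadL) r| ∂radVol
      ≤ ∫ r, (|dataWeight r * gain κ b (den u) d r| + |dataWeight r * gain κ b d (den v) r|) ∂radVol := by
        refine integral_mono_ae (gainL hκ hb₁ hb u - gainL hκ hb₁ hb v).integrable.abs (h1.abs.add h2.abs) ?_
        filter_upwards [Lp.coeFn_sub (gainL hκ hb₁ hb u) (gainL hκ hb₁ hb v), coe_gainL hκ hb₁ hb u,
          coe_gainL hκ hb₁ hb v, gain_sub (κ := κ) hb (aesm_den u) (aesm_den v)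
          (integrable_rpow_den u (s := -(b / 2)) (by linarith) (by linarith))
          (integrable_rpow_den v (s := -(b / 2)) (by linarith) (by linarith))] with r e1 e2 e3 e4
        rw [e1, Pi.sub_apply, e2, e3, ← mul_sub, e4, mul_add]
        exact abs_add_le _ _
    _ = _ := integral_add h1.abs h2.abs
    _ ≤ _ := add_le_add h1' h2'
    _ = _ := by ring

lemma continuous_gainL : Continuous (gainL hκ hb₁ hb) := by
  refine continuous_iff_continuousAt.2 fun v => ?_
  rw [ContinuousAt, tendsto_iff_norm_sub_tendsto_zero]
  refine squeeze_zero (fun _ => norm_nonneg _) (fun u => norm_gainL_sub_le hκ hb₁ hb u v) ?_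
  have : Continuous fun u : RadL => gainConst κ b * (‖u‖ + ‖v‖) * ‖u - v‖ := by fun_prop
  simpa using this.tendsto v

end GainL

end

/-! ### Local existence -/

section

variable {κ b : ℝ}

lemma collRad_congr {n m : ℝ → ℝ} (h : n =ᵐ[radVol] m) : collRad κ b n =ᵐ[radVol] collRad κ b m := by
  have h1 : mom (-(b / 2)) n = mom (-(b / 2)) m := integral_congr_ae (by filter_upwards [h] with r hr; rw [hr])
  filter_upwards [h, gain_congr (b := b) h h] with r hr h2
  rw [collRad, collRad, gain, gain, integral_congr_ae h2, hr, h1]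

lemma lossSemi_nonneg {θ : ℝ} {x : RadL} (hx : 0 ≤ x) : 0 ≤ lossSemi b θ x := by
  rw [RadL.nonneg_iff] at *
  filter_upwards [coe_mulL (isBddWeight_exp b θ) x, hx] with r h1 h2
  rw [lossSemi, h1]; positivity

lemma lossSemi_anti {θ θ' : ℝ} (hθ : 0 ≤ θ) (h : θ ≤ θ') {x : RadL} (hx : 0 ≤ x) :
    lossSemi b θ' x ≤ lossSemi b θ x := by
  rw [RadL.nonneg_iff] at hx
  rw [← Lp.coeFn_le]
  filter_upwards [coe_lossSemi (b := b) hθ x, coe_lossSemi (b := b) (hθ.trans h) x, hx, ae_radVol_pos] with r h1 h2 h3 hr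
  rw [h1, h2]
  gcongr

lemma lossSemi_ne_zero {θ : ℝ} {x : RadL} (hx : x ≠ 0) : lossSemi b θ x ≠ 0 := by
  refine fun h => hx (Lp.ext ?_)
  have h1 := coe_mulL (isBddWeight_exp b θ) x
  change lossSemi b θ x =ᵐ[radVol] _ at h1
  rw [h] at h1
  filter_upwards [h1, Lp.coeFn_zero ℝ 1 radVol] with r h1 h2
  rw [h2, Pi.zero_apply, eq_comm, mul_eq_zero] at h1
  rw [h2]
  exact h1.resolve_left (Real.exp_pos _).ne'

/-- The gain term, normalised by the loss rate. -/
def normGain (hκ : 0 < κ) (hb₁ : 1 < b) (hb : b < 2) (m₀ : ℝ) (u : RadL) : RadL :=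
  (lossConst κ b * max (momL hb₁ hb u) m₀)⁻¹ • gainL hκ hb₁ hb u

section NormGain
variable (hκ : 0 < κ) (hb₁ : 1 < b) (hb : b < 2) {m₀ : ℝ}

/-- The cut-off at `m₀` keeps the divisor away from zero for every `u`, so the map is globally
continuous. On the solution constructed below the cut-off is inactive. -/
lemma continuous_normGain (hm₀ : 0 < m₀) : Continuous (normGain hκ hb₁ hb m₀) := by
  have ha := lossConst_pos hκ hb
  have h1 : Continuous fun u => (lossConst κ b * max (momL hb₁ hb u) m₀)⁻¹ := by
    refine Continuous.inv₀ (by fun_prop) fun u => ?_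
    have := le_max_right (momL hb₁ hb u) m₀
    have : 0 < max (momL hb₁ hb u) m₀ := hm₀.trans_le this
    positivity
  exact h1.smul (continuous_gainL hκ hb₁ hb)

lemma normGain_nonneg (hm₀ : 0 < m₀) {u : RadL} (hu : 0 ≤ u) : 0 ≤ normGain hκ hb₁ hb m₀ u := by
  have ha := lossConst_pos hκ hb
  have : 0 ≤ max (momL hb₁ hb u) m₀ := hm₀.le.trans (le_max_right _ _)
  exact RadL.smul_nonneg (by positivity) (gainL_nonneg hκ hb₁ hb hu)

lemma inv_mul_max_le {a x m : ℝ} (ha : 0 < a) (hm : 0 < m) : (a * max x m)⁻¹ ≤ (a * m)⁻¹ := by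
  have := le_max_right x m
  gcongr

lemma norm_normGain_le (hm₀ : 0 < m₀) {u : RadL} {R : ℝ} (hu : ‖u‖ ≤ R) :
    ‖normGain hκ hb₁ hb m₀ u‖ ≤ (lossConst κ b * m₀)⁻¹ * (gainConst κ b * R ^ 2) := by
  have ha := lossConst_pos hκ hb
  have hg := gainConst_pos hκ hb
  have h0 : 0 ≤ max (momL hb₁ hb u) m₀ := hm₀.le.trans (le_max_right _ _)
  rw [normGain, norm_smul, Real.norm_of_nonneg (by positivity)]
  refine mul_le_mul (inv_mul_max_le ha hm₀) ((norm_gainL_le hκ hb₁ hb u).trans ?_) (norm_nonneg _) (by positivity)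
  gcongr

lemma norm_normGain_sub_le (hm₀ : 0 < m₀) {u v : RadL} {R : ℝ} (hu : ‖u‖ ≤ R) (hv : ‖v‖ ≤ R) :
    ‖normGain hκ hb₁ hb m₀ u - normGain hκ hb₁ hb m₀ v‖ ≤ ((lossConst κ b * m₀ ^ 2)⁻¹ * (gainConst κ b * R ^ 2) +
      (lossConst κ b * m₀)⁻¹ * (gainConst κ b * (R + R))) * ‖u - v‖ := by
  have ha := lossConst_pos hκ hb
  have hg := gainConst_pos hκ hb
  set a := lossConst κ b
  set x := max (momL hb₁ hb u) m₀
  set y := max (momL hb₁ hb v) m₀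
  have hx : m₀ ≤ x := le_max_right _ _
  have hy : m₀ ≤ y := le_max_right _ _
  have hx0 : 0 < x := hm₀.trans_le hx
  have hy0 : 0 < y := hm₀.trans_le hy
  have hxy : |y - x| ≤ ‖u - v‖ := by
    rw [abs_sub_comm]
    refine (abs_max_sub_max_le_abs _ _ _).trans ?_
    rw [← map_sub]; exact abs_momL_le hb₁ hb _
  have hinv : |(a * x)⁻¹ - (a * y)⁻¹| ≤ (a * m₀ ^ 2)⁻¹ * ‖u - v‖ := by
    have e : (a * x)⁻¹ - (a * y)⁻¹ = (a * (x * y))⁻¹ * (y - x) := by field_simp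
    rw [e, abs_mul, abs_of_nonneg (by positivity), sq]
    gcongr
  have e : normGain hκ hb₁ hb m₀ u - normGain hκ hb₁ hb m₀ v =
      ((a * x)⁻¹ - (a * y)⁻¹) • gainL hκ hb₁ hb u + (a * y)⁻¹ • (gainL hκ hb₁ hb u - gainL hκ hb₁ hb v) := by
    simp only [normGain]
    module
  rw [e]
  refine (norm_add_le _ _).trans ?_
  rw [norm_smul, norm_smul, Real.norm_eq_abs, Real.norm_of_nonneg (by positivity : 0 ≤ (a * y)⁻¹), add_mul]
  have hR : 0 ≤ R := (norm_nonneg u).trans hu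
  refine add_le_add ?_ ?_
  · calc _ ≤ ((a * m₀ ^ 2)⁻¹ * ‖u - v‖) * (gainConst κ b * R ^ 2) := by
          refine mul_le_mul hinv ((norm_gainL_le hκ hb₁ hb u).trans ?_) (norm_nonneg _) (by positivity)
          gcongr
      _ = _ := by ring
  · calc _ ≤ (a * m₀)⁻¹ * (gainConst κ b * (R + R) * ‖u - v‖) := by
          refine mul_le_mul (by gcongr) ((norm_gainL_sub_le hκ hb₁ hb u v).trans ?_) (norm_nonneg _) (by positivity)
          gcongr
      _ = _ := by ring

/-- Local existence for the normalised mild equation. -/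
lemma exists_mild_solution {u₀ : RadL} (h0 : 0 ≤ u₀) (hne : u₀ ≠ 0) :
    ∃ (Θ m₀ : ℝ) (u : ℝ → RadL), 0 < Θ ∧ 0 < m₀ ∧ Continuous u ∧ u 0 = u₀ ∧
      (∀ θ, 0 ≤ u θ ∧ m₀ ≤ momL hb₁ hb (u θ) ∧ ‖u θ‖ ≤ 2 * ‖u₀‖) ∧
      ∀ θ ∈ Icc 0 Θ, u θ = duhamel (lossSemi b) u₀ (fun τ => normGain hκ hb₁ hb m₀ (u τ)) θ := by
  set R := ‖u₀‖
  have hR : 0 < R := norm_pos_iff.2 hne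
  -- A lower barrier: the gain term is nonnegative, so up to `θ = 1` Duhamel's formula stays above
  -- the pure decay of the data. Its moment `m₀` is a positive lower bound for the loss functional.
  set v := lossSemi b 1 u₀
  have hv0 : 0 ≤ v := lossSemi_nonneg h0
  set m₀ := momL hb₁ hb v
  have hm₀ : 0 < m₀ := momL_pos hb₁ hb hv0 (lossSemi_ne_zero hne)
  have ha := lossConst_pos hκ hb
  have hg := gainConst_pos hκ hb
  set P := (lossConst κ b * m₀)⁻¹ * (gainConst κ b * (2 * R) ^ 2)
  set K := (lossConst κ b * m₀ ^ 2)⁻¹ * (gainConst κ b * (2 * R) ^ 2) +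
      (lossConst κ b * m₀)⁻¹ * (gainConst κ b * (2 * R + 2 * R))
  have hP : 0 < P := by positivity
  have hK : 0 < K := by positivity
  set X : Set RadL := Ici v ∩ {x | ‖x‖ ≤ 2 * R}
  have hX : IsClosed X := isClosed_Ici.inter (isClosed_le continuous_norm continuous_const)
  have hX0 : ∀ x ∈ X, 0 ≤ x := fun x hx => hv0.trans hx.1
  -- The three entries keep the path above the barrier, keep its norm below `2R`, and make the
  -- Duhamel map a contraction.
  set Θ := min 1 (min (R / P) (1 / (2 * K)))
  have hΘ : 0 < Θ := by positivity
  have hΘ1 : Θ ≤ 1 := min_le_left _ _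
  have hΘP : Θ * P ≤ R := (le_div_iff₀ hP).1 ((min_le_right _ _).trans (min_le_left _ _))
  have hΘK : K * Θ < 1 := by
    have : Θ ≤ 1 / (2 * K) := (min_le_right _ _).trans (min_le_right _ _)
    rw [le_div_iff₀ (by positivity)] at this
    linarith
  have hN := continuous_normGain hκ hb₁ hb hm₀
  have hu₀ : u₀ ∈ X := ⟨(lossSemi_anti le_rfl zero_le_one h0).trans_eq (lossSemi_zero u₀), by
    change ‖u₀‖ ≤ 2 * R; linarith⟩
  have hinv : ∀ y : ℝ → RadL, Continuous y → (∀ τ, y τ ∈ normGain hκ hb₁ hb m₀ '' X) → ∀ θ ∈ Icc 0 Θ,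
      duhamel (lossSemi b) u₀ y θ ∈ X := by
    intro y hy hyN θ hθ
    have hy0 : ∀ τ, 0 ≤ y τ := by
      intro τ; obtain ⟨x, hx, hxy⟩ := hyN τ
      rw [← hxy]; exact normGain_nonneg hκ hb₁ hb hm₀ (hX0 x hx)
    have hyP : ∀ τ, ‖y τ‖ ≤ P := by
      intro τ; obtain ⟨x, hx, hxy⟩ := hyN τ
      rw [← hxy]; exact norm_normGain_le hκ hb₁ hb hm₀ hx.2
    constructor
    · refine (lossSemi_anti hθ.1 (hθ.2.trans hΘ1) h0).trans ?_
      refine le_add_of_nonneg_right ?_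
      rw [intervalIntegral.integral_of_le hθ.1]
      exact integral_nonneg fun τ => lossSemi_nonneg (hy0 τ)
    · refine (norm_add_le _ _).trans ?_
      have h1 : ‖lossSemi b θ u₀‖ ≤ R := norm_lossSemi_le θ u₀
      have h2 := intervalIntegral.norm_integral_le_of_norm_le_const (a := 0) (b := θ)
        (f := fun τ => lossSemi b (θ - τ) (y τ)) (C := P) fun τ _ => (norm_lossSemi_le _ _).trans (hyP τ)
      rw [sub_zero, abs_of_nonneg hθ.1] at h2
      have : P * θ ≤ Θ * P := by rw [mul_comm]; gcongr; exact hθ.2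
      linarith
  obtain ⟨u, hu, huX, hud⟩ := exists_eq_duhamel (S := lossSemi b) continuous_lossSemi norm_lossSemi_le hN hX
    hu₀ hΘ.le hK.le hΘK (fun x hx y hy => norm_normGain_sub_le hκ hb₁ hb hm₀ hx.2 hy.2) hinv
  refine ⟨Θ, m₀, u, hΘ, hm₀, hu, ?_, fun θ => ⟨hX0 _ (huX θ), momL_mono hb₁ hb (huX θ).1, (huX θ).2⟩, hud⟩
  rw [hud 0 ⟨le_rfl, hΘ.le⟩, duhamel, intervalIntegral.integral_same, add_zero, lossSemi_zero]

end NormGain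

/-- Change of the time variable by integration of a positive rate. -/
lemma exists_time_change {β : ℝ → ℝ} (hβ : Continuous β) {c : ℝ} (hc : 0 < c) (hβc : ∀ x, c ≤ β x) {Θ : ℝ} (hΘ : 0 < Θ) :
    ∃ (T : ℝ) (t : ℝ → ℝ), 0 < T ∧ t 0 = 0 ∧ MapsTo t (Icc 0 T) (Icc 0 Θ) ∧ ∀ x, HasDerivAt t (β (t x))⁻¹ x := by
  set s : ℝ → ℝ := fun θ => ∫ τ in (0 : ℝ)..θ, β τ
  have hs : ∀ θ, HasDerivAt s (β θ) θ := fun θ => (hβ.integral_hasStrictDerivAt 0 θ).hasDerivAt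
  have hs0 : s 0 = 0 := intervalIntegral.integral_same
  have hsc : Continuous s := continuous_iff_continuousAt.2 fun x => (hs x).continuousAt
  have hmono : StrictMono s := strictMono_of_deriv_pos fun x => by
    rw [(hs x).deriv]; exact hc.trans_le (hβc x)
  -- `s` grows at least linearly in both directions, hence is a bijection of the line and its
  -- inverse is defined everywhere.
  have hm : Monotone fun θ => s θ - c * θ := by
    have hd : ∀ θ, HasDerivAt (fun θ => s θ - c * θ) (β θ - c * 1) θ := fun θ =>
      (hs θ).sub ((hasDerivAt_id' θ).const_mul c)
    refine monotone_of_deriv_nonneg (fun x => (hd x).differentiableAt) fun x => ?_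
    rw [(hd x).deriv]; linarith [hβc x]
  have htop : Tendsto s atTop atTop := by
    refine tendsto_atTop_mono' _ ?_ (tendsto_id.const_mul_atTop hc)
    filter_upwards [eventually_ge_atTop 0] with x hx
    have := hm hx
    simp only [hs0] at this
    simp only [id]; linarith
  have hbot : Tendsto s atBot atBot := by
    refine tendsto_atBot_mono' _ ?_ (tendsto_id.const_mul_atBot hc)
    filter_upwards [eventually_le_atBot 0] with x hx
    have := hm hx
    simp only [hs0] at this
    simp only [id]; linarith
  set iso := hmono.orderIsoOfSurjective s (hsc.surjective htop hbot)
  have his : ∀ x, s (iso.symm x) = x := fun x => iso.apply_symm_apply x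
  have hsi : ∀ x, iso.symm (s x) = x := fun x => iso.symm_apply_apply x
  refine ⟨s Θ, iso.symm, hs0 ▸ hmono hΘ, ?_, fun x hx => ⟨?_, ?_⟩, fun x => ?_⟩
  · conv_lhs => rw [← hs0]
    exact hsi 0
  · have := iso.symm.monotone hx.1
    rwa [← hs0, hsi] at this
  · have := iso.symm.monotone hx.2
    rwa [hsi] at this
  · exact HasDerivAt.of_local_left_inverse iso.symm.continuous.continuousAt (hs _)
      (hc.trans_le (hβc _)).ne' (.of_forall his)

lemma solWeight_le_two_mul_dataWeight {r : ℝ} (hr : 0 < r) : solWeight r ≤ 2 * dataWeight r := by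
  have h1 := rpow_le_dataWeight hr (s := -1) (by norm_num) (by norm_num)
  have h2 := rpow_le_dataWeight hr (s := 2) (by norm_num) (by norm_num)
  rw [solWeight]; linarith

/-- Local existence of radial solutions. -/
theorem exists_isRadSolution (hκ : 0 < κ) (hb₁ : 1 < b) (hb : b < 2) {u₀ : RadL} (h0 : 0 ≤ u₀) (hne : u₀ ≠ 0) :
    ∃ (T : ℝ) (n : ℝ → RadL), 0 < T ∧ IsRadSolution κ b T n ∧ n 0 = denL u₀ := by
  obtain ⟨Θ, m₀, u, hΘ, hm₀, hu, hu0, hux, hud⟩ := exists_mild_solution hκ hb₁ hb h0 hne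
  set a := lossConst κ b
  have ha : 0 < a := lossConst_pos hκ hb
  have hR : 0 < ‖u₀‖ := norm_pos_iff.2 hne
  have hMpos : ∀ θ, 0 < momL hb₁ hb (u θ) := fun θ => hm₀.trans_le (hux θ).2.1
  -- The rate `ds/dθ`. In the time `θ` the loss coefficient is exactly `r^(-b/2)`; returning to `s`
  -- multiplies the equation by the loss rate and cancels the divisor in `normGain`.
  set β : ℝ → ℝ := fun θ => (a * momL hb₁ hb (u θ))⁻¹
  have hβ : Continuous β := Continuous.inv₀ (by fun_prop) fun θ => (mul_pos ha (hMpos θ)).ne'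
  have hβc : ∀ θ, (a * (2 * ‖u₀‖))⁻¹ ≤ β θ := by
    intro θ
    have := hMpos θ
    have := (le_abs_self _).trans ((abs_momL_le hb₁ hb (u θ)).trans (hux θ).2.2)
    simp only [β]; gcongr
  obtain ⟨T, t, hT, ht0, htm, htd⟩ := exists_time_change hβ (by positivity) hβc hΘ
  have htc : Continuous t := continuous_iff_continuousAt.2 fun x => (htd x).continuousAt
  have hNc := (continuous_normGain hκ hb₁ hb hm₀).comp hu
  have hder := hasDerivWithinAt_of_eq_duhamel continuous_lossSemi lossSemi_zero lossSemi_add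
    (norm_denL_lossSemi_sub_le hb₁ hb) hu hNc hud
  have hcoe : ∀ θ, denL (u θ) =ᵐ[radVol] den (u θ) := fun θ => coe_denL (u θ)
  refine ⟨T, fun x => denL (u (t x)), hT, ⟨fun x _ => ?_, ⟨4 * ‖u₀‖, fun x _ => ?_⟩,
    fun x => (β (t x))⁻¹ • (lossL hb₁ hb (u (t x)) + denL (normGain hκ hb₁ hb m₀ (u (t x)))), ?_, fun x hx => ⟨?_, ?_⟩⟩, ?_⟩
  · rw [RadL.nonneg_iff]
    filter_upwards [hcoe (t x), den_nonneg (hux (t x)).1] with r h1 h2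
    rw [h1]; exact h2
  · set v := u (t x)
    have h1 : Integrable (fun r => dataWeight r * denL v r) radVol := by
      refine (integrable_dataWeight_den v).congr ?_
      filter_upwards [hcoe (t x)] with r hr; rw [hr]
    have h2 : Integrable (fun r => solWeight r * denL v r) radVol :=
      integrable_mul_of_le measurable_solWeight (denL v).aesm h1 solWeight_nonneg
        fun r hr => solWeight_le_two_mul_dataWeight hr
    refine ⟨h2, ?_⟩
    have h3 := integral_dataWeight_abs_den v
    calc ∫ r, solWeight r * denL v r ∂radVol ≤ ∫ r, 2 * (dataWeight r * denL v r) ∂radVol := by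
          refine integral_mono_ae h2 (h1.const_mul 2) ?_
          filter_upwards [ae_radVol_pos, hcoe (t x), den_nonneg (hux (t x)).1] with r hr e1 e2
          rw [e1, ← mul_assoc]
          exact mul_le_mul_of_nonneg_right (solWeight_le_two_mul_dataWeight hr) e2
      _ = 2 * ‖v‖ := by
          rw [integral_const_mul, ← h3]
          congr 1
          refine integral_congr_ae ?_
          filter_upwards [hcoe (t x), den_nonneg (hux (t x)).1] with r e1 e2
          rw [e1, abs_of_nonneg e2]
      _ ≤ 4 * ‖u₀‖ := by linarith [(hux (t x)).2.2]
  · have h1 : Continuous fun x => (β (t x))⁻¹ :=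
      (hβ.comp htc).inv₀ fun x => (inv_pos.2 (mul_pos ha (hMpos _))).ne'
    have h2 : Continuous fun x => lossL hb₁ hb (u (t x)) + denL (normGain hκ hb₁ hb m₀ (u (t x))) :=
      ((lossL hb₁ hb).continuous.comp (hu.comp htc)).add (denL.continuous.comp (hNc.comp htc))
    exact (h1.smul h2).continuousOn
  · exact HasDerivWithinAt.scomp x (hder (t x) (htm hx)) (htd x).hasDerivWithinAt htm
  · set v := u (t x)
    have hM : max (momL hb₁ hb v) m₀ = momL hb₁ hb v := max_eq_left (hux (t x)).2.1
    have hMp := hMpos (t x)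
    refine EventuallyEq.trans ?_ (collRad_congr (hcoe (t x))).symm
    filter_upwards [Lp.coeFn_smul (β (t x))⁻¹ (lossL hb₁ hb v + denL (normGain hκ hb₁ hb m₀ v)),
      Lp.coeFn_add (lossL hb₁ hb v) (denL (normGain hκ hb₁ hb m₀ v)), coe_lossL hb₁ hb v,
      coe_denL (normGain hκ hb₁ hb m₀ v), Lp.coeFn_smul (lossConst κ b * max (momL hb₁ hb v) m₀)⁻¹ (gainL hκ hb₁ hb v),
      coe_gainL hκ hb₁ hb v, ae_radVol_pos] with r e1 e2 e3 e4 e5 e6 hr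
    have e7 : normGain hκ hb₁ hb m₀ v = (lossConst κ b * max (momL hb₁ hb v) m₀)⁻¹ • gainL hκ hb₁ hb v := rfl
    have e8 : den (normGain hκ hb₁ hb m₀ v) r = normGain hκ hb₁ hb m₀ v r / dataWeight r := rfl
    have hw := (dataWeight_pos hr).ne'
    rw [e1, Pi.smul_apply, e2, Pi.add_apply, e3, e4, e8, e7, e5, Pi.smul_apply, e6, hM, collRad, ← momL_apply hb₁ hb v]
    simp only [β, smul_eq_mul]
    change ((a * momL hb₁ hb v)⁻¹)⁻¹ * (_ + (a * momL hb₁ hb v)⁻¹ * _ / _) = _ - a * momL hb₁ hb v * _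
    have hMn := hMp.ne'
    change momL hb₁ hb v ≠ 0 at hMn
    field_simp
    ring
  · simp only [ht0, hu0]

end

/-! ### Local existence, uniqueness and energy for isotropic data -/

section

variable {κ b : ℝ}

lemma IsData.exists_radEmb {f₀ : L1} (h : IsData f₀) : ∃ n₀ : RadL, 0 ≤ n₀ ∧ n₀ ≠ 0 ∧ radEmb n₀ = f₀ ∧
    ∀ m : ℝ, -2 ≤ m → m ≤ 2 → Integrable (fun r => r ^ m * n₀ r) radVol := by
  obtain ⟨n₀, hn, he⟩ := exists_radEmb_eq h.isotropic h.nonneg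
  refine ⟨n₀, hn, ?_, he, fun m h₁ h₂ => ?_⟩
  · rintro rfl
    exact h.ne_zero (by rw [← he, map_zero])
  · have := h.moments m h₁ h₂
    rw [← he] at this
    exact (integrable_radEmb_mul (w := fun r => r ^ m)).1 this

/-- Local existence. -/
theorem IsData.exists_existsUpTo {f₀ : L1} (h : IsData f₀) (hκ : 0 < κ) (hb₁ : 1 < b) (hb : b < 2) :
    ∃ T : ℝ, 0 < T ∧ ExistsUpTo κ b f₀ T := by
  obtain ⟨n₀, h0, hne, he, hm⟩ := h.exists_radEmb
  have hi : Integrable (fun r => dataWeight r * n₀ r) radVol := by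
    simp only [dataWeight, add_mul]
    exact (hm (-2) le_rfl (by norm_num)).add (hm 2 (by norm_num) le_rfl)
  set u₀ : RadL := hi.toL1 _
  have hu : u₀ =ᵐ[radVol] fun r => dataWeight r * n₀ r := hi.coeFn_toL1
  have hden : denL u₀ = n₀ := by
    refine Lp.ext ?_
    filter_upwards [coe_denL u₀, hu, ae_radVol_pos] with r h1 h2 hr
    rw [h1, den, h2, mul_div_cancel_left₀ _ (dataWeight_pos hr).ne']
  have hu0 : 0 ≤ u₀ := by
    rw [RadL.nonneg_iff]
    filter_upwards [hu, ae_radVol_pos, RadL.nonneg_iff.1 h0] with r h1 hr h2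
    rw [h1]; exact mul_nonneg (dataWeight_nonneg r hr) h2
  have hune : u₀ ≠ 0 := by
    intro h; rw [h, map_zero] at hden; exact hne hden.symm
  obtain ⟨T, n, hT, hn, hn0⟩ := exists_isRadSolution hκ hb₁ hb hu0 hune
  refine ⟨T, hT, fun s => radEmb (n s), ?_⟩
  have := hn.isSolution hb₁ hb
  rwa [hn0, hden, he] at this

/-- Solutions are determined by their data. -/
theorem IsSolution.eqOn {T : ℝ} {f₀ : L1} (h : IsData f₀) (hκ : 0 < κ) (hb₁ : 1 < b) (hb : b < 2) {f g : ℝ → L1}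
    (hf : IsSolution κ b T f₀ f) (hg : IsSolution κ b T f₀ g) : EqOn f g (Icc 0 T) := by
  intro s hs
  have h0T : (0 : ℝ) ∈ Icc 0 T := ⟨le_rfl, hs.1.trans hs.2⟩
  obtain ⟨n₀, h0, hne, he, hm⟩ := h.exists_radEmb
  obtain ⟨n, hn, hnf⟩ := hf.exists_isRadSolution hb₁ hb
  obtain ⟨m, hm', hmg⟩ := hg.exists_isRadSolution hb₁ hb
  have e1 : n 0 = n₀ := radEmb_injective (by rw [hnf 0 h0T, hf.init, he])
  have e2 : m 0 = n₀ := radEmb_injective (by rw [hmg 0 h0T, hg.init, he])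
  have := hn.eqOn hκ hb₁ hb hm' (e1.trans e2.symm) (e1 ▸ hne) (e1 ▸ hm (-2) le_rfl (by norm_num)) hs
  rw [← hnf s hs, ← hmg s hs, this]

lemma energy_radEmb (n : RadL) : energy (radEmb n) = 4 * Real.pi * mom 1 n := by
  rw [energy, mom, ← integral_radEmb_mul]
  refine integral_congr_ae (.of_forall fun p => ?_)
  simp only [Real.rpow_one]; ring

/-- Conservation of energy. -/
theorem IsSolution.energy_eq {T : ℝ} {f₀ : L1} (hκ : 0 < κ) (hb₁ : 1 < b) (hb : b < 2) {f : ℝ → L1}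
    (hf : IsSolution κ b T f₀ f) {s : ℝ} (hs : s ∈ Icc 0 T) : energy (f s) = energy f₀ := by
  have h0T : (0 : ℝ) ∈ Icc 0 T := ⟨le_rfl, hs.1.trans hs.2⟩
  obtain ⟨n, hn, hnf⟩ := hf.exists_isRadSolution hb₁ hb
  rw [← hf.init, ← hnf s hs, ← hnf 0 h0T, energy_radEmb, energy_radEmb, hn.mom_one_eq hκ hb₁ hb hs]

lemma IsData.energy_pos {f₀ : L1} (h : IsData f₀) : 0 < energy f₀ := by
  obtain ⟨n₀, h0, hne, he, hm⟩ := h.exists_radEmb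
  have hi := hm 1 (by norm_num) (by norm_num)
  rw [← he, energy_radEmb]
  refine mul_pos (by positivity) (lt_of_le_of_ne (mom_nonneg h0 1) fun h1 => hne ?_)
  have hnn : 0 ≤ᵐ[radVol] fun r => r ^ (1 : ℝ) * n₀ r := by
    filter_upwards [ae_radVol_pos, RadL.nonneg_iff.1 h0] with r h1 h2
    exact mul_nonneg (Real.rpow_nonneg h1.le _) h2
  rw [eq_comm, mom, integral_eq_zero_iff_of_nonneg_ae hnn hi] at h1
  refine Lp.ext ?_
  filter_upwards [h1, ae_radVol_pos, Lp.coeFn_zero ℝ 1 radVol] with r h1 hr h2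
  rw [h2]
  simpa [hr.ne'] using h1

lemma IsData.smul {f₀ : L1} (h : IsData f₀) {lam : ℝ} (hl : 0 < lam) : IsData (lam • f₀) where
  nonneg := by
    have h0 := h.nonneg
    rw [← Lp.coeFn_nonneg] at *
    filter_upwards [h0, Lp.coeFn_smul lam f₀] with p h1 h2
    rw [h2]; exact mul_nonneg hl.le h1
  ne_zero := smul_ne_zero hl.ne' h.ne_zero
  isotropic := by
    obtain ⟨φ, hφ, hp⟩ := h.isotropic
    refine ⟨fun r => lam * φ r, hφ.const_mul _, ?_⟩
    filter_upwards [hp, Lp.coeFn_smul lam f₀] with p h1 h2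
    rw [h2, Pi.smul_apply, h1, smul_eq_mul]
  moments m h₁ h₂ := by
    refine ((h.moments m h₁ h₂).const_mul lam).congr ?_
    filter_upwards [Lp.coeFn_smul lam f₀] with p h2
    rw [h2, Pi.smul_apply, smul_eq_mul, mul_assoc]

lemma energy_smul (lam : ℝ) (f : L1) : energy (lam • f) = lam * energy f := by
  rw [energy, energy, ← integral_const_mul]
  refine integral_congr_ae ?_
  filter_upwards [Lp.coeFn_smul lam f] with p h
  rw [h, Pi.smul_apply, smul_eq_mul]; ring

end

/-! ### The scale factor, the time `s` and the Einstein equations -/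

section

variable {Λ b : ℝ} {f₀ : L1}

lemma hubble_pos (hΛ : 0 < Λ) : 0 < hubble Λ := Real.sqrt_pos.2 (by positivity)

lemma hubble_sq (hΛ : 0 < Λ) : hubble Λ ^ 2 = Λ / 3 := Real.sq_sqrt (by positivity)

lemma scaleConst_pos (hΛ : 0 < Λ) (hE : 0 < energy f₀) : 0 < scaleConst Λ f₀ := by
  have := hubble_pos hΛ
  unfold scaleConst; positivity

lemma scaleConst_pow_four (hΛ : 0 < Λ) (hE : 0 < energy f₀) :
    scaleConst Λ f₀ ^ 4 = 8 * Real.pi / (3 * hubble Λ ^ 2) * energy f₀ := by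
  have := hubble_pos hΛ
  rw [scaleConst, ← Real.rpow_natCast, ← Real.rpow_mul (by positivity)]
  norm_num

lemma continuous_scaleFactor : Continuous (scaleFactor Λ f₀) := by unfold scaleFactor; fun_prop

lemma sinh_pos_of_pos (hΛ : 0 < Λ) {t : ℝ} (ht : 0 < t) : 0 < Real.sinh (2 * hubble Λ * t) := by
  have := hubble_pos hΛ
  exact Real.sinh_pos_iff.2 (by positivity)

lemma scaleFactor_pos (hΛ : 0 < Λ) (hE : 0 < energy f₀) {t : ℝ} (ht : 0 < t) : 0 < scaleFactor Λ f₀ t :=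
  mul_pos (scaleConst_pos hΛ hE) (Real.sqrt_pos.2 (sinh_pos_of_pos hΛ ht))

lemma scaleFactor_of_nonpos (hΛ : 0 < Λ) {t : ℝ} (ht : t ≤ 0) : scaleFactor Λ f₀ t = 0 := by
  have := hubble_pos hΛ
  rw [scaleFactor, Real.sqrt_eq_zero_of_nonpos, mul_zero]
  rw [Real.sinh_nonpos_iff]
  exact mul_nonpos_of_nonneg_of_nonpos (by positivity) ht

/-- The first bound is `sinh x ≥ x` and controls the singularity; the second follows from `sinh 2x =
2 sinh x cosh x ≥ x²` and controls late times. Linear growth suffices there, because `b - 3 < -1`.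
-/
lemma le_scaleFactor (hΛ : 0 < Λ) (hE : 0 < energy f₀) {t : ℝ} (ht : 0 < t) :
    scaleConst Λ f₀ * (2 * hubble Λ) ^ (1 / 2 : ℝ) * t ^ (1 / 2 : ℝ) ≤ scaleFactor Λ f₀ t ∧
    scaleConst Λ f₀ * hubble Λ * t ≤ scaleFactor Λ f₀ t := by
  have hH := hubble_pos hΛ
  have hC := scaleConst_pos hΛ hE
  constructor
  · rw [mul_assoc, ← Real.mul_rpow (by positivity) ht.le, ← Real.sqrt_eq_rpow, scaleFactor]
    gcongr
    exact Real.self_le_sinh_iff.2 (by positivity)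
  · rw [mul_assoc, scaleFactor]
    gcongr
    refine Real.le_sqrt_of_sq_le ?_
    rw [mul_assoc, Real.sinh_two_mul]
    have h1 : hubble Λ * t ≤ Real.sinh (hubble Λ * t) := Real.self_le_sinh_iff.2 (by positivity)
    have h2 := (Real.sinh_lt_cosh (hubble Λ * t)).le
    have h3 : 0 < hubble Λ * t := by positivity
    nlinarith

lemma integrable_scaleFactor_rpow (hΛ : 0 < Λ) (hE : 0 < energy f₀) (hb₁ : 1 < b) (hb : b < 2) :
    Integrable fun t => scaleFactor Λ f₀ t ^ (b - 3) := by
  have hH := hubble_pos hΛ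
  have hC := scaleConst_pos hΛ hE
  have hm : AEStronglyMeasurable (fun t => scaleFactor Λ f₀ t ^ (b - 3)) volume := by
    have := continuous_scaleFactor (Λ := Λ) (f₀ := f₀)
    exact (this.measurable.pow_const _).aestronglyMeasurable
  have h1 : IntegrableOn (fun t => scaleFactor Λ f₀ t ^ (b - 3)) (Ioc 0 1) := by
    have hi : IntegrableOn (fun t : ℝ => t ^ ((b - 3) / 2)) (Ioc 0 1) :=
      (intervalIntegrable_iff_integrableOn_Ioc_of_le zero_le_one).1
        (intervalIntegral.intervalIntegrable_rpow' (by linarith))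
    refine (hi.const_mul ((scaleConst Λ f₀ * (2 * hubble Λ) ^ (1 / 2 : ℝ)) ^ (b - 3))).mono' hm.restrict ?_
    filter_upwards [ae_restrict_mem measurableSet_Ioc] with t ht
    have hR := scaleFactor_pos hΛ hE ht.1
    have ht0 := ht.1
    rw [Real.norm_of_nonneg (by positivity), show (b - 3) / 2 = 1 / 2 * (b - 3) by ring, Real.rpow_mul ht.1.le,
      ← Real.mul_rpow (by positivity) (by positivity)]
    exact Real.rpow_le_rpow_of_nonpos (by positivity) (le_scaleFactor hΛ hE ht.1).1 (by linarith)
  have h2 : IntegrableOn (fun t => scaleFactor Λ f₀ t ^ (b - 3)) (Ioi 1) := by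
    have hi : IntegrableOn (fun t : ℝ => t ^ (b - 3)) (Ioi 1) := integrableOn_Ioi_rpow_of_lt (by linarith) one_pos
    refine (hi.const_mul ((scaleConst Λ f₀ * hubble Λ) ^ (b - 3))).mono' hm.restrict ?_
    filter_upwards [ae_restrict_mem measurableSet_Ioi] with t ht
    have ht0 : 0 < t := one_pos.trans ht
    have hR := scaleFactor_pos hΛ hE ht0
    rw [Real.norm_of_nonneg (by positivity), ← Real.mul_rpow (by positivity) (by positivity)]
    exact Real.rpow_le_rpow_of_nonpos (by positivity) (le_scaleFactor hΛ hE ht0).2 (by linarith)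
  have h3 := h1.union h2
  rw [Ioc_union_Ioi_eq_Ioi zero_le_one] at h3
  -- For `t ≤ 0` the square root is `0` by default, and `0 ^ (b - 3) = 0`, so the integrand is
  -- supported in `t > 0` and integrable on the whole line.
  refine (integrableOn_iff_integrable_of_support_subset fun t ht => ?_).1 h3
  by_contra h
  rw [mem_Ioi, not_lt] at h
  exact ht (by simp only []; rw [scaleFactor_of_nonpos hΛ h, Real.zero_rpow (by linarith)])

lemma continuous_sTime (hΛ : 0 < Λ) (hE : 0 < energy f₀) (hb₁ : 1 < b) (hb : b < 2) :
    Continuous (sTime Λ b f₀) :=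
  intervalIntegral.continuous_primitive (fun _ _ => (integrable_scaleFactor_rpow hΛ hE hb₁ hb).intervalIntegrable) 0

lemma continuousAt_scaleFactor_rpow (hΛ : 0 < Λ) (hE : 0 < energy f₀) {t : ℝ} (ht : 0 < t) :
    ContinuousAt (fun t => scaleFactor Λ f₀ t ^ (b - 3)) t :=
  continuous_scaleFactor.continuousAt.rpow_const (Or.inl (scaleFactor_pos hΛ hE ht).ne')

lemma hasDerivAt_sTime (hΛ : 0 < Λ) (hE : 0 < energy f₀) (hb₁ : 1 < b) (hb : b < 2) {t : ℝ} (ht : 0 < t) :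
    HasDerivAt (sTime Λ b f₀) (scaleFactor Λ f₀ t ^ (b - 3)) t := by
  have hi := integrable_scaleFactor_rpow (f₀ := f₀) hΛ hE hb₁ hb
  exact intervalIntegral.integral_hasDerivAt_right hi.intervalIntegrable
    hi.aestronglyMeasurable.stronglyMeasurableAtFilter (continuousAt_scaleFactor_rpow hΛ hE ht)

lemma strictMonoOn_sTime (hΛ : 0 < Λ) (hE : 0 < energy f₀) (hb₁ : 1 < b) (hb : b < 2) :
    StrictMonoOn (sTime Λ b f₀) (Ici 0) := by
  refine strictMonoOn_of_deriv_pos (convex_Ici 0) (continuous_sTime hΛ hE hb₁ hb).continuousOn fun t ht => ?_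
  rw [interior_Ici] at ht
  rw [(hasDerivAt_sTime hΛ hE hb₁ hb ht).deriv]
  have := scaleFactor_pos hΛ hE ht
  positivity

lemma tendsto_sTime (hΛ : 0 < Λ) (hE : 0 < energy f₀) (hb₁ : 1 < b) (hb : b < 2) :
    Tendsto (sTime Λ b f₀) atTop (𝓝 (sInfinity Λ b f₀)) :=
  intervalIntegral_tendsto_integral_Ioi 0 (integrable_scaleFactor_rpow hΛ hE hb₁ hb).integrableOn tendsto_id

lemma sTime_zero : sTime Λ b f₀ 0 = 0 := intervalIntegral.integral_same

lemma sTime_nonneg (hΛ : 0 < Λ) (hE : 0 < energy f₀) (hb₁ : 1 < b) (hb : b < 2) {t : ℝ} (ht : 0 ≤ t) : 0 ≤ sTime Λ b f₀ t := by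
  have := (strictMonoOn_sTime hΛ hE hb₁ hb).monotoneOn self_mem_Ici (mem_Ici.2 ht) ht
  rwa [sTime_zero] at this

lemma sTime_lt_sInfinity (hΛ : 0 < Λ) (hE : 0 < energy f₀) (hb₁ : 1 < b) (hb : b < 2) {t : ℝ} (ht : 0 ≤ t) : sTime Λ b f₀ t < sInfinity Λ b f₀ := by
  have hm := strictMonoOn_sTime (f₀ := f₀) hΛ hE hb₁ hb
  have h1 : (0 : ℝ) ≤ t + 1 := by linarith
  refine (hm (mem_Ici.2 ht) (mem_Ici.2 h1) (by linarith)).trans_le (ge_of_tendsto (tendsto_sTime hΛ hE hb₁ hb) ?_)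
  filter_upwards [eventually_ge_atTop (t + 1)] with x hx
  exact hm.monotoneOn (mem_Ici.2 h1) (mem_Ici.2 (h1.trans hx)) hx

lemma sInfinity_pos (hΛ : 0 < Λ) (hE : 0 < energy f₀) (hb₁ : 1 < b) (hb : b < 2) :
    0 < sInfinity Λ b f₀ := by
  have := sTime_lt_sInfinity (f₀ := f₀) hΛ hE hb₁ hb le_rfl
  rwa [sTime_zero] at this

lemma image_sTime (hΛ : 0 < Λ) (hE : 0 < energy f₀) (hb₁ : 1 < b) (hb : b < 2) :
    sTime Λ b f₀ '' Ici 0 = Ico 0 (sInfinity Λ b f₀) := by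
  refine Subset.antisymm ?_ fun y hy => ?_
  · rintro _ ⟨t, ht, rfl⟩
    exact ⟨sTime_nonneg hΛ hE hb₁ hb ht, sTime_lt_sInfinity hΛ hE hb₁ hb ht⟩
  · obtain ⟨t, h1, h2⟩ := (((tendsto_sTime hΛ hE hb₁ hb).eventually (lt_mem_nhds hy.2)).and (eventually_ge_atTop 0)).exists
    obtain ⟨x, hx, hxy⟩ := intermediate_value_Icc h2 (continuous_sTime (f₀ := f₀) hΛ hE hb₁ hb).continuousOn
      (show y ∈ Icc _ _ from ⟨by rw [sTime_zero]; exact hy.1, h1.le⟩)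
    exact ⟨x, hx.1, hxy⟩

/-- `R` is proportional to the fourth root of the energy, which is linear in the data. -/
lemma sInfinity_smul (hΛ : 0 < Λ) (hE : 0 < energy f₀) {lam : ℝ} (hl : 0 < lam) :
    sInfinity Λ b (lam • f₀) = lam ^ ((b - 3) / 4) * sInfinity Λ b f₀ := by
  have hH := hubble_pos hΛ
  rw [sInfinity, sInfinity, ← integral_const_mul]
  refine setIntegral_congr_fun measurableSet_Ioi fun t ht => ?_
  have hR := scaleFactor_pos (f₀ := f₀) hΛ hE ht
  have h1 : scaleFactor Λ (lam • f₀) t = lam ^ (1 / 4 : ℝ) * scaleFactor Λ f₀ t := by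
    rw [scaleFactor, scaleFactor, scaleConst, scaleConst, energy_smul, mul_left_comm, Real.mul_rpow hl.le (by positivity),
      mul_assoc]
  simp only [h1]
  rw [Real.mul_rpow (by positivity) hR.le, ← Real.rpow_mul hl.le]
  congr 2; ring

/-- The algebra of the second Einstein equation, with `q = √(sinh 2Ht)` and `c = cosh 2Ht` treated
as free variables subject to `c² = (q²)² + 1`. -/
lemma friedmann_aux {C H q c S : ℝ} (hC : C ≠ 0) (hq : q ≠ 0) (hc : c ^ 2 = (q ^ 2) ^ 2 + 1) (hS : S = q ^ 2) :
    C * ((S * (2 * H) * (2 * H) * (2 * q) - c * (2 * H) * (2 * (c * (2 * H) / (2 * q)))) / (2 * q) ^ 2) / (C * q) =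
      -(H ^ 2 / (q ^ 2) ^ 2) + H ^ 2 := by
  have e : C * ((S * (2 * H) * (2 * H) * (2 * q) - c * (2 * H) * (2 * (c * (2 * H) / (2 * q)))) / (2 * q) ^ 2) / (C * q) =
      2 * H ^ 2 - H ^ 2 * c ^ 2 / (q ^ 2) ^ 2 := by
    rw [hS]; field_simp
  rw [e, hc]
  field_simp
  ring

/-- The Friedmann equations for radiation and a cosmological constant. -/
lemma solvesEinstein (hΛ : 0 < Λ) (hE : 0 < energy f₀) {F : ℝ → L1} (hF : ∀ t, 0 < t → energy (F t) = energy f₀) :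
    SolvesEinstein Λ (scaleFactor Λ f₀) (energyDensity (scaleFactor Λ f₀) F) := by
  have hH := hubble_pos hΛ
  have hH2 := hubble_sq hΛ
  have hC := scaleConst_pos hΛ hE
  have hC4 := scaleConst_pow_four hΛ hE
  set H := hubble Λ
  set C := scaleConst Λ f₀
  have hsin : ∀ t, HasDerivAt (fun t => Real.sinh (2 * H * t)) (Real.cosh (2 * H * t) * (2 * H)) t := fun t => by
    simpa using ((hasDerivAt_id' t).const_mul (2 * H)).sinh
  have hcos : ∀ t, HasDerivAt (fun t => Real.cosh (2 * H * t)) (Real.sinh (2 * H * t) * (2 * H)) t := fun t => by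
    simpa using ((hasDerivAt_id' t).const_mul (2 * H)).cosh
  have hpos : ∀ t, 0 < t → 0 < Real.sinh (2 * H * t) := fun t ht => sinh_pos_of_pos hΛ ht
  have hd1 : ∀ t, 0 < t → HasDerivAt (scaleFactor Λ f₀) (C * (Real.cosh (2 * H * t) * (2 * H) /
      (2 * √(Real.sinh (2 * H * t))))) t := fun t ht => ((hsin t).sqrt (hpos t ht).ne').const_mul C
  -- Conserved energy and the normalisation of `C₂` turn the matter term into `H²/sinh²`; the first
  -- equation then reduces to `cosh² = sinh² + 1`.
  have hρ : ∀ t, 0 < t → 8 * Real.pi / 3 * energyDensity (scaleFactor Λ f₀) F t = H ^ 2 / Real.sinh (2 * H * t) ^ 2 := by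
    intro t ht
    have hs := hpos t ht
    have h4 : scaleFactor Λ f₀ t ^ 4 = C ^ 4 * Real.sinh (2 * H * t) ^ 2 := by
      rw [scaleFactor, mul_pow, show (4 : ℕ) = 2 * 2 from rfl, pow_mul √_, Real.sq_sqrt hs.le]
    rw [energyDensity, hF t ht, h4, hC4]
    field_simp
  refine ⟨fun t ht => scaleFactor_pos hΛ hE ht, ?_, ?_, fun t ht => ?_, fun t ht => ?_⟩
  · have := (continuous_scaleFactor (Λ := Λ) (f₀ := f₀)).tendsto 0
    rw [scaleFactor_of_nonpos hΛ le_rfl] at this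
    exact this.mono_left nhdsWithin_le_nhds
  · refine contDiffOn_const.mul (ContDiffOn.sqrt ?_ fun t ht => (hpos t ht).ne')
    exact (Real.contDiff_sinh.comp (contDiff_const.mul contDiff_id)).contDiffOn
  · have hs := hpos t ht
    have hq : 0 < √(Real.sinh (2 * H * t)) := Real.sqrt_pos.2 hs
    have hq2 := Real.sq_sqrt hs.le
    rw [(hd1 t ht).deriv, hρ t ht, ← hH2]
    have e : C * (Real.cosh (2 * H * t) * (2 * H) / (2 * √(Real.sinh (2 * H * t)))) / scaleFactor Λ f₀ t =
        H * Real.cosh (2 * H * t) / Real.sinh (2 * H * t) := by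
      change _ / (C * √(Real.sinh (2 * H * t))) = _
      rw [← hq2]
      field_simp
      rw [hq2]
      exact hq2.symm
    rw [e, div_pow, mul_pow, Real.cosh_sq]
    field_simp
    ring
  · have hs := hpos t ht
    have hq : 0 < √(Real.sinh (2 * H * t)) := Real.sqrt_pos.2 hs
    have hq2 := Real.sq_sqrt hs.le
    have hev : deriv (scaleFactor Λ f₀) =ᶠ[𝓝 t] fun t => C * (Real.cosh (2 * H * t) * (2 * H) /
        (2 * √(Real.sinh (2 * H * t)))) := by
      filter_upwards [lt_mem_nhds ht] with x hx using (hd1 x hx).deriv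
    have hd2 : HasDerivAt (fun t => C * (Real.cosh (2 * H * t) * (2 * H) / (2 * √(Real.sinh (2 * H * t))))) _ t :=
      ((((hcos t).mul_const (2 * H)).div (((hsin t).sqrt hs.ne').const_mul 2) (by positivity)).const_mul C)
    have hc := Real.cosh_sq (2 * H * t)
    rw [hev.deriv_eq, hd2.deriv, neg_mul, hρ t ht, ← hH2]
    change _ / (C * √(Real.sinh (2 * H * t))) = _
    rw [← hq2] at hc
    refine (friedmann_aux hC.ne' hq.ne' hc hq2.symm).trans ?_
    rw [hq2]

end

section

variable {κ b T lam : ℝ} {f₀ : L1}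

/-! ### Rescaling -/

lemma collIntegrand_congr {f g : Mom → ℝ} (h : f =ᵐ[volume] g) :
    ∀ᵐ p : Mom, collIntegrand κ b f p =ᵐ[collMeasure] collIntegrand κ b g p := by
  have hq : ∀ᵐ z ∂collMeasure, f z.1 = g z.1 := Measure.quasiMeasurePreserving_fst.ae h
  filter_upwards [h, ae_postMom h] with p h1 h2
  filter_upwards [hq, h2] with z h3 h4
  simp only [collIntegrand, gainLoss]
  rw [h1, h3, h4.1, h4.2]

lemma collIntegrand_smul (f : L1) : ∀ᵐ p : Mom,
    collIntegrand κ b (lam • f : L1) p =ᵐ[collMeasure] fun z => lam ^ 2 * collIntegrand κ b f p z := by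
  filter_upwards [collIntegrand_congr (κ := κ) (b := b) (Lp.coeFn_smul lam f)] with p hp
  filter_upwards [hp] with z hz
  rw [hz]
  simp only [collIntegrand, gainLoss, Pi.smul_apply, smul_eq_mul]
  ring

lemma IsIsotropic.smul {f : L1} (h : IsIsotropic f) (lam : ℝ) : IsIsotropic (lam • f) := by
  obtain ⟨φ, hφ, hp⟩ := h
  refine ⟨fun r => lam * φ r, hφ.const_mul _, ?_⟩
  filter_upwards [hp, Lp.coeFn_smul lam f] with p h1 h2
  rw [h2, Pi.smul_apply, h1, smul_eq_mul]

lemma smul_nonneg_of_nonneg {f : L1} (h : 0 ≤ f) (hl : 0 ≤ lam) : 0 ≤ lam • f := by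
  rw [← Lp.coeFn_nonneg] at *
  filter_upwards [h, Lp.coeFn_smul lam f] with p h1 h2
  rw [h2]; exact mul_nonneg hl h1

/-- Rescaling of solutions. -/
lemma IsSolution.smul {f : ℝ → L1} (h : IsSolution κ b T f₀ f) (hl : 0 < lam) :
    IsSolution κ b (lam⁻¹ * T) (lam • f₀) (fun s => lam • f (lam * s)) := by
  have hmaps : MapsTo (fun s => lam * s) (Icc 0 (lam⁻¹ * T)) (Icc 0 T) := by
    intro s hs
    refine ⟨mul_nonneg hl.le hs.1, ?_⟩
    have := mul_le_mul_of_nonneg_left hs.2 hl.le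
    rwa [mul_inv_cancel_left₀ hl.ne'] at this
  obtain ⟨C, hC⟩ := h.moments
  obtain ⟨g, hg, hd⟩ := h.equation
  refine ⟨by simp only [mul_zero, h.init], fun s hs => smul_nonneg_of_nonneg (h.nonneg _ (hmaps hs)) hl.le,
    fun s hs => (h.isotropic _ (hmaps hs)).smul lam, ⟨lam * C, fun s hs m h₁ h₂ => ?_⟩, fun s hs => ?_,
    fun s => lam • lam • g (lam * s), ?_, fun s hs => ⟨?_, ?_⟩⟩
  · obtain ⟨h1, h2⟩ := hC _ (hmaps hs) m h₁ h₂
    have he : (fun p : Mom => lam * (f (lam * s) p * ‖p‖ ^ m)) =ᵐ[volume]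
        fun p => (lam • f (lam * s) : L1) p * ‖p‖ ^ m := by
      filter_upwards [Lp.coeFn_smul lam (f (lam * s))] with p hp
      rw [hp, Pi.smul_apply, smul_eq_mul, mul_assoc]
    refine ⟨(h1.const_mul lam).congr he, ?_⟩
    rw [← integral_congr_ae he, integral_const_mul]
    exact mul_le_mul_of_nonneg_left h2 hl.le
  · filter_upwards [h.converges _ (hmaps hs), collIntegrand_smul (κ := κ) (b := b) (lam := lam) (f (lam * s))]
      with p h1 h2
    exact (h1.const_mul _).congr h2.symm
  · exact ((hg.comp (by fun_prop) hmaps).const_smul lam).const_smul lam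
  · have h1 := HasDerivWithinAt.scomp s (hd _ (hmaps hs)).1
      (((hasDerivAt_id' s).const_mul lam).hasDerivWithinAt) hmaps
    rw [mul_one] at h1
    exact h1.const_smul lam
  · filter_upwards [(hd _ (hmaps hs)).2, collIntegrand_smul (κ := κ) (b := b) (lam := lam) (f (lam * s)),
      Lp.coeFn_smul lam (lam • g (lam * s)), Lp.coeFn_smul lam (g (lam * s))] with p h1 h2 h3 h4
    rw [h3, Pi.smul_apply, h4, Pi.smul_apply, h1, collision, collision, integral_congr_ae h2, integral_const_mul,
      smul_eq_mul, smul_eq_mul]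
    ring

lemma ExistsUpTo.smul (h : ExistsUpTo κ b f₀ T) (hl : 0 < lam) : ExistsUpTo κ b (lam • f₀) (lam⁻¹ * T) := by
  obtain ⟨f, hf⟩ := h
  exact ⟨_, hf.smul hl⟩

lemma existsUpTo_smul_iff (hl : 0 < lam) : ExistsUpTo κ b f₀ T ↔ ExistsUpTo κ b (lam • f₀) (lam⁻¹ * T) := by
  refine ⟨fun h => h.smul hl, fun h => ?_⟩
  have := h.smul (inv_pos.2 hl)
  rwa [inv_inv, mul_inv_cancel_left₀ hl.ne', inv_smul_smul₀ hl.ne'] at this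

lemma le_existenceTime (hT : 0 < T) (h : ExistsUpTo κ b f₀ T) : ENNReal.ofReal T ≤ existenceTime κ b f₀ :=
  le_iSup₂_of_le (f := fun (T : ℝ) (_ : 0 < T ∧ ExistsUpTo κ b f₀ T) => ENNReal.ofReal T) T ⟨hT, h⟩ le_rfl

lemma mul_existenceTime_le (hl : 0 < lam) :
    ENNReal.ofReal lam⁻¹ * existenceTime κ b f₀ ≤ existenceTime κ b (lam • f₀) := by
  conv_lhs => rw [existenceTime]
  simp only [ENNReal.mul_iSup]
  refine iSup₂_le fun T hT => ?_
  rw [← ENNReal.ofReal_mul (inv_pos.2 hl).le]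
  exact le_existenceTime (mul_pos (inv_pos.2 hl) hT.1) (hT.2.smul hl)

/-- One inequality for all positive factors is enough: applied to `lam⁻¹` and the rescaled data, it
gives the reverse. -/
lemma existenceTime_smul (hl : 0 < lam) :
    existenceTime κ b (lam • f₀) = ENNReal.ofReal lam⁻¹ * existenceTime κ b f₀ := by
  refine le_antisymm ?_ (mul_existenceTime_le hl)
  have h := mul_existenceTime_le (κ := κ) (b := b) (f₀ := lam • f₀) (inv_pos.2 hl)
  rw [inv_inv, inv_smul_smul₀ hl.ne'] at h
  calc existenceTime κ b (lam • f₀) = ENNReal.ofReal lam⁻¹ * (ENNReal.ofReal lam * existenceTime κ b (lam • f₀)) := by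
        rw [← mul_assoc, ← ENNReal.ofReal_mul (inv_pos.2 hl).le, inv_mul_cancel₀ hl.ne', ENNReal.ofReal_one, one_mul]
    _ ≤ _ := by gcongr

lemma ofReal_mul_div_ofReal_mul (hl : 0 < lam) {s : ℝ} (x : ℝ≥0∞) :
    ENNReal.ofReal lam⁻¹ * x / ENNReal.ofReal (lam ^ ((b - 3) / 4) * s) =
      ENNReal.ofReal (lam ^ (-(1 + b) / 4)) * (x / ENNReal.ofReal s) := by
  have h1 : 0 < lam ^ ((b - 3) / 4) := by positivity
  have h2 : lam ^ (-(1 + b) / 4) = lam⁻¹ * (lam ^ ((b - 3) / 4))⁻¹ := by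
    rw [← Real.rpow_neg_one, ← Real.rpow_neg hl.le, ← Real.rpow_add hl]
    congr 1; ring
  rw [h2]
  generalize lam ^ ((b - 3) / 4) = A at h1
  rw [ENNReal.ofReal_mul h1.le, ENNReal.ofReal_mul (inv_pos.2 hl).le, ENNReal.ofReal_inv_of_pos h1,
    div_eq_mul_inv, div_eq_mul_inv, ENNReal.mul_inv (Or.inl (ENNReal.ofReal_pos.2 h1).ne') (Or.inl ENNReal.ofReal_ne_top)]
  ring

/-- The ratio of the two sides is `lam^((1+b)/4)` times `s/T`. Requiring it to be at most `1/2`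
gives the strict inequality and the value of `lam₀`. -/
lemma exists_smallness (hb₁ : 1 < b) {s : ℝ} (hT : 0 < T) (hs : 0 < s) :
    ∃ lam₀ : ℝ, 0 < lam₀ ∧ ∀ lam : ℝ, 0 < lam → lam ≤ lam₀ → lam ^ ((b - 3) / 4) * s < lam⁻¹ * T := by
  have he : 0 < (1 + b) / 4 := by linarith
  refine ⟨(T / (2 * s)) ^ ((1 + b) / 4)⁻¹, by positivity, fun lam hl hle => ?_⟩
  have h1 : lam ^ ((1 + b) / 4) ≤ T / (2 * s) := by
    have := Real.rpow_le_rpow hl.le hle he.le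
    rwa [← Real.rpow_mul (by positivity), inv_mul_cancel₀ he.ne', Real.rpow_one] at this
  have h2 : lam ^ ((b - 3) / 4) = lam⁻¹ * lam ^ ((1 + b) / 4) := by
    rw [← Real.rpow_neg_one, ← Real.rpow_add hl]
    congr 1; ring
  rw [h2, mul_assoc]
  refine mul_lt_mul_of_pos_left ?_ (inv_pos.2 hl)
  calc lam ^ ((1 + b) / 4) * s ≤ T / (2 * s) * s := by gcongr
    _ = T / 2 := by field_simp
    _ < T := by linarith

/-! ### Proper time -/

/-- `h²σ(h) = κ h^(2-b)` is homogeneous of degree `2 - b` in `h = ϱ/R`. At `ϱ = 0` both sides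
vanish, the right-hand one because `2 - b ≠ 0`. -/
lemma physIntegrand_eq (hb : b < 2) {R : ℝ} (hR : 0 < R) (f : Mom → ℝ) (p : Mom) (z : Mom × Sph) :
    physIntegrand κ b R f p z = R ^ (b - 2) * collIntegrand κ b f p z := by
  have h : (relMom p z.1 / R) ^ 2 * (relMom p z.1 / R) ^ (-b) = R ^ (b - 2) * relMom p z.1 ^ (2 - b) := by
    rcases (relMom_nonneg p z.1).eq_or_lt with h | h
    · rw [← h, Real.zero_rpow (by linarith : 2 - b ≠ 0)]; simp
    · rw [← Real.rpow_two, ← Real.rpow_add (by positivity), Real.div_rpow h.le hR.le, div_eq_mul_inv, ← Real.rpow_neg hR.le,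
        mul_comm, show 2 + -b = 2 - b by ring, show -(2 - b) = b - 2 by ring]
  rw [physIntegrand, collIntegrand, crossSection]
  calc _ = κ * ((relMom p z.1 / R) ^ 2 * (relMom p z.1 / R) ^ (-b)) / (‖p‖ * ‖z.1‖) * gainLoss f p z.1 (z.2 : Mom) := by
        ring
    _ = _ := by rw [h]; ring

lemma IsSolution.continuousOn {f : ℝ → L1} (h : IsSolution κ b T f₀ f) : ContinuousOn f (Icc 0 T) := by
  obtain ⟨g, -, hg⟩ := h.equation
  exact fun s hs => (hg s hs).1.continuousWithinAt

/-- The chain rule: the factor `R⁻¹ · R^(b-2)` in front of the collision integral equals `ds/dt =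
R^(b-3)`. -/
lemma IsSolution.isProperTimeSolution {Λ : ℝ} {f : ℝ → L1} (h : IsSolution κ b T f₀ f) (hΛ : 0 < Λ)
    (hE : 0 < energy f₀) (hb₁ : 1 < b) (hb : b < 2) (hT : sInfinity Λ b f₀ < T) :
    IsProperTimeSolution κ b (scaleFactor Λ f₀) f₀ (fun t => f (sTime Λ b f₀ t)) := by
  have hmem : ∀ t, 0 ≤ t → sTime Λ b f₀ t ∈ Icc 0 T := fun t ht =>
    ⟨sTime_nonneg hΛ hE hb₁ hb ht, ((sTime_lt_sInfinity hΛ hE hb₁ hb ht).trans hT).le⟩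
  have hR : ∀ t, 0 < t → 0 < scaleFactor Λ f₀ t := fun t ht => scaleFactor_pos hΛ hE ht
  have hsc := continuous_sTime (f₀ := f₀) hΛ hE hb₁ hb
  obtain ⟨C, hC⟩ := h.moments
  obtain ⟨g, hg, hd⟩ := h.equation
  refine ⟨by simp only [sTime_zero, h.init], h.continuousOn.comp hsc.continuousOn fun t ht => hmem t ht,
    fun t ht => h.nonneg _ (hmem t ht), fun t ht => h.isotropic _ (hmem t ht),
    ⟨C, fun t ht => hC _ (hmem t ht)⟩, fun t ht => ?_,
    fun t => scaleFactor Λ f₀ t ^ (b - 3) • g (sTime Λ b f₀ t), ?_, fun t ht => ⟨?_, ?_⟩⟩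
  · filter_upwards [h.converges _ (hmem t ht.le)] with p hp
    refine (hp.const_mul (scaleFactor Λ f₀ t ^ (b - 2))).congr (.of_forall fun z => ?_)
    rw [physIntegrand_eq hb (hR t ht)]
  · refine ContinuousOn.smul (fun t ht => (continuousAt_scaleFactor_rpow hΛ hE ht).continuousWithinAt) ?_
    exact hg.comp hsc.continuousOn fun t ht => hmem t (le_of_lt ht)
  · have hs0 : 0 < sTime Λ b f₀ t := by
      have := strictMonoOn_sTime (f₀ := f₀) hΛ hE hb₁ hb self_mem_Ici (mem_Ici.2 ht.le) ht
      rwa [sTime_zero] at this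
    -- For `t > 0` the time `s(t)` lies strictly between `0` and `T`, so the derivative within the
    -- interval is a full derivative.
    have h1 := (hd _ (hmem t ht.le)).1.hasDerivAt
      (Icc_mem_nhds hs0 ((sTime_lt_sInfinity hΛ hE hb₁ hb ht.le).trans hT))
    exact h1.scomp t (hasDerivAt_sTime hΛ hE hb₁ hb ht)
  · have hRt := hR t ht
    filter_upwards [(hd _ (hmem t ht.le)).2,
      Lp.coeFn_smul (scaleFactor Λ f₀ t ^ (b - 3)) (g (sTime Λ b f₀ t))] with p h1 h2
    rw [h2, Pi.smul_apply, h1, collision]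
    simp only [physIntegrand_eq hb hRt]
    rw [integral_const_mul, smul_eq_mul, ← mul_assoc, ← Real.rpow_neg_one, ← Real.rpow_add hRt]
    congr 2; ring

end

end FLRWBoltzmann

end

theorem mainTheorem3 (Λ κ b : ℝ) (hΛ : 0 < Λ) (hκ : 0 < κ) (hb₁ : 1 < b) (hb₂ : b < 2)
    (f₀ : L1) (hf₀ : IsData f₀) :
    -- the whole range `0 ≤ t < ∞` of proper time corresponds to the finite interval `[0, s_∞)`
    (IntegrableOn (fun t => scaleFactor Λ f₀ t ^ (b - 3)) (Ioi 0) ∧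
      0 < sInfinity Λ b f₀ ∧
      sTime Λ b f₀ 0 = 0 ∧
      ContinuousOn (sTime Λ b f₀) (Ici 0) ∧
      StrictMonoOn (sTime Λ b f₀) (Ici 0) ∧
      (∀ t, 0 < t → HasDerivAt (sTime Λ b f₀) (scaleFactor Λ f₀ t ^ (b - 3)) t) ∧
      sTime Λ b f₀ '' Ici 0 = Ico 0 (sInfinity Λ b f₀)) ∧
    -- the effect of the rescaling `f₀ → lam f₀`
    (0 < existenceTime κ b f₀ ∧
      ∀ lam : ℝ, 0 < lam →
        (∀ T : ℝ, 0 < T → (ExistsUpTo κ b f₀ T ↔ ExistsUpTo κ b (lam • f₀) (lam⁻¹ * T))) ∧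
        existenceTime κ b (lam • f₀) = ENNReal.ofReal lam⁻¹ * existenceTime κ b f₀ ∧
        sInfinity Λ b (lam • f₀) = lam ^ ((b - 3) / 4) * sInfinity Λ b f₀ ∧
        existenceTime κ b (lam • f₀) / ENNReal.ofReal (sInfinity Λ b (lam • f₀)) =
          ENNReal.ofReal (lam ^ (-(1 + b) / 4)) *
            (existenceTime κ b f₀ / ENNReal.ofReal (sInfinity Λ b f₀))) ∧
    -- for small data the solution exists beyond `s_∞`, that is, for all proper time
    (∃ lam₀ : ℝ, 0 < lam₀ ∧ ∀ lam : ℝ, 0 < lam → lam ≤ lam₀ →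
      ∃ T : ℝ, sInfinity Λ b (lam • f₀) < T ∧
        ∃ f : ℝ → L1, IsSolution κ b T (lam • f₀) f ∧
          (∀ g : ℝ → L1, IsSolution κ b T (lam • f₀) g → EqOn g f (Icc 0 T)) ∧
          IsProperTimeSolution κ b (scaleFactor Λ (lam • f₀)) (lam • f₀)
            (fun t => f (sTime Λ b (lam • f₀) t)) ∧
          SolvesEinstein Λ (scaleFactor Λ (lam • f₀))
            (energyDensity (scaleFactor Λ (lam • f₀))
              (fun t => f (sTime Λ b (lam • f₀) t)))) := by
  have hE := hf₀.energy_pos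
  obtain ⟨T₀, hT₀, hex⟩ := hf₀.exists_existsUpTo hκ hb₁ hb₂
  refine ⟨⟨(integrable_scaleFactor_rpow hΛ hE hb₁ hb₂).integrableOn, sInfinity_pos hΛ hE hb₁ hb₂, sTime_zero,
    (continuous_sTime hΛ hE hb₁ hb₂).continuousOn, strictMonoOn_sTime hΛ hE hb₁ hb₂,
    fun t ht => hasDerivAt_sTime hΛ hE hb₁ hb₂ ht, image_sTime hΛ hE hb₁ hb₂⟩,
    ⟨(ENNReal.ofReal_pos.2 hT₀).trans_le (le_existenceTime hT₀ hex), fun lam hl =>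
      ⟨fun T _ => existsUpTo_smul_iff hl, existenceTime_smul hl, sInfinity_smul hΛ hE hl, ?_⟩⟩, ?_⟩
  · rw [existenceTime_smul hl, sInfinity_smul hΛ hE hl, ofReal_mul_div_ofReal_mul hl]
  · obtain ⟨lam₀, hlam₀, hsmall⟩ := exists_smallness hb₁ hT₀ (sInfinity_pos (f₀ := f₀) hΛ hE hb₁ hb₂)
    -- The solution is the local one for `f₀` on `[0, T₀]`, rescaled; its lifespan `lam⁻¹ * T₀`
    -- already exceeds `s_∞` of the rescaled data.
    refine ⟨lam₀, hlam₀, fun lam hl hle => ⟨lam⁻¹ * T₀, ?_, ?_⟩⟩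
    · rw [sInfinity_smul hΛ hE hl]; exact hsmall lam hl hle
    · have hT : sInfinity Λ b (lam • f₀) < lam⁻¹ * T₀ := by
        rw [sInfinity_smul hΛ hE hl]; exact hsmall lam hl hle
      have hdata := hf₀.smul hl
      have hE' := hdata.energy_pos
      obtain ⟨f, hf⟩ := hex.smul hl
      refine ⟨f, hf, fun g hg => hg.eqOn hdata hκ hb₁ hb₂ hf, hf.isProperTimeSolution hΛ hE' hb₁ hb₂ hT,
        solvesEinstein hΛ hE' fun t ht => hf.energy_eq hκ hb₁ hb₂
          ⟨sTime_nonneg hΛ hE' hb₁ hb₂ ht.le, ((sTime_lt_sInfinity hΛ hE' hb₁ hb₂ ht.le).trans hT).le⟩⟩
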